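/- Let $p$ be a prime, let $K_0$ be a finite unramified extension of $\mathbb{Q}_p$ of degree $f=[K_0:\mathbb{Q}_p]$, let $\mathrm{Frob}_p$ be the automorphism of $K_0$ which induces the $p$-power map on its residue field, and let $d\ge 0$ be an integer. For a $\mathbb{Q}_p$-algebra $R$ write $\phi=\mathrm{id}_R\otimes\mathrm{Frob}_p$ for the induced endomorphism of $R\otimes_{\mathbb{Q}_p}K_0$, applied to matrices entrywise. Let $$P_{K_0,d}\;\subset\;\mathrm{Res}_{K_0/\mathbb{Q}_p}\mathrm{GL}_{d}\times_{\mathbb{Q}_p}\mathrm{Res}_{K_0/\mathbb{Q}_p}\mathrm{Mat}_{d\times d}$$ be the closed subscheme whose $R$-valued points are the pairs $(\Phi,N)$ with $\Phi\in\mathrm{GL}_d(R\otimes_{\mathbb{Q}_p}K_0)$, $N\in\mathrm{Mat}_{d\times d}(R\otimes_{\mathbb{Q}_p}K_0)$ and $N\,\Phi=p\,\Phi\,\phi(N)$. Write $\Phi^f:=\Phi\,\phi(\Phi)\cdots\phi^{f-1}(\Phi)$. For a point $y$ of $P_{K_0,d}$, an algebraic closure $L$ of its residue field and a $\mathbb{Q}_p$-embedding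 $\sigma\colon K_0\to L$, let $(\Phi^f)_0$ and $N_0$ be the $d\times d$ matrices over $L$ obtained from the values of $\Phi^f$ and $N$ at $y$ by applying $L\otimes_{\mathbb{Q}_p}K_0\to L$, $a\otimes b\mapsto a\,\sigma(b)$, to the entries. (a) The $\mathbb{Q}_p$-scheme $P_{K_0,d}$ is reduced, Cohen–Macaulay, generically smooth over $\mathbb{Q}_p$, and equidimensional of dimension $fd^2$. At the generic point of each irreducible component of $P_{K_0,d}$, and for every $\sigma$, the matrix $(\Phi^f)_0$ has no multiple eigenvalues. (b) There is a bijection between the partitions $d=k_1+\dots+k_m$, $1\le k_1\le\dots\le k_m$, and the generic points of the irreducible components of $P_{K_0,d}$, such that for every generic point $y$, every $\sigma$ and every partition $(k_1,\dots,k_m)$ of $d$ the following are equivalent: 1. $y$ is the generic point corresponding to $(k_1,\dots,k_m)$; 2. the eigenvalues of $(\Phi^f)_0$ at $y$ can be ordered as $\lambda_1,\dots,\lambda_d$ in such a way that, for all $i,j$, one has $p^f\lambda_i=\lambda_j$ if and only if $j=i+1$ and $i\notin\{k_1,\,k_1+k_2,\,\dots,\,k_1+\dots+k_m\}$; 3.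 the endomorphism $N_0$ at $y$ is nilpotent and its Jordan canonical form has $m$ Jordan blocks, of sizes $k_1,\dots,k_m$. -/

import Mathlib

open scoped TensorProduct
open AlgebraicGeometry CategoryTheory

universe u

noncomputable section

/-! ### General notions for schemes -/

/-- A Noetherian local ring is Cohen–Macaulay if its depth equals its Krull dimension, i.e. if there
is a regular sequence (automatically contained in the maximal ideal) of length `dim R`. -/
structure IsCohenMacaulayLocalRing (R : Type u) [CommRing R] [IsLocalRing R] : Prop where
  noetherian : IsNoetherianRing R
  exists_isRegular : ∃ rs : List R,
    RingTheory.Sequence.IsRegular R rs ∧ ((rs.length : ℕ∞) : WithBot ℕ∞) = ringKrullDim R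

/-- A scheme is Cohen–Macaulay if it is locally Noetherian and all its local rings are
Cohen–Macaulay. -/
def IsCohenMacaulayScheme (X : Scheme.{u}) : Prop :=
  IsLocallyNoetherian X ∧ ∀ x : X, IsCohenMacaulayLocalRing (X.presheaf.stalk x)

/-- A morphism `X ⟶ Y` is generically smooth if it is smooth on a dense open subscheme of `X`. -/
def IsGenericallySmooth {X Y : Scheme.{u}} (f : X ⟶ Y) : Prop :=
  ∃ U : X.Opens, Dense (U : Set X) ∧ AlgebraicGeometry.Smooth (U.ι ≫ f)

/-- Every irreducible component has Krull dimension `n`. -/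
def IsEquidimensionalOfDim (X : Scheme.{u}) (n : ℕ) : Prop :=
  ∀ Z ∈ irreducibleComponents X, topologicalKrullDim Z = n

namespace PhiNModule

/-! ### Finite unramified extensions of `ℚ_p` and their Frobenius -/

section Frobenius

variable (p : ℕ) [Fact p.Prime] (K₀ : Type u) [Field K₀] [Algebra ℤ_[p] K₀]

/-- The finite extension `K₀` of `ℚ_p`, with ring of integers `W`, is unramified: `p` generates the
maximal ideal of `W` (the residue field being finite, no separability condition is needed). -/
def IsUnramified : Prop :=
  (Ideal.span {(p : integralClosure ℤ_[p] K₀)}).IsMaximal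

variable [Algebra ℚ_[p] K₀]

/-- `φ` is the Frobenius automorphism of `K₀`: it induces the `p`-power map on the residue field
`W / pW`, where `W` is the ring of integers of `K₀`. -/
def IsFrobenius (φ : K₀ ≃ₐ[ℚ_[p]] K₀) : Prop :=
  ∀ x : integralClosure ℤ_[p] K₀, ∃ y : integralClosure ℤ_[p] K₀,
    φ (x : K₀) = (x : K₀) ^ p + (p : K₀) * (y : K₀)

end Frobenius

/-! ### The scheme of pairs `(Φ, N)` -/

section Moduli

variable (p : ℕ) [Fact p.Prime] {K₀ : Type u} [Field K₀] [Algebra ℚ_[p] K₀]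

/-- The endomorphism `id ⊗ Frob_p` of `R ⊗ K₀`. -/
def frob (φ : K₀ ≃ₐ[ℚ_[p]] K₀) (R : Type*) [CommRing R] [Algebra ℚ_[p] R] :
    (R ⊗[ℚ_[p]] K₀) →ₐ[ℚ_[p]] (R ⊗[ℚ_[p]] K₀) :=
  Algebra.TensorProduct.map (AlgHom.id ℚ_[p] R) (φ : K₀ →ₐ[ℚ_[p]] K₀)

/-- The relation `N Φ = p Φ φ(N)` for matrices over `R ⊗ K₀`. -/
def PhiNRel (φ : K₀ ≃ₐ[ℚ_[p]] K₀) {R : Type*} [CommRing R] [Algebra ℚ_[p] R] {d : ℕ}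
    (Φ N : Matrix (Fin d) (Fin d) (R ⊗[ℚ_[p]] K₀)) : Prop :=
  N * Φ = (p : R ⊗[ℚ_[p]] K₀) • (Φ * N.map (frob p φ R))

/-- Base change of a matrix over `R ⊗ K₀` along `g : R → S`. -/
def baseChange {R S : Type*} [CommRing R] [Algebra ℚ_[p] R] [CommRing S] [Algebra ℚ_[p] S]
    (g : R →ₐ[ℚ_[p]] S) {d : ℕ} (M : Matrix (Fin d) (Fin d) (R ⊗[ℚ_[p]] K₀)) :
    Matrix (Fin d) (Fin d) (S ⊗[ℚ_[p]] K₀) :=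
  M.map (Algebra.TensorProduct.map g (AlgHom.id ℚ_[p] K₀))

variable [FiniteDimensional ℚ_[p] K₀]

variable (K₀) in
/-- The index set of the coordinates of three `d × d` matrices with entries in `R ⊗ K₀`; the last
index runs through a basis of `K₀` over `ℚ_p`. -/
abbrev Idx (d : ℕ) : Type := Fin 3 × Fin d × Fin d × Fin (Module.finrank ℚ_[p] K₀)

variable (K₀) in
/-- The coordinate ring of the affine space `(Res_{K₀/ℚ_p} Mat_{d × d})³`. -/
abbrev PolyRing (d : ℕ) : Type := MvPolynomial (Idx p K₀ d) ℚ_[p]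

variable (K₀) in
/-- The coordinates of an element of `R ⊗ K₀` with respect to a basis of `K₀` over `ℚ_p`. -/
def coords (R : Type*) [CommRing R] [Algebra ℚ_[p] R] :
    Module.Basis (Fin (Module.finrank ℚ_[p] K₀)) R (R ⊗[ℚ_[p]] K₀) :=
  Algebra.TensorProduct.basis R (Module.finBasis ℚ_[p] K₀)

variable (K₀) in
/-- The `s`-th generic `d × d` matrix, with entries in `ℚ_p[X] ⊗ K₀`: the matrices for `s = 0, 1, 2`
are denoted by `Φ`, `Φ'`, `N`. -/
def genMat (d : ℕ) (s : Fin 3) : Matrix (Fin d) (Fin d) (PolyRing p K₀ d ⊗[ℚ_[p]] K₀) :=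
  Matrix.of fun i j => ∑ k, (MvPolynomial.X (s, i, j, k) : PolyRing p K₀ d) • coords p K₀ _ k

/-- The ideal generated by the coordinates of the entries of `Φ Φ' - 1` and of
`N Φ - p Φ φ(N)`. The first relation makes `Φ` invertible (with inverse `Φ'`). -/
def relIdeal (φ : K₀ ≃ₐ[ℚ_[p]] K₀) (d : ℕ) : Ideal (PolyRing p K₀ d) :=
  Ideal.span
    ({a | ∃ i j k, a = (coords p K₀ _).repr ((genMat p K₀ d 0 * genMat p K₀ d 1 - 1) i j) k} ∪
     {a | ∃ i j k, a = (coords p K₀ _).repr ((genMat p K₀ d 2 * genMat p K₀ d 0 -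
        (p : PolyRing p K₀ d ⊗[ℚ_[p]] K₀) •
          (genMat p K₀ d 0 * (genMat p K₀ d 2).map (frob p φ _))) i j) k})

/-- The coordinate ring of `P_{K₀,d}`. -/
def PRing (φ : K₀ ≃ₐ[ℚ_[p]] K₀) (d : ℕ) : Type := PolyRing p K₀ d ⧸ relIdeal p φ d

instance (φ : K₀ ≃ₐ[ℚ_[p]] K₀) (d : ℕ) : CommRing (PRing p φ d) :=
  inferInstanceAs (CommRing (PolyRing p K₀ d ⧸ relIdeal p φ d))

instance (φ : K₀ ≃ₐ[ℚ_[p]] K₀) (d : ℕ) : Algebra ℚ_[p] (PRing p φ d) :=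
  inferInstanceAs (Algebra ℚ_[p] (PolyRing p K₀ d ⧸ relIdeal p φ d))

/-- The quotient map onto the coordinate ring of `P_{K₀,d}`. -/
def mkP (φ : K₀ ≃ₐ[ℚ_[p]] K₀) (d : ℕ) : PolyRing p K₀ d →ₐ[ℚ_[p]] PRing p φ d :=
  Ideal.Quotient.mkₐ ℚ_[p] (relIdeal p φ d)

/-- The scheme `P_{K₀,d}`, a closed subscheme of
`Res_{K₀/ℚ_p} GL_d × Res_{K₀/ℚ_p} Mat_{d × d}`. -/
abbrev P (φ : K₀ ≃ₐ[ℚ_[p]] K₀) (d : ℕ) : Scheme.{0} := Spec (CommRingCat.of (PRing p φ d))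

/-- The structure morphism of `P_{K₀,d}`. -/
def PStruct (φ : K₀ ≃ₐ[ℚ_[p]] K₀) (d : ℕ) : P p φ d ⟶ Spec (CommRingCat.of ℚ_[p]) :=
  Spec.map (CommRingCat.ofHom (algebraMap ℚ_[p] (PRing p φ d)))

/-- The universal matrix `Φ` over `P_{K₀,d}`. -/
def univΦ (φ : K₀ ≃ₐ[ℚ_[p]] K₀) (d : ℕ) : Matrix (Fin d) (Fin d) (PRing p φ d ⊗[ℚ_[p]] K₀) :=
  baseChange p (mkP p φ d) (genMat p K₀ d 0)

/-- The universal matrix `N` over `P_{K₀,d}`. -/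
def univN (φ : K₀ ≃ₐ[ℚ_[p]] K₀) (d : ℕ) : Matrix (Fin d) (Fin d) (PRing p φ d ⊗[ℚ_[p]] K₀) :=
  baseChange p (mkP p φ d) (genMat p K₀ d 2)

/-- The matrix `Φ φ(Φ) ⋯ φ^{f-1}(Φ)` of the linear map `Φ^f`, where `f = [K₀ : ℚ_p]`. -/
def phiPow (φ : K₀ ≃ₐ[ℚ_[p]] K₀) {R : Type*} [CommRing R] [Algebra ℚ_[p] R] {d : ℕ}
    (Φ : Matrix (Fin d) (Fin d) (R ⊗[ℚ_[p]] K₀)) : Matrix (Fin d) (Fin d) (R ⊗[ℚ_[p]] K₀) :=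
  ((List.range (Module.finrank ℚ_[p] K₀)).map fun i => Φ.map ((frob p φ R)^[i])).prod

/-- The algebraic closure of the residue field of a point of `P_{K₀,d}`. -/
abbrev GeomField (φ : K₀ ≃ₐ[ℚ_[p]] K₀) (d : ℕ) (y : PrimeSpectrum (PRing p φ d)) : Type :=
  AlgebraicClosure y.asIdeal.ResidueField

/-- Given an embedding `σ` of `K₀` into the algebraically closed field `L` belonging to the point
`y`, the composition of evaluation at `y` with the projection
`L ⊗ K₀ → L`, `a ⊗ b ↦ a σ(b)`, onto the factor with index `0`. -/
def evalZero (φ : K₀ ≃ₐ[ℚ_[p]] K₀) (d : ℕ) (y : PrimeSpectrum (PRing p φ d))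
    (σ : K₀ →ₐ[ℚ_[p]] GeomField p φ d y) :
    (PRing p φ d ⊗[ℚ_[p]] K₀) →ₐ[ℚ_[p]] GeomField p φ d y :=
  Algebra.TensorProduct.productMap
    (IsScalarTower.toAlgHom ℚ_[p] (PRing p φ d) (GeomField p φ d y)) σ

/-- The matrix `(Φ^f)_0` at the point `y`. -/
def phiPowZero (φ : K₀ ≃ₐ[ℚ_[p]] K₀) (d : ℕ) (y : PrimeSpectrum (PRing p φ d))
    (σ : K₀ →ₐ[ℚ_[p]] GeomField p φ d y) : Matrix (Fin d) (Fin d) (GeomField p φ d y) :=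
  (phiPow p φ (univΦ p φ d)).map (evalZero p φ d y σ)

/-- The matrix `N_0` at the point `y`. -/
def monodromyZero (φ : K₀ ≃ₐ[ℚ_[p]] K₀) (d : ℕ) (y : PrimeSpectrum (PRing p φ d))
    (σ : K₀ →ₐ[ℚ_[p]] GeomField p φ d y) : Matrix (Fin d) (Fin d) (GeomField p φ d y) :=
  (univN p φ d).map (evalZero p φ d y σ)

end Moduli

/-! ### Partitions, chains of eigenvalues and Jordan types -/

section Partition

variable {d : ℕ}

/-- Let `k₁ ≤ ⋯ ≤ kₘ` be the parts of the partition `π` of `d`. For the 1-based positions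
`i' = i + 1`, `j' = j + 1` the condition says that `j' = i' + 1` and that `i'` is none of the
partial sums `k₁, k₁ + k₂, …, k₁ + ⋯ + kₘ`. -/
def IsLink (π : d.Partition) (i j : Fin d) : Prop :=
  (j : ℕ) = i + 1 ∧ ∀ n, ((π.parts.sort (· ≤ ·)).take n).sum ≠ i + 1

open scoped Classical in
/-- The nilpotent matrix in Jordan canonical form with blocks of sizes `k₁ ≤ ⋯ ≤ kₘ`. -/
def nilpotentJordan (π : d.Partition) (L : Type*) [Field L] : Matrix (Fin d) (Fin d) L :=
  Matrix.of fun i j => if IsLink π i j then 1 else 0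

/-- The matrix `M` is conjugate to the nilpotent Jordan matrix with block sizes given by `π`. -/
def HasNilpotentJordanType {L : Type*} [Field L] (M : Matrix (Fin d) (Fin d) L)
    (π : d.Partition) : Prop :=
  ∃ S : GL (Fin d) L, M = S.val * nilpotentJordan π L * S⁻¹.val

/-- The eigenvalues of `M` can be ordered as `c₁, …, c_d` (with multiplicity) such that
`q cᵢ = cⱼ` if and only if `j = i + 1` and `i` is none of `k₁, k₁ + k₂, …, k₁ + ⋯ + kₘ`. -/
def HasEigenvalueChains {L : Type*} [Field L] (q : ℕ) (M : Matrix (Fin d) (Fin d) L)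
    (π : d.Partition) : Prop :=
  ∃ c : Fin d → L, M.charpoly = ∏ i, (Polynomial.X - Polynomial.C (c i)) ∧
    ∀ i j, (q : L) * c i = c j ↔ IsLink π i j

end Partition

/-! ### The moduli problem represented by `P_{K₀,d}` -/

section Representability

variable (p : ℕ) [Fact p.Prime] {K₀ : Type u} [Field K₀] [Algebra ℚ_[p] K₀]

theorem coords_repr_map [FiniteDimensional ℚ_[p] K₀] {R S : Type*} [CommRing R] [Algebra ℚ_[p] R] [CommRing S] [Algebra ℚ_[p] S]
    (g : R →ₐ[ℚ_[p]] S) (z : R ⊗[ℚ_[p]] K₀) (k : Fin (Module.finrank ℚ_[p] K₀)) :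
    (coords p K₀ S).repr (Algebra.TensorProduct.map g (AlgHom.id ℚ_[p] K₀) z) k =
      g ((coords p K₀ R).repr z k) := by
  induction z using TensorProduct.induction_on with
  | zero => simp
  | tmul a b => simp [coords]
  | add x y hx hy => simp [hx, hy]

theorem frob_map (φ : K₀ ≃ₐ[ℚ_[p]] K₀) {R S : Type*} [CommRing R] [Algebra ℚ_[p] R] [CommRing S]
    [Algebra ℚ_[p] S] (g : R →ₐ[ℚ_[p]] S) (z : R ⊗[ℚ_[p]] K₀) :
    Algebra.TensorProduct.map g (AlgHom.id ℚ_[p] K₀) (frob p φ R z) =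
      frob p φ S (Algebra.TensorProduct.map g (AlgHom.id ℚ_[p] K₀) z) := by
  induction z using TensorProduct.induction_on with
  | zero => simp
  | tmul a b => simp [frob]
  | add x y hx hy => simp [hx, hy]

theorem baseChange_mul {R S : Type*} [CommRing R] [Algebra ℚ_[p] R] [CommRing S]
    [Algebra ℚ_[p] S] (g : R →ₐ[ℚ_[p]] S) {d : ℕ}
    (A B : Matrix (Fin d) (Fin d) (R ⊗[ℚ_[p]] K₀)) :
    baseChange p g (A * B) = baseChange p g A * baseChange p g B :=
  Matrix.map_mul

variable [FiniteDimensional ℚ_[p] K₀]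

/-- An evaluation of the coordinates kills the ideal of relations if and only if the evaluated
matrices satisfy the relations. -/
theorem relIdeal_le_ker_iff (φ : K₀ ≃ₐ[ℚ_[p]] K₀) (d : ℕ) {R : Type*} [CommRing R]
    [Algebra ℚ_[p] R] (g : PolyRing p K₀ d →ₐ[ℚ_[p]] R) :
    (∀ a ∈ relIdeal p φ d, g a = 0) ↔
      baseChange p g (genMat p K₀ d 0) * baseChange p g (genMat p K₀ d 1) = 1 ∧
      PhiNRel p φ (baseChange p g (genMat p K₀ d 0)) (baseChange p g (genMat p K₀ d 2)) := by
  have key : ∀ M : Matrix (Fin d) (Fin d) (PolyRing p K₀ d ⊗[ℚ_[p]] K₀),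
      (∀ i j k, g ((coords p K₀ _).repr (M i j) k) = 0) ↔ baseChange p g M = 0 := by
    intro M
    simp only [← coords_repr_map, ← Matrix.ext_iff, baseChange, Matrix.map_apply, Matrix.zero_apply]
    refine forall_congr' fun i => forall_congr' fun j => ?_
    rw [← (coords p K₀ R).repr.map_eq_zero_iff, Finsupp.ext_iff]
    rfl
  have h1 : (∀ a ∈ relIdeal p φ d, g a = 0) ↔ relIdeal p φ d ≤ RingHom.ker g := Iff.rfl
  rw [h1, relIdeal, Ideal.span_le, Set.union_subset_iff]
  refine and_congr ?_ ?_
  · rw [← sub_eq_zero, ← baseChange_mul]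
    have := key (genMat p K₀ d 0 * genMat p K₀ d 1 - 1)
    have e : baseChange p g (genMat p K₀ d 0 * genMat p K₀ d 1 - 1) =
        baseChange p g (genMat p K₀ d 0 * genMat p K₀ d 1) - 1 := by
      simp [baseChange, Matrix.map_sub, Matrix.map_one]
    rw [← e, ← this]
    constructor
    · intro h i j k
      exact h ⟨i, j, k, rfl⟩
    · rintro h _ ⟨i, j, k, rfl⟩
      exact h i j k
  · rw [PhiNRel, ← sub_eq_zero, ← baseChange_mul]
    have := key (genMat p K₀ d 2 * genMat p K₀ d 0 - (p : PolyRing p K₀ d ⊗[ℚ_[p]] K₀) •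
          (genMat p K₀ d 0 * (genMat p K₀ d 2).map (frob p φ _)))
    have e2 : (baseChange p g (genMat p K₀ d 2)).map (frob p φ R) =
        baseChange p g ((genMat p K₀ d 2).map (frob p φ _)) := by
      ext i j
      simp [baseChange, frob_map]
    have e : baseChange p g (genMat p K₀ d 2 * genMat p K₀ d 0 -
          (p : PolyRing p K₀ d ⊗[ℚ_[p]] K₀) •
          (genMat p K₀ d 0 * (genMat p K₀ d 2).map (frob p φ _))) =
        baseChange p g (genMat p K₀ d 2 * genMat p K₀ d 0) - (p : R ⊗[ℚ_[p]] K₀) •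
          (baseChange p g (genMat p K₀ d 0) * (baseChange p g (genMat p K₀ d 2)).map
            (frob p φ R)) := by
      rw [e2, ← baseChange_mul]
      ext i j
      simp only [baseChange, Matrix.map_apply, Matrix.sub_apply, Matrix.smul_apply, map_sub,
        smul_eq_mul, map_mul, map_natCast]
    rw [← e, ← this]
    constructor
    · intro h i j k
      exact h ⟨i, j, k, rfl⟩
    · rintro h _ ⟨i, j, k, rfl⟩
      exact h i j k

theorem baseChange_genMat_eq_iff {d : ℕ} {R : Type*} [CommRing R] [Algebra ℚ_[p] R]
    (g : PolyRing p K₀ d →ₐ[ℚ_[p]] R) (s : Fin 3) (M : Matrix (Fin d) (Fin d) (R ⊗[ℚ_[p]] K₀)) :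
    baseChange p g (genMat p K₀ d s) = M ↔
      ∀ i j k, g (MvPolynomial.X (s, i, j, k)) = (coords p K₀ R).repr (M i j) k := by
  rw [← Matrix.ext_iff]
  refine forall_congr' fun i => forall_congr' fun j => ?_
  rw [← (coords p K₀ R).repr.injective.eq_iff, Finsupp.ext_iff]
  refine forall_congr' fun k => ?_
  rw [baseChange, Matrix.map_apply, coords_repr_map]
  simp [genMat, Finsupp.single_apply]

theorem mkP_eq_zero (φ : K₀ ≃ₐ[ℚ_[p]] K₀) (d : ℕ) {a : PolyRing p K₀ d}
    (ha : a ∈ relIdeal p φ d) : mkP p φ d a = 0 :=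
  Ideal.Quotient.eq_zero_iff_mem.2 ha

/-- The universal pair `(Φ, N)` consists of an invertible matrix and a matrix satisfying the
relation `N Φ = p Φ φ(N)`. -/
theorem univ_rel (φ : K₀ ≃ₐ[ℚ_[p]] K₀) (d : ℕ) :
    IsUnit (univΦ p φ d) ∧ PhiNRel p φ (univΦ p φ d) (univN p φ d) := by
  have h := (relIdeal_le_ker_iff p φ d (mkP p φ d)).1
    (fun a ha => mkP_eq_zero p φ d ha)
  exact ⟨(Matrix.isUnit_iff_isUnit_det _).2 (IsUnit.of_mul_eq_one _ (by
    rw [← Matrix.det_mul, univΦ, h.1, Matrix.det_one])), h.2⟩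

/-- `P_{K₀,d}` represents the functor of pairs `(Φ, N)`: for each `ℚ_p`-algebra `R`, a pair
consisting of `Φ ∈ GL_d(R ⊗ K₀)` and `N ∈ Mat_{d × d}(R ⊗ K₀)` with `N Φ = p Φ φ(N)` is the pullback
of the universal pair under a unique homomorphism to `R`. -/
theorem existsUnique_univ (φ : K₀ ≃ₐ[ℚ_[p]] K₀) (d : ℕ) {R : Type*} [CommRing R]
    [Algebra ℚ_[p] R] (Φ N : Matrix (Fin d) (Fin d) (R ⊗[ℚ_[p]] K₀)) (hΦ : IsUnit Φ)
    (hN : PhiNRel p φ Φ N) :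
    ∃! g : PRing p φ d →ₐ[ℚ_[p]] R,
      baseChange p g (univΦ p φ d) = Φ ∧ baseChange p g (univN p φ d) = N := by
  have hcomp : ∀ (g : PRing p φ d →ₐ[ℚ_[p]] R) (s : Fin 3),
      baseChange p g (baseChange p (mkP p φ d) (genMat p K₀ d s)) =
        baseChange p (g.comp (mkP p φ d)) (genMat p K₀ d s) := by
    intro g s
    ext i j
    simp only [baseChange, Matrix.map_apply, ← AlgHom.comp_apply,
      ← Algebra.TensorProduct.map_comp, AlgHom.comp_id]
  obtain ⟨Φ', h1, h2⟩ := isUnit_iff_exists.1 hΦ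
  let M : Fin 3 → Matrix (Fin d) (Fin d) (R ⊗[ℚ_[p]] K₀) := ![Φ, Φ', N]
  let g₀ : PolyRing p K₀ d →ₐ[ℚ_[p]] R :=
    MvPolynomial.aeval fun x => (coords p K₀ R).repr (M x.1 x.2.1 x.2.2.1) x.2.2.2
  have hg₀ : ∀ s, baseChange p g₀ (genMat p K₀ d s) = M s := fun s =>
    (baseChange_genMat_eq_iff p g₀ s (M s)).2 fun i j k => by simp [g₀]
  have hker : ∀ a ∈ relIdeal p φ d, g₀ a = 0 := by
    rw [relIdeal_le_ker_iff, hg₀, hg₀, hg₀]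
    exact ⟨h1, hN⟩
  let g₁ : PRing p φ d →ₐ[ℚ_[p]] R := Ideal.Quotient.liftₐ (relIdeal p φ d) g₀ hker
  have hg₁ : g₁.comp (mkP p φ d) = g₀ := Ideal.Quotient.liftₐ_comp (relIdeal p φ d) g₀ hker
  refine ⟨g₁, ⟨?_, ?_⟩, ?_⟩
  · rw [univΦ, hcomp, hg₁, hg₀]
    rfl
  · rw [univN, hcomp, hg₁, hg₀]
    rfl
  · rintro g ⟨ha, hb⟩
    rw [univΦ, hcomp] at ha
    rw [univN, hcomp] at hb
    have hc : baseChange p (g.comp (mkP p φ d))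
        (genMat p K₀ d 1) = Φ' := by
      have h := ((relIdeal_le_ker_iff p φ d
        (g.comp (mkP p φ d))).1 fun a ha => by
          rw [AlgHom.comp_apply, mkP_eq_zero p φ d ha, map_zero]).1
      rw [ha] at h
      exact (left_inv_eq_right_inv h2 h).symm
    suffices h : g.comp (mkP p φ d) = g₁.comp (mkP p φ d) from Ideal.Quotient.algHom_ext _ h
    rw [hg₁]
    apply MvPolynomial.algHom_ext
    rintro ⟨s, i, j, k⟩
    have h3 : baseChange p (g.comp (mkP p φ d))
        (genMat p K₀ d s) = M s := by
      fin_cases s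
      · exact ha
      · exact hc
      · exact hb
    rw [(baseChange_genMat_eq_iff p _ s _).1 h3, (baseChange_genMat_eq_iff p _ s _).1 (hg₀ s)]

end Representability

end PhiNModule

end

/-! Write `f` for the degree of `K₀` and `q = p ^ f`. Over a field `L` with an embedding `σ` of
`K₀`, the ring `L ⊗ K₀` is a product of `f` copies of `L`, indexed by the embeddings `σ ∘ φ ^ i`. A
point becomes a cyclic family `(Φ_i, N_i)` with `N_i Φ_i = p Φ_i N_{i+1}`. The product `A = Φ_0 ⋯
Φ_{f-1}` is `(Φ^f)_0` and satisfies `N_0 A = q A N_0`. Since `q` is not a root of unity and `A` is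
invertible, `N_0` is nilpotent, so it has a Jordan type `π`.

Components. Fix the Jordan matrix `J` of `π`. A basis putting `N_0` into the form `J`, transported
along the `Φ_i`, gives frames `G_0, …, G_f`. The data reduce to free invertible matrices `G_0, …,
G_{f-1}` and an invertible solution `C` of the linear equation `J C = q C J`. These form a nonempty
open subset of a linear space over `K₀`, so the points of type `π` have irreducible closure, with
prime ideal `genericIdeal`. Every prime contains one of these ideals (`exists_genericIdeal_le`).
They are incomparable by a rank count. If `A` has distinct eigenvalues, then `N_0 ^ k` is supported,
in an eigenbasis, at pairs of eigenvalues with ratio `q ^ k`. The number of such pairs is the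
nullity of `n ↦ n A - q ^ k A n`, hence `rank N_0 ^ k + rank (intertwiner (q ^ k) A) ≤ d ^ 2`. A
diagonal `A` with suitable integer eigenvalues attains equality for all `k` (`exists_special`). Both
ranks are lower semicontinuous, so equality holds at the generic point of each stratum, and an
inclusion of two closures forces equal ranks of all powers of `N_0`, hence equal partitions
(`eq_of_genericIdeal_le`). Equality for `k = 1` also says that in an eigenbasis of `A` the nonzero
entries of `N_0` are exactly the pairs with ratio `q`. Thus eigenvalue chains and Jordan blocks give
the same partition (`exists_partition_forall_iff`).

Singularities. The scheme is cut out by `2 f d ^ 2` equations in an affine space of dimension `3 f d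
^ 2`. At each generic point the linearized equations are solvable (`exists_linearized_solution`,
`exists_linearized_cyclic_solution`). Deformations to the dual numbers turn this into linear
independence of the equations modulo the square of the prime (`mem_ker_of_sum_mem_sq`). So the
equations generate the maximal ideal of the regular local ring at each generic point. Depth
arguments then show that the quotient is Cohen–Macaulay, has no embedded primes, is reduced and has
pure dimension `f d ^ 2`. Generic smoothness follows because `ℚ_[p]` is perfect. -/

noncomputable section

/-! ### Depth of finite modules over Noetherian local rings -/

section Depth

open RingTheory.Sequence IsLocalRing
open scoped Pointwise

section

variable {A : Type*} [CommRing A] [IsNoetherianRing A] {M : Type*} [AddCommGroup M] [Module A M]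

theorem isSMulRegular_of_forall_associatedPrimes {x : A}
    (h : ∀ P ∈ associatedPrimes A M, x ∉ P) : IsSMulRegular M x := by
  by_contra hx
  have : x ∈ ⋃ p ∈ associatedPrimes A M, (p : Set A) := by
    rw [biUnion_associatedPrimes_eq_compl_regular]; exact hx
  simp only [Set.mem_iUnion] at this
  obtain ⟨P, hP, hxP⟩ := this
  exact h P hP hxP

theorem IsSMulRegular.notMem_of_associatedPrimes {x : A} (hx : IsSMulRegular M x) {P : Ideal A}
    (hP : P ∈ associatedPrimes A M) : x ∉ P := fun h => by
  have : x ∈ ⋃ p ∈ associatedPrimes A M, (p : Set A) := by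
    simp only [Set.mem_iUnion]; exact ⟨P, hP, h⟩
  rw [biUnion_associatedPrimes_eq_compl_regular] at this
  exact this hx

end

/-- `(M / x M) / y (M / x M) ≃ (M / y M) / x (M / y M)`. -/
def QuotSMulTop.quotComm {A M : Type*} [CommRing A] [AddCommGroup M] [Module A M] (x y : A) :
    QuotSMulTop y (QuotSMulTop x M) ≃ₗ[A] QuotSMulTop x (QuotSMulTop y M) :=
  have key : ∀ x y : A, (y • ⊤ : Submodule A (QuotSMulTop x M)) =
      (y • ⊤ : Submodule A M).map (x • ⊤ : Submodule A M).mkQ := fun x y => by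
    rw [Submodule.map_pointwise_smul, Submodule.map_top, Submodule.range_mkQ]
  Submodule.quotEquivOfEq _ _ (key x y) ≪≫ₗ
    Submodule.quotientQuotientEquivQuotientSup _ _ ≪≫ₗ
    Submodule.quotEquivOfEq _ _ (sup_comm _ _) ≪≫ₗ
    (Submodule.quotientQuotientEquivQuotientSup _ _).symm ≪≫ₗ
    (Submodule.quotEquivOfEq _ _ (key y x)).symm

variable {A : Type*} [CommRing A] [IsLocalRing A]

variable (A) in
/-- There is a weakly regular sequence of length `n` on `M` inside the maximal ideal. -/
def HasDepthGE (M : Type*) [AddCommGroup M] [Module A M] (n : ℕ) : Prop :=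
  ∃ rs : List A, rs.length = n ∧ (∀ r ∈ rs, r ∈ maximalIdeal A) ∧ IsWeaklyRegular M rs

namespace HasDepthGE

variable {M : Type*} [AddCommGroup M] [Module A M]

theorem zero : HasDepthGE A M 0 := ⟨[], rfl, by simp, .nil A M⟩

theorem cons {x : A} (hx : x ∈ maximalIdeal A) (hreg : IsSMulRegular M x) {n : ℕ}
    (h : HasDepthGE A (QuotSMulTop x M) n) : HasDepthGE A M (n + 1) := by
  obtain ⟨rs, rfl, h1, h2⟩ := h
  exact ⟨x :: rs, rfl, List.forall_mem_cons.2 ⟨hx, h1⟩, .cons hreg h2⟩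

theorem exists_cons {n : ℕ} (h : HasDepthGE A M (n + 1)) : ∃ x ∈ maximalIdeal A,
    IsSMulRegular M x ∧ HasDepthGE A (QuotSMulTop x M) n := by
  obtain ⟨rs, hl, h1, h2⟩ := h
  match rs, hl with
  | x :: rs, hl =>
    rw [isWeaklyRegular_cons_iff] at h2
    exact ⟨x, h1 x (by simp), h2.1, rs, by simpa using hl, fun r hr => h1 r (by simp [hr]), h2.2⟩

theorem congr {M' : Type*} [AddCommGroup M'] [Module A M'] (e : M ≃ₗ[A] M') {n : ℕ}
    (h : HasDepthGE A M n) : HasDepthGE A M' n := by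
  obtain ⟨rs, h0, h1, h2⟩ := h
  exact ⟨rs, h0, h1, (e.isWeaklyRegular_congr rs).1 h2⟩

end HasDepthGE

variable [IsNoetherianRing A] {M : Type*} [AddCommGroup M] [Module A M]

/-- Prime avoidance applied to the union of the two finite sets of associated primes. -/
theorem exists_isSMulRegular_pair [Module.Finite A M] {M' : Type*} [AddCommGroup M'] [Module A M']
    [Module.Finite A M'] (h : maximalIdeal A ∉ associatedPrimes A M)
    (h' : maximalIdeal A ∉ associatedPrimes A M') :
    ∃ y ∈ maximalIdeal A, IsSMulRegular M y ∧ IsSMulRegular M' y := by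
  have hfin := (associatedPrimes.finite A M).union (associatedPrimes.finite A M')
  have : ¬ ((maximalIdeal A : Set A) ⊆
      ⋃ P ∈ (associatedPrimes A M ∪ associatedPrimes A M'), (P : Set A)) := by
    intro hsub
    obtain ⟨P, hP, hle⟩ := (Ideal.subset_union_prime_finite hfin (f := id) 0 0
      (fun P hP _ _ => by rcases hP with hP | hP <;> exact hP.isPrime)).1 hsub
    have hPp : P.IsPrime := by rcases hP with hP | hP <;> exact hP.isPrime
    have : P = maximalIdeal A := le_antisymm (le_maximalIdeal hPp.ne_top) hle
    subst this
    exact hP.elim h h'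
  rw [Set.not_subset] at this
  obtain ⟨y, hy, hy'⟩ := this
  simp only [Set.mem_iUnion, not_exists] at hy'
  exact ⟨y, hy, isSMulRegular_of_forall_associatedPrimes fun P hP => hy' P (.inl hP),
    isSMulRegular_of_forall_associatedPrimes fun P hP => hy' P (.inr hP)⟩

theorem IsSMulRegular.swap [Module.Finite A M] {x y : A} (hx : x ∈ maximalIdeal A)
    (hy : y ∈ maximalIdeal A) (h1 : IsSMulRegular M x) (h2 : IsSMulRegular (QuotSMulTop x M) y) :
    IsSMulRegular M y ∧ IsSMulRegular (QuotSMulTop y M) x := by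
  have h : IsWeaklyRegular M [x, y] := .cons h1 ((isWeaklyRegular_singleton_iff _ _).2 h2)
  have h' := IsLocalRing.isWeaklyRegular_of_perm_of_subset_maximalIdeal h
    (List.Perm.swap y x []) (List.forall_mem_cons.2 ⟨hx, List.forall_mem_singleton.2 hy⟩)
  rw [isWeaklyRegular_cons_iff, isWeaklyRegular_singleton_iff] at h'
  exact h'

/-- If `x, x'` is a regular sequence on `M` and `f` is regular on `M`, then the maximal ideal is not
associated to `M / f M`. -/
theorem maximalIdeal_notMem_associatedPrimes_quotSMulTop {x x' f : A} (hx : x ∈ maximalIdeal A)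
    (hx' : x' ∈ maximalIdeal A) (h1 : IsSMulRegular M x) (h2 : IsSMulRegular (QuotSMulTop x M) x')
    (hf : IsSMulRegular M f) :
    maximalIdeal A ∉ associatedPrimes A (QuotSMulTop f M) := by
  intro h
  obtain ⟨-, b, hb⟩ := (isAssociatedPrime_iff (R := A)).1 h
  obtain ⟨b, rfl⟩ := Submodule.mkQ_surjective _ b
  have key : ∀ r : A, r ∈ maximalIdeal A ↔ r • b ∈ f • (⊤ : Submodule A M) := by
    intro r
    rw [hb, Submodule.mem_colon_singleton, ← map_smul, Submodule.mem_bot, Submodule.mkQ_apply,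
      Submodule.Quotient.mk_eq_zero]
  -- If the maximal ideal kills `b` modulo `f M`, then `x b = f c` and `x' b = f c'`. Cancelling `f`
  -- gives `x' c = x c'`, so `c = x e` by regularity of `x, x'`, and then `b = f e` is zero in the
  -- quotient.
  obtain ⟨c, -, hc⟩ := (Submodule.mem_smul_pointwise_iff_exists _ _ _).1 ((key x).1 hx)
  obtain ⟨c', -, hc'⟩ := (Submodule.mem_smul_pointwise_iff_exists _ _ _).1 ((key x').1 hx')
  have h3 : x' • c = x • c' := by
    apply hf
    change f • x' • c = f • x • c'
    rw [smul_comm f x', hc, smul_comm f x, hc', smul_comm]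
  have h4 : c ∈ x • (⊤ : Submodule A M) := by
    refine mem_of_isSMulRegular_quotient_of_smul_mem h2 (x := c) ?_
    rw [h3]
    exact Submodule.smul_mem_pointwise_smul _ _ _ trivial
  obtain ⟨e, -, he⟩ := (Submodule.mem_smul_pointwise_iff_exists _ _ _).1 h4
  have h5 : b = f • e := by
    apply h1
    change x • b = x • f • e
    rw [← hc, ← he, smul_comm]
  have : (1 : A) ∈ maximalIdeal A := by
    rw [key, one_smul, h5]
    exact Submodule.smul_mem_pointwise_smul _ _ _ trivial
  exact (Ideal.ne_top_iff_one _).1 (maximalIdeal.isMaximal A).ne_top this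

/-- The regular element `f` need not start the given sequence. An element `y` regular on both `M / f
M` and `M / x M` mediates between `x` and `f`: the induction hypothesis passes from `M / x M` to `M
/ (x, y)`, so `M / y M` has large depth, and it applies a second time to `M / y M` and `f`. -/
theorem HasDepthGE.quotSMulTop [Module.Finite A M] {n : ℕ} (h : HasDepthGE A M (n + 1)) {f : A}
    (hf : f ∈ maximalIdeal A) (hreg : IsSMulRegular M f) :
    HasDepthGE A (QuotSMulTop f M) n := by
  induction n generalizing M f with
  | zero => exact .zero
  | succ n ih =>
    obtain ⟨x, hx, h1, hd⟩ := h.exists_cons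
    obtain ⟨x', hx', h2, -⟩ := hd.exists_cons
    obtain ⟨y, hy, hyf, hyx⟩ := exists_isSMulRegular_pair (A := A)
      (maximalIdeal_notMem_associatedPrimes_quotSMulTop hx hx' h1 h2 hreg)
      (maximalIdeal_notMem_associatedPrimes_quotSMulTop hx hx' h1 h2 h1)
    obtain ⟨hy1, hyf'⟩ := hreg.swap hf hy hyf
    obtain ⟨-, hyx'⟩ := h1.swap hx hy hyx
    have e1 : HasDepthGE A (QuotSMulTop y M) (n + 1) :=
      .cons hx hyx' ((ih hd hy hyx).congr (QuotSMulTop.quotComm x y))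
    exact .cons hy hyf ((ih e1 hf hyf').congr (QuotSMulTop.quotComm y f))

/-- If `M` has depth at least `n`, then `dim A / P ≥ n` for every associated prime `P` of `M`. -/
theorem HasDepthGE.le_ringKrullDim_quotient [Module.Finite A M] {n : ℕ} (h : HasDepthGE A M n)
    {P : Ideal A} (hP : P ∈ associatedPrimes A M) : (n : WithBot ℕ∞) ≤ ringKrullDim (A ⧸ P) := by
  induction n generalizing M P with
  | zero =>
    have := hP.isPrime
    exact ringKrullDim_nonneg_of_nontrivial
  | succ n ih =>
    obtain ⟨x, hx, h1, hd⟩ := h.exists_cons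
    have hPp := hP.isPrime
    have hxP := h1.notMem_of_associatedPrimes hP
    obtain ⟨-, a, ha⟩ := (isAssociatedPrime_iff (R := A)).1 hP
    -- The elements killed by `P`. By Nakayama some `b` in `N` lies outside `x M`. An associated
    -- prime of `M / x M` containing the annihilator of the class of `b` contains both `P` and `x`,
    -- so its quotient has strictly smaller dimension than `A / P`.
    let N : Submodule A M :=
      { carrier := {b | ∀ r ∈ P, r • b = 0}
        add_mem' := fun hb hc r hr => by rw [smul_add, hb r hr, hc r hr, add_zero]
        zero_mem' := fun r _ => smul_zero r
        smul_mem' := fun c b hb r hr => by rw [smul_comm, hb r hr, smul_zero] }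
    have haN : a ∈ N := fun r hr => by
      rw [ha, Submodule.mem_colon_singleton] at hr
      simpa using hr
    have hN : ¬ N ≤ x • (⊤ : Submodule A M) := by
      intro hle
      have h2 : N ≤ Ideal.span {x} • N := by
        intro b hb
        obtain ⟨c, -, rfl⟩ := (Submodule.mem_smul_pointwise_iff_exists _ _ _).1 (hle hb)
        refine Submodule.smul_mem_smul (Ideal.mem_span_singleton_self x) fun r hr => h1 ?_
        change x • r • c = x • 0
        rw [smul_comm, hb r hr, smul_zero]
      have h3 := Submodule.eq_bot_of_le_smul_of_le_jacobson_bot _ N (IsNoetherian.noetherian N) h2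
        (((Ideal.span_singleton_le_iff_mem _).2 hx).trans (maximalIdeal_le_jacobson _))
      have h4 : a = 0 := by simpa [h3] using haN
      apply hPp.ne_top
      rw [ha, h4]
      ext; simp
    obtain ⟨b, hbN, hb⟩ := Set.not_subset.1 hN
    have hb0 : (Submodule.mkQ (x • (⊤ : Submodule A M)) b) ≠ 0 := by
      rwa [Ne, Submodule.mkQ_apply, Submodule.Quotient.mk_eq_zero]
    obtain ⟨P', hP', hle⟩ := exists_le_isAssociatedPrime_of_isNoetherianRing A _ hb0
    have hPP' : P ≤ P' := fun r hr => hle (by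
      rw [Submodule.mem_colon_singleton, ← map_smul, hbN r hr, map_zero]; exact zero_mem _)
    have hxP' : x ∈ P' := by
      refine hle ?_
      rw [Submodule.mem_colon_singleton, ← map_smul, Submodule.mem_bot, Submodule.mkQ_apply,
        Submodule.Quotient.mk_eq_zero]
      exact Submodule.smul_mem_pointwise_smul _ _ _ trivial
    have h5 := ringKrullDim_succ_le_of_surjective (Ideal.Quotient.factor hPP')
      (Ideal.Quotient.factor_surjective hPP') (r := Ideal.Quotient.mk P x)
      (mem_nonZeroDivisors_of_ne_zero (by rwa [Ne, Ideal.Quotient.eq_zero_iff_mem]))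
      (by simpa [Ideal.Quotient.eq_zero_iff_mem] using hxP')
    refine le_trans ?_ h5
    push_cast
    gcongr
    exact ih hd hP'

theorem ringKrullDim_quotient_le_add_length (J : Ideal A) (fs : List A)
    (hfs : ∀ f ∈ fs, f ∈ maximalIdeal A) :
    ringKrullDim (A ⧸ J) ≤ ringKrullDim (A ⧸ J ⊔ Ideal.ofList fs) + fs.length := by
  classical
  rcases eq_or_ne J ⊤ with rfl | hJ
  · have : Subsingleton (A ⧸ (⊤ : Ideal A)) := Ideal.Quotient.subsingleton_iff.2 rfl
    simp [ringKrullDim_eq_bot_of_subsingleton]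
  have : Nontrivial (A ⧸ J) := Ideal.Quotient.nontrivial_iff.2 hJ
  have : IsLocalRing (A ⧸ J) := .of_surjective' _ Ideal.Quotient.mk_surjective
  let s : Finset (A ⧸ J) := (fs.map (Ideal.Quotient.mk J)).toFinset
  have hs : (s : Set (A ⧸ J)) ⊆ Ring.jacobson (A ⧸ J) := by
    intro y hy
    simp only [s, List.coe_toFinset, List.mem_map, Set.mem_ofPred_eq] at hy
    obtain ⟨f, hf, rfl⟩ := hy
    have : IsLocalHom (Ideal.Quotient.mk J) := .of_surjective _ Ideal.Quotient.mk_surjective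
    rw [ringJacobson_eq_maximalIdeal]
    exact map_mem_nonunits_iff (Ideal.Quotient.mk J) f |>.2 (hfs f hf)
  have h1 := ringKrullDim_le_ringKrullDim_quotient_add_card _ hs
  have h2 : Ideal.span (s : Set (A ⧸ J)) = (Ideal.ofList fs).map (Ideal.Quotient.mk J) := by
    rw [Ideal.map_ofList, Ideal.ofList]
    congr 1
    ext; simp [s]
  have e : ((A ⧸ J) ⧸ Ideal.span (s : Set (A ⧸ J))) ≃+* A ⧸ J ⊔ Ideal.ofList fs :=
    (Ideal.quotEquivOfEq h2).trans (DoubleQuot.quotQuotEquivQuotSup J (Ideal.ofList fs))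
  rw [ringKrullDim_eq_of_ringEquiv e] at h1
  refine h1.trans ?_
  gcongr
  exact (List.toFinset_card_le _).trans (by simp)

/-- If `M` has depth at least `k + r`, then elements `f₁, …, fᵣ` cutting down the dimension of the
support to `k` form a regular sequence and the quotient has depth at least `k`. -/
theorem HasDepthGE.quotient_ofList [Module.Finite A M] (fs : List A)
    (hfs : ∀ f ∈ fs, f ∈ maximalIdeal A) {k : ℕ} (h : HasDepthGE A M (k + fs.length))
    (hdim : ringKrullDim (A ⧸ Module.annihilator A M ⊔ Ideal.ofList fs) ≤ k) :
    HasDepthGE A (M ⧸ (Ideal.ofList fs • ⊤ : Submodule A M)) k := by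
  induction fs generalizing M with
  | nil =>
    refine h.congr (Submodule.quotEquivOfEqBot _ ?_).symm
    simp
  | cons f fs ih =>
    rw [List.forall_mem_cons] at hfs
    -- If `f` lay in an associated prime `P`, the remaining elements `fs` alone would cut `A / P`,
    -- of dimension at least `k + length (f :: fs)`, down to dimension at most `k`.
    have hreg : IsSMulRegular M f := by
      refine isSMulRegular_of_forall_associatedPrimes fun P hP hfP => ?_
      have h1 := h.le_ringKrullDim_quotient hP
      have h2 := ringKrullDim_quotient_le_add_length P fs hfs.2
      have h3 : Module.annihilator A M ⊔ Ideal.ofList (f :: fs) ≤ P ⊔ Ideal.ofList fs := by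
        rw [Ideal.ofList_cons]
        refine sup_le (le_sup_of_le_left ?_) (sup_le_sup_right ?_ _)
        · simpa only [Submodule.annihilator_top] using hP.annihilator_le
        · rwa [Ideal.span_singleton_le_iff_mem]
      have h4 := ringKrullDim_le_of_surjective (Ideal.Quotient.factor h3)
        (Ideal.Quotient.factor_surjective h3)
      have h5 : ((k + (f :: fs).length : ℕ) : WithBot ℕ∞) ≤ ((k + fs.length : ℕ) : WithBot ℕ∞) := by
        refine h1.trans (h2.trans ?_)
        push_cast
        gcongr
        exact h4.trans hdim
      have h6 : k + (f :: fs).length ≤ k + fs.length := by exact_mod_cast h5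
      simp at h6
    have h1 : HasDepthGE A (QuotSMulTop f M) (k + fs.length) := HasDepthGE.quotSMulTop h hfs.1 hreg
    refine (ih hfs.2 h1 ?_).congr (Submodule.quotOfListConsSMulTopEquivQuotSMulTopInner M f fs).symm
    refine le_trans ?_ hdim
    have h3 : Module.annihilator A M ⊔ Ideal.ofList (f :: fs) ≤
        Module.annihilator A (QuotSMulTop f M) ⊔ Ideal.ofList fs := by
      rw [Ideal.ofList_cons, ← sup_assoc]
      refine sup_le_sup_right (sup_le ?_ ?_) _
      · exact LinearMap.annihilator_le_of_surjective (Submodule.mkQ _) (Submodule.mkQ_surjective _)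
      · rw [Ideal.span_singleton_le_iff_mem, Module.mem_annihilator]
        intro m
        obtain ⟨m, rfl⟩ := Submodule.mkQ_surjective _ m
        rw [← map_smul, Submodule.mkQ_apply, Submodule.Quotient.mk_eq_zero]
        exact Submodule.smul_mem_pointwise_smul _ _ _ trivial
    exact ringKrullDim_le_of_surjective (Ideal.Quotient.factor h3)
        (Ideal.Quotient.factor_surjective h3)

end Depth

/-! ### Regular local rings and maximal ideals of polynomial rings -/

section RegularLocal

open RingTheory.Sequence IsLocalRing
open scoped Pointwise

universe v

theorem HasDepthGE.of_surjective {A B : Type*} [CommRing A] [IsLocalRing A] [CommRing B]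
    [IsLocalRing B] [Algebra A B] (hs : Function.Surjective (algebraMap A B)) {M : Type*}
    [AddCommGroup M] [Module A M] [Module B M] [IsScalarTower A B M] {n : ℕ}
    (h : HasDepthGE B M n) : HasDepthGE A M n := by
  obtain ⟨rs, h0, h1, h2⟩ := h
  obtain ⟨ts, rfl⟩ := List.map_surjective_iff.2 hs rs
  refine ⟨ts, by simpa using h0, fun t ht => ?_, (isWeaklyRegular_map_algebraMap_iff B M ts).1 h2⟩
  have hloc : IsLocalHom (algebraMap A B) := .of_surjective _ hs
  exact (map_mem_nonunits_iff (algebraMap A B) t).1 (h1 _ (List.mem_map_of_mem ht))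

theorem HasDepthGE.map_of_surjective {A B : Type*} [CommRing A] [IsLocalRing A] [CommRing B]
    [IsLocalRing B] [Algebra A B] (hs : Function.Surjective (algebraMap A B)) {M : Type*}
    [AddCommGroup M] [Module A M] [Module B M] [IsScalarTower A B M] {n : ℕ}
    (h : HasDepthGE A M n) : HasDepthGE B M n := by
  obtain ⟨rs, h0, h1, h2⟩ := h
  refine ⟨rs.map (algebraMap A B), by simpa using h0, ?_,
    (isWeaklyRegular_map_algebraMap_iff B M rs).2 h2⟩
  have hloc : IsLocalHom (algebraMap A B) := .of_surjective _ hs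
  intro t ht
  obtain ⟨r, hr, rfl⟩ := List.mem_map.1 ht
  exact (map_mem_nonunits_iff (algebraMap A B) r).2 (h1 r hr)

variable (A : Type v) [CommRing A]

/-- The class of `x` is nonzero in the cotangent space and extends to a basis. By Nakayama, lifts of
the basis generate the maximal ideal, and the `n` lifts other than `x` suffice modulo `x`. -/
theorem spanFinrank_maximalIdeal_quotient_le [IsLocalRing A] [IsNoetherianRing A] {n : ℕ}
    (hn : (maximalIdeal A).spanFinrank = n + 1) {x : A} (hx : x ∈ maximalIdeal A)
    (hx2 : x ∉ maximalIdeal A ^ 2) [IsLocalRing (A ⧸ Ideal.span {x})] :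
    (maximalIdeal (A ⧸ Ideal.span {x})).spanFinrank ≤ n := by
  classical
  let m := maximalIdeal A
  let v : CotangentSpace A := m.toCotangent ⟨x, hx⟩
  have hv : v ≠ 0 := by
    rw [Ne, Ideal.toCotangent_eq_zero]; exact hx2
  have hli : LinearIndepOn (ResidueField A) id ({v} : Set (CotangentSpace A)) :=
    LinearIndepOn.singleton (v := id) hv
  let E := hli.extend (Set.subset_univ _)
  have hvE : v ∈ E := hli.subset_extend _ rfl
  let b : Module.Basis E (ResidueField A) (CotangentSpace A) := .extend hli
  have hfin : Finite E := Module.Finite.finite_basis b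
  have hE : E.ncard = n + 1 := by
    rw [← hn, spanFinrank_maximalIdeal_eq_finrank_cotangentSpace, Module.finrank_eq_nat_card_basis b]
    rfl
  obtain ⟨l, hl⟩ := (Ideal.toCotangent_surjective m).hasRightInverse
  let s : Set m := insert ⟨x, hx⟩ (l '' (E \ {v}))
  have himg : m.toCotangent '' s = E := by
    rw [Set.image_insert_eq, Set.image_image]
    simp only [hl _, Set.image_id']
    exact Set.insert_sdiff_self_of_mem hvE
  have hspan : Submodule.span A s = ⊤ := by
    rw [← CotangentSpace.span_image_eq_top_iff, himg]
    have := b.span_eq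
    rwa [Module.Basis.range_extend] at this
  have hm : m = Ideal.span ((↑) '' s : Set A) := by
    have := congrArg (Submodule.map m.subtype) hspan
    rw [Submodule.map_span, Submodule.map_top, Submodule.range_subtype] at this
    exact this.symm
  let t : Set (A ⧸ Ideal.span {x}) := (fun w => Ideal.Quotient.mk _ ((l w : m) : A)) '' (E \ {v})
  have hm' : maximalIdeal (A ⧸ Ideal.span {x}) = Ideal.span t := by
    rw [← map_maximalIdeal_of_surjective _ (Ideal.Quotient.mk_surjective (I := Ideal.span {x}))]
    change Ideal.map _ m = _
    rw [hm, Ideal.map_span, Set.image_insert_eq, Set.image_insert_eq, Set.image_image,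
      Set.image_image, Ideal.span_insert]
    have : Ideal.Quotient.mk (Ideal.span {x}) x = 0 :=
      Ideal.Quotient.eq_zero_iff_mem.2 (Ideal.mem_span_singleton_self x)
    simp only [this, Ideal.span_singleton_zero, bot_sup_eq]
    rfl
  have hEf : E.Finite := hfin
  rw [hm']
  refine (Submodule.spanFinrank_span_le_ncard_of_finite (hEf.sdiff.image _)).trans
    ((Set.ncard_image_le hEf.sdiff).trans ?_)
  rw [Set.ncard_sdiff_singleton_of_mem hvE, hE]
  rfl

/-- A regular local ring of dimension `n` is a domain and has a regular sequence of length `n`. -/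
theorem IsRegularLocalRing.isDomain_and_hasDepthGE [IsRegularLocalRing A] (n : ℕ)
    (hn : ringKrullDim A = n) : IsDomain A ∧ HasDepthGE A A n := by
  induction n generalizing A with
  | zero =>
    have h := (isRegularLocalRing_iff A).1 ‹_›
    rw [hn] at h
    have h' : (maximalIdeal A).spanFinrank = 0 := by exact_mod_cast h
    rw [Submodule.spanFinrank_eq_zero_iff_eq_bot (IsNoetherian.noetherian _)] at h'
    exact ⟨((isField_iff_maximalIdeal_eq).2 h').isDomain, .zero⟩
  | succ n ih =>
    have h := (isRegularLocalRing_iff A).1 ‹_›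
    rw [hn] at h
    have h' : (maximalIdeal A).spanFinrank = n + 1 := by exact_mod_cast h
    -- Prime avoidance tolerates the single nonprime ideal `𝔪 ^ 2`. The ideal `𝔪` lies neither in `𝔪
    -- ^ 2` (Nakayama) nor in a minimal prime (positive dimension).
    obtain ⟨x, hx, hx2, hxP⟩ : ∃ x ∈ maximalIdeal A, x ∉ maximalIdeal A ^ 2 ∧
        ∀ P ∈ minimalPrimes A, x ∉ P := by
      by_contra! hcon
      have hfin := (minimalPrimes.finite_of_isNoetherianRing A).insert (maximalIdeal A ^ 2)
      have hsub : (maximalIdeal A : Set A) ⊆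
          ⋃ P ∈ insert (maximalIdeal A ^ 2) (minimalPrimes A), (P : Set A) := by
        intro x hx
        simp only [Set.mem_iUnion]
        by_cases hx2 : x ∈ maximalIdeal A ^ 2
        · exact ⟨_, Set.mem_insert _ _, hx2⟩
        · obtain ⟨P, hP, hxP⟩ := hcon x hx hx2
          exact ⟨P, Set.mem_insert_of_mem _ hP, hxP⟩
      obtain ⟨P, hP, hle⟩ := (Ideal.subset_union_prime_finite hfin (f := id)
        (maximalIdeal A ^ 2) (maximalIdeal A ^ 2)
        (fun P hP h1 _ => (hP.resolve_left h1).1.1)).1 hsub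
      rcases hP with rfl | hP
      · have : IsIdempotentElem (maximalIdeal A) :=
          le_antisymm Ideal.mul_le_left ((pow_two (maximalIdeal A)) ▸ hle)
        have h0 : maximalIdeal A = ⊥ :=
          Submodule.eq_bot_of_le_smul_of_le_jacobson_bot _ _ (IsNoetherian.noetherian _)
            (le_of_eq this.symm) (maximalIdeal_le_jacobson _)
        rw [h0] at h'
        simp at h'
      · have hPp : P.IsPrime := hP.1.1
        have h1 : maximalIdeal A = P := le_antisymm hle (le_maximalIdeal hPp.ne_top)
        have h2 : (maximalIdeal A).height = 0 := by
          rw [Ideal.height_eq_zero_iff, h1]; exact hP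
        have h3 := maximalIdeal_height_eq_ringKrullDim (R := A)
        rw [h2, hn] at h3
        have : (0 : ℕ) = n + 1 := by exact_mod_cast h3
        omega
    have hne : Ideal.span {x} ≠ ⊤ := fun h => (maximalIdeal.isMaximal A).ne_top
      (top_le_iff.1 (h ▸ (Ideal.span_singleton_le_iff_mem _).2 hx))
    have : Nontrivial (A ⧸ Ideal.span {x}) := Ideal.Quotient.nontrivial_iff.2 hne
    have : IsLocalRing (A ⧸ Ideal.span {x}) := .of_surjective' _ Ideal.Quotient.mk_surjective
    have hle := spanFinrank_maximalIdeal_quotient_le A h' hx hx2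
    have hdim : (n : WithBot ℕ∞) ≤ ringKrullDim (A ⧸ Ideal.span {x}) := by
      have h1 := ringKrullDim_quotient_le_add_length (A := A) ⊥ [x] (by simpa using hx)
      rw [ringKrullDim_eq_of_ringEquiv (RingEquiv.quotientBot A), bot_sup_eq, Ideal.ofList_singleton,
        hn] at h1
      rw [List.length_singleton, Nat.cast_add, Nat.cast_one] at h1
      exact ENat.WithBot.add_le_add_one_right_iff.1 h1
    have hreg : IsRegularLocalRing (A ⧸ Ideal.span {x}) :=
      .of_spanFinrank_maximalIdeal_le _ (le_trans (by exact_mod_cast hle) hdim)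
    have hdim' : ringKrullDim (A ⧸ Ideal.span {x}) = n :=
      le_antisymm ((ringKrullDim_le_spanFinrank_maximalIdeal _).trans (by exact_mod_cast hle)) hdim
    obtain ⟨hdom, hdep⟩ := ih _ hdim'
    have hprime : (Ideal.span {x}).IsPrime := (Ideal.Quotient.isDomain_iff_prime _).1 hdom
    obtain ⟨P, hP, hPle⟩ := Ideal.exists_minimalPrimes_le (I := ⊥) (J := Ideal.span {x}) bot_le
    have hPp : P.IsPrime := hP.1.1
    -- The minimal prime `P` lies in `(x)` but does not contain `x`, so `P = x P` and Nakayama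
    -- applies.
    have hPbot : P = ⊥ := by
      refine Submodule.eq_bot_of_le_smul_of_le_jacobson_bot (Ideal.span {x}) P
        (IsNoetherian.noetherian _) (fun y hy => ?_)
        (((Ideal.span_singleton_le_iff_mem _).2 hx).trans (maximalIdeal_le_jacobson _))
      obtain ⟨c, rfl⟩ := Ideal.mem_span_singleton'.1 (hPle hy)
      rw [mul_comm]
      exact Submodule.smul_mem_smul (Ideal.mem_span_singleton_self x)
        ((hPp.mem_or_mem hy).resolve_right (hxP P hP))
    have hdomA : IsDomain A := by
      have := (Ideal.Quotient.isDomain_iff_prime P).2 hPp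
      subst hPbot
      exact (RingEquiv.quotientBot A).symm.isDomain
    refine ⟨hdomA, .cons hx (fun a b hab => ?_) ?_⟩
    · have hx0 : x ≠ 0 := fun h => hx2 (h ▸ zero_mem _)
      exact mul_left_cancel₀ hx0 hab
    · refine (HasDepthGE.of_surjective (A := A) Ideal.Quotient.mk_surjective hdep).congr
        (Submodule.quotEquivOfEq _ _ ?_)
      rw [← Submodule.ideal_span_singleton_smul, smul_eq_mul, Ideal.mul_top]

theorem Polynomial.height_of_isMaximal {T : Type*} [CommRing T] [IsNoetherianRing T]
    (M : Ideal (Polynomial T)) [M.IsMaximal] : M.height = (M.comap Polynomial.C).height + 1 := by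
  have : M.LiesOver (M.comap Polynomial.C) := ⟨rfl⟩
  exact Polynomial.height_eq_height_add_one _ M

/-- Induction on the number of variables: a maximal ideal of a polynomial ring in one variable over
a Jacobson ring contracts to a maximal ideal, and its height is one more than that of the
contraction. -/
theorem MvPolynomial.height_of_isMaximal (k : Type*) [Field k] (ι : Type*) [Finite ι]
    (M : Ideal (MvPolynomial ι k)) (hM : M.IsMaximal) : M.height = Nat.card ι := by
  induction ι using Finite.induction_empty_option with
  | @of_equiv α β e ih =>
    let e' := (renameEquiv k e).toRingEquiv
    have := ih (M.comap e') (Ideal.comap_isMaximal_of_equiv e')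
    rw [RingEquiv.height_comap] at this
    rw [this, Nat.card_congr e]
  | h_empty =>
    have hM' : M = ⊥ := by
      have e := (isEmptyRingEquiv k PEmpty)
      have hf : IsField (MvPolynomial PEmpty k) := e.toMulEquiv.isField (Field.toIsField k)
      let := hf.toField
      exact (Ideal.eq_bot_or_top M).resolve_right hM.ne_top
    simp [hM']
  | @h_option α _ ih =>
    let e' := (optionEquivLeft k α).symm.toRingEquiv
    have hMm : (M.comap e').IsMaximal := Ideal.comap_isMaximal_of_equiv e'
    have h1 := Polynomial.height_of_isMaximal (M.comap e')
    rw [RingEquiv.height_comap, ih _ (Polynomial.isMaximal_comap_C_of_isJacobsonRing _)] at h1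
    rw [h1, Finite.card_option]
    rfl

end RegularLocal

/-! ### Quotients of regular rings by equations that are independent at the generic points -/

section CompleteIntersection

open RingTheory.Sequence IsLocalRing

universe v

variable {S R : Type v} {κ : Type*} [CommRing S] [CommRing R] [Fintype κ] {ρ : κ → S}

/-- If the elements `ρⱼ` of the prime `Q` are linearly independent in `Q / Q²` (over the residue
field), then they are linearly independent in the cotangent space of the localization at `Q`. -/
theorem linearIndependent_toCotangent (Q : Ideal S) [Q.IsPrime] (hρ : ∀ j, ρ j ∈ Q)
    (hJ : ∀ a : κ → S, ∑ j, a j * ρ j ∈ Q ^ 2 → ∀ j, a j ∈ Q) :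
    LinearIndependent (ResidueField (Localization.AtPrime Q)) fun j =>
      (maximalIdeal (Localization.AtPrime Q)).toCotangent ⟨algebraMap S _ (ρ j),
        (IsLocalization.AtPrime.to_map_mem_maximal_iff _ Q _).2 (hρ j)⟩ := by
  rw [Fintype.linearIndependent_iff]
  intro g hg j
  choose α hα using fun j => residue_surjective (g j)
  -- Clear denominators twice: first in the coefficients of the relation, then in its membership in
  -- the localized square of `Q`.
  obtain ⟨b, hb⟩ := IsLocalization.exist_integer_multiples_of_finite Q.primeCompl α
  choose a ha using hb
  have h1 : ∑ j, α j • (⟨algebraMap S _ (ρ j),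
        (IsLocalization.AtPrime.to_map_mem_maximal_iff _ Q _).2 (hρ j)⟩ :
        maximalIdeal (Localization.AtPrime Q)) ∈
      LinearMap.ker (maximalIdeal (Localization.AtPrime Q)).toCotangent := by
    rw [LinearMap.mem_ker, map_sum, ← hg]
    refine Finset.sum_congr rfl fun j _ => ?_
    rw [map_smul, ← hα]
    rfl
  rw [Ideal.mem_toCotangent_ker] at h1
  have h2 : ∑ j, α j * algebraMap S _ (ρ j) ∈ maximalIdeal (Localization.AtPrime Q) ^ 2 := by
    simpa using h1
  have h3 : algebraMap S (Localization.AtPrime Q) (∑ j, a j * ρ j) ∈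
      Ideal.map (algebraMap S (Localization.AtPrime Q)) (Q ^ 2) := by
    rw [Ideal.map_pow, Localization.AtPrime.map_eq_maximalIdeal]
    have := Ideal.mul_mem_left _ (algebraMap S _ (b : S)) h2
    rw [Finset.mul_sum] at this
    rw [map_sum]
    convert this using 2 with j
    rw [map_mul, ha, Algebra.smul_def, mul_assoc]
  obtain ⟨⟨y, t⟩, hy⟩ := (IsLocalization.mem_map_algebraMap_iff Q.primeCompl _).1 h3
  rw [← map_mul, IsLocalization.eq_iff_exists Q.primeCompl] at hy
  obtain ⟨c, hc⟩ := hy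
  have h4 : ∑ j, ((c : S) * t * a j) * ρ j ∈ Q ^ 2 := by
    have : ∑ j, ((c : S) * t * a j) * ρ j = (c : S) * ((∑ j, a j * ρ j) * t) := by
      rw [Finset.sum_mul, Finset.mul_sum]
      exact Finset.sum_congr rfl fun j _ => by ring
    rw [this, hc]
    exact Ideal.mul_mem_left _ _ y.2
  have h5 : a j ∈ Q := by
    have := hJ _ h4 j
    refine ((‹Q.IsPrime›.mem_or_mem this).resolve_left ?_)
    exact (c * t).2
  rw [← hα, residue_eq_zero_iff]
  have h6 : algebraMap S (Localization.AtPrime Q) b * α j ∈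
      maximalIdeal (Localization.AtPrime Q) := by
    rw [← Algebra.smul_def]
    change ((b : S) • α j) ∈ _
    rw [← ha]
    exact (IsLocalization.AtPrime.to_map_mem_maximal_iff _ Q _).2 h5
  refine ((maximalIdeal.isMaximal _).isPrime.mem_or_mem h6).resolve_left ?_
  rw [IsLocalization.AtPrime.to_map_mem_maximal_iff _ Q]
  exact b.2

variable [IsRegularRing S]

/-- Krull's height theorem bounds the height above by the number of equations. Independence in the
cotangent space of the regular local ring `S_Q` bounds it below. So the equations form a basis of
the cotangent space and generate the maximal ideal of `S_Q` by Nakayama; the second claim is this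
with denominators cleared. -/
theorem height_eq_and_forall_exists_mul_mem (Q : Ideal S) [Q.IsPrime]
    (hQ : Q ∈ (Ideal.span (Set.range ρ)).minimalPrimes)
    (hJ : ∀ a : κ → S, ∑ j, a j * ρ j ∈ Q ^ 2 → ∀ j, a j ∈ Q) :
    Q.height = Fintype.card κ ∧ ∀ s ∈ Q, ∃ t ∉ Q, t * s ∈ Ideal.span (Set.range ρ) := by
  have hρ : ∀ j, ρ j ∈ Q := fun j => hQ.1.2 (Ideal.subset_span ⟨j, rfl⟩)
  have hli := linearIndependent_toCotangent Q hρ hJ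
  set A := Localization.AtPrime Q
  have hle : Q.height ≤ Fintype.card κ := by
    classical
    have h := Ideal.height_le_card_of_mem_minimalPrimes_span_finset
      (s := Finset.univ.image ρ) (p := Q) (by simpa using hQ)
    exact h.trans (by exact_mod_cast Finset.card_image_le)
  have hfin : (Module.finrank (ResidueField A) (CotangentSpace A) : WithBot ℕ∞) = Q.height := by
    rw [(IsRegularLocalRing.iff_finrank_cotangentSpace A).1 inferInstance,
      IsLocalization.AtPrime.ringKrullDim_eq_height Q A]
  have hcard := hli.fintype_card_le_finrank
  have hfin' : ((Module.finrank (ResidueField A) (CotangentSpace A) : ℕ) : ℕ∞) = Q.height := by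
    exact_mod_cast hfin
  have hge : (Fintype.card κ : ℕ∞) ≤ Q.height := by
    rw [← hfin']; exact_mod_cast hcard
  have hht := le_antisymm hle hge
  refine ⟨hht, fun s hs => ?_⟩
  have hcard' : Fintype.card κ = Module.finrank (ResidueField A) (CotangentSpace A) := by
    rw [hht] at hfin'; exact_mod_cast hfin'.symm
  have hspan := hli.span_eq_top_of_card_eq_finrank' hcard'
  let v : κ → maximalIdeal A := fun j => ⟨algebraMap S _ (ρ j),
        (IsLocalization.AtPrime.to_map_mem_maximal_iff _ Q _).2 (hρ j)⟩
  have hspan' : Submodule.span A (Set.range v) = ⊤ := by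
    rw [← CotangentSpace.span_image_eq_top_iff, ← Set.range_comp]
    exact hspan
  have h1 := congrArg (Submodule.map (maximalIdeal A).subtype) hspan'
  rw [Submodule.map_span, Submodule.map_top, Submodule.range_subtype, ← Set.range_comp] at h1
  have h2 : algebraMap S A s ∈ (Ideal.span (Set.range ρ)).map (algebraMap S A) := by
    rw [Ideal.map_span, ← Set.range_comp]
    have : algebraMap S A s ∈ maximalIdeal A :=
      (IsLocalization.AtPrime.to_map_mem_maximal_iff _ Q _).2 hs
    rw [← h1] at this
    exact this
  obtain ⟨⟨y, t⟩, hy⟩ := (IsLocalization.mem_map_algebraMap_iff Q.primeCompl _).1 h2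
  rw [← map_mul, IsLocalization.eq_iff_exists Q.primeCompl] at hy
  obtain ⟨c, hc⟩ := hy
  refine ⟨c * t, (c * t).2, ?_⟩
  have : (c : S) * t * s = c * (s * t) := by ring
  rw [this, hc]
  exact Ideal.mul_mem_left _ _ y.2

theorem HasDepthGE.of_le {A M : Type*} [CommRing A] [IsLocalRing A] [AddCommGroup M] [Module A M]
    {m n : ℕ} (h : HasDepthGE A M n) (hmn : m ≤ n) : HasDepthGE A M m := by
  obtain ⟨rs, rfl, h1, h2⟩ := h
  refine ⟨rs.take m, by simpa using hmn, fun r hr => h1 r (List.mem_of_mem_take hr), ?_⟩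
  rw [← List.take_append_drop m rs, isWeaklyRegular_append_iff] at h2
  exact h2.1

variable [IsNoetherianRing R] {π : S →+* R} (hπ : Function.Surjective π)
  (hker : RingHom.ker π = Ideal.span (Set.range ρ))
  (hJ : ∀ 𝔭 ∈ minimalPrimes R, ∀ a : κ → S, ∑ j, a j * ρ j ∈ (𝔭.comap π) ^ 2 →
    ∀ j, a j ∈ 𝔭.comap π)

include hπ hker

omit [Fintype κ] [IsRegularRing S] [IsNoetherianRing R] in
theorem comap_mem_minimalPrimes_span {𝔭 : Ideal R} (h𝔭 : 𝔭 ∈ minimalPrimes R) :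
    𝔭.comap π ∈ (Ideal.span (Set.range ρ)).minimalPrimes := by
  rw [← hker]
  exact Ideal.minimalPrimes_comap_of_surjective hπ h𝔭

include hJ

omit [IsNoetherianRing R] in
-- Strict inclusions of primes of `R` pull back to strict inclusions in `S`, and the preimage of the
-- minimal prime at the bottom already has height equal to the number of equations.
theorem height_add_card_le_height_comap (n : ℕ) (P : Ideal R) [P.IsPrime] (hn : n ≤ P.height) :
    ((n + Fintype.card κ : ℕ) : ℕ∞) ≤ (P.comap π).height := by
  induction n generalizing P with
  | zero =>
    obtain ⟨𝔭, h𝔭, hle⟩ := Ideal.exists_minimalPrimes_le (bot_le : ⊥ ≤ P)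
    have := h𝔭.1.1
    rw [zero_add, ← (height_eq_and_forall_exists_mul_mem _
      (comap_mem_minimalPrimes_span hπ hker h𝔭) (hJ 𝔭 h𝔭)).1]
    exact Ideal.height_mono (Ideal.comap_mono hle)
  | succ n ih =>
    have h : ¬ P.height ≤ n := fun h => by
      have := hn.trans h
      norm_cast at this
      omega
    rw [Ideal.height_le_iff] at h
    push Not at h
    obtain ⟨q, hq, hqP, hle⟩ := h
    have hlt : q.comap π < P.comap π := by
      refine lt_of_le_of_ne (Ideal.comap_mono hqP.le) fun h => hqP.ne ?_
      exact Ideal.comap_injective_of_surjective π hπ h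
    refine le_trans ?_ (Ideal.height_add_one_le_of_lt_of_isPrime hlt)
    have := ih q hle
    push_cast at this ⊢
    rw [add_right_comm]
    gcongr

omit [IsNoetherianRing R] in
-- The local ring of `R` is a quotient of a regular local ring of dimension at least `n + card κ` by
-- `card κ` elements, and it has dimension `n`. So `HasDepthGE.quotient_ofList` applies.
theorem hasDepthGE_localization_atPrime (P : Ideal R) [P.IsPrime] (n : ℕ) (hn : P.height = n) :
    HasDepthGE (Localization.AtPrime P) (Localization.AtPrime P) n := by
  set Q := P.comap π with hQ
  set A := Localization.AtPrime Q
  set B := Localization.AtPrime P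
  obtain ⟨h, hh⟩ := ENat.ne_top_iff_exists.1 (Ideal.height_ne_top_of_isPrime (I := Q))
  have hle := height_add_card_le_height_comap hπ hker hJ n P hn.ge
  rw [← hQ, ← hh] at hle
  have hle : n + Fintype.card κ ≤ h := by exact_mod_cast hle
  have hdA : ringKrullDim A = h := by
    rw [IsLocalization.AtPrime.ringKrullDim_eq_height Q A, ← hh]; rfl
  have hdB : ringKrullDim B = n := by
    rw [IsLocalization.AtPrime.ringKrullDim_eq_height P B, hn]; rfl
  have hA := (IsRegularLocalRing.isDomain_and_hasDepthGE A h hdA).2.of_le hle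
  let f : A →+* B := Localization.localRingHom Q P π rfl
  have hf : Function.Surjective f := RingHom.surjective_localRingHom_of_surjective π hπ P
  have hfa : ∀ s, f (algebraMap S A s) = algebraMap R B (π s) := Localization.localRingHom_to_map _ _ _ _
  let fs : List A := (Finset.univ.toList.map ρ).map (algebraMap S A)
  have hfs : Ideal.ofList fs = (Ideal.span (Set.range ρ)).map (algebraMap S A) := by
    rw [← Ideal.map_ofList]
    congr 1
    simp [Ideal.ofList, Set.range]
  have hkf : RingHom.ker f = Ideal.ofList fs := by
    rw [hfs]
    refine le_antisymm (fun x hx => ?_) ?_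
    · obtain ⟨a, s, rfl⟩ := IsLocalization.exists_mk'_eq Q.primeCompl x
      have h1 : algebraMap R B (π a) = 0 := by
        rw [← hfa, ← IsLocalization.mk'_spec A a s, map_mul, RingHom.mem_ker.1 hx, zero_mul]
      obtain ⟨t, ht⟩ := (IsLocalization.map_eq_zero_iff P.primeCompl B _).1 h1
      obtain ⟨t', ht'⟩ := hπ t
      have ht'Q : t' ∈ Q.primeCompl := by
        change π t' ∉ P
        rw [ht']; exact t.2
      have h2 : t' * a ∈ Ideal.span (Set.range ρ) := by
        rw [← hker, RingHom.mem_ker, map_mul, ht', ht]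
      rw [IsLocalization.mk'_mem_map_algebraMap_iff]
      exact ⟨t', ht'Q, h2⟩
    · rw [Ideal.map_le_iff_le_comap, ← hker]
      intro x hx
      rw [Ideal.mem_comap, RingHom.mem_ker, hfa, RingHom.mem_ker.1 hx, map_zero]
  have hmem : ∀ x ∈ fs, x ∈ maximalIdeal A := by
    intro x hx
    simp only [fs, List.mem_map, exists_exists_and_eq_and] at hx
    obtain ⟨j, -, rfl⟩ := hx
    rw [IsLocalization.AtPrime.to_map_mem_maximal_iff _ Q, Ideal.mem_comap]
    have : ρ j ∈ RingHom.ker π := by rw [hker]; exact Ideal.subset_span ⟨j, rfl⟩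
    rw [RingHom.mem_ker.1 this]
    exact zero_mem _
  have hlen : fs.length = Fintype.card κ := by simp [fs]
  algebraize [f]
  have hdim : ringKrullDim (A ⧸ Module.annihilator A A ⊔ Ideal.ofList fs) ≤ n := by
    refine (ringKrullDim_le_of_surjective (Ideal.Quotient.factor (le_sup_right))
        (Ideal.Quotient.factor_surjective le_sup_right)).trans ?_
    rw [← hkf, ringKrullDim_eq_of_ringEquiv (RingHom.quotientKerEquivOfSurjective hf), hdB]
  have h1 := HasDepthGE.quotient_ofList (M := A) fs hmem (hlen ▸ hA) hdim
  refine HasDepthGE.map_of_surjective (A := A) hf (h1.congr ?_)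
  refine (Submodule.quotEquivOfEq _ (LinearMap.ker (Algebra.linearMap A B)) ?_).trans
    ((Algebra.linearMap A B).quotKerEquivOfSurjective hf)
  rw [smul_eq_mul, Ideal.mul_top, ← hkf]
  rfl

theorem isCohenMacaulayLocalRing_localization_atPrime (P : Ideal R) [P.IsPrime] :
    IsCohenMacaulayLocalRing (Localization.AtPrime P) := by
  obtain ⟨n, hn⟩ := ENat.ne_top_iff_exists.1 (Ideal.height_ne_top_of_isPrime (I := P))
  obtain ⟨rs, hlen, hmem, hreg⟩ := hasDepthGE_localization_atPrime hπ hker hJ P n hn.symm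
  refine ⟨inferInstance, rs, .of_isWeaklyRegular_of_mem_maximalIdeal _ hmem hreg, ?_⟩
  rw [IsLocalization.AtPrime.ringKrullDim_eq_height P, ← hn, hlen]

/-- In the localization at `P` the maximal ideal is associated, so the depth is at most the
dimension of the residue field, which is zero; but the depth is at least the height of `P`. -/
theorem mem_minimalPrimes_of_mem_associatedPrimes {P : Ideal R} (hP : P ∈ associatedPrimes R R) :
    P ∈ minimalPrimes R := by
  have := hP.isPrime
  obtain ⟨n, hn⟩ := ENat.ne_top_iff_exists.1 (Ideal.height_ne_top_of_isPrime (I := P))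
  have h1 := hasDepthGE_localization_atPrime hπ hker hJ P n hn.symm
  have h2 : maximalIdeal (Localization.AtPrime P) ∈
      associatedPrimes (Localization.AtPrime P) (Localization.AtPrime P) :=
    Module.associatedPrimes.mem_associatedPrimes_of_comap_mem_associatedPrimes_of_isLocalizedModule
      P.primeCompl (Algebra.linearMap R _) _ (by simpa [Localization.AtPrime.under_maximalIdeal] using hP)
  have h3 := h1.le_ringKrullDim_quotient h2
  have h4 : ringKrullDim (Localization.AtPrime P ⧸ maximalIdeal (Localization.AtPrime P)) = 0 :=
    ringKrullDim_eq_zero_of_field (ResidueField (Localization.AtPrime P))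
  rw [h4] at h3
  rw [← Ideal.height_eq_zero_iff, ← hn]
  exact_mod_cast le_antisymm (by exact_mod_cast h3) (Nat.zero_le n)

/-- The annihilator of a nonzero nilpotent lies in an associated prime `P`, which is minimal. The
localization at `P` is a field, so some element outside `P` kills the nilpotent, a contradiction. -/
theorem isReduced_of_completeIntersection : IsReduced R := by
  refine ⟨fun a ha => ?_⟩
  by_contra h0
  obtain ⟨P, hP, hle⟩ := exists_le_isAssociatedPrime_of_isNoetherianRing R a h0
  have := hP.isPrime
  have hmin := mem_minimalPrimes_of_mem_associatedPrimes hπ hker hJ hP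
  obtain ⟨s, hs⟩ := hπ a
  have hsP : s ∈ P.comap π := by
    rw [Ideal.mem_comap, hs]
    obtain ⟨n, hn⟩ := ha
    exact ‹P.IsPrime›.mem_of_pow_mem n (hn ▸ zero_mem P)
  obtain ⟨t, ht, hts⟩ := (height_eq_and_forall_exists_mul_mem _
    (comap_mem_minimalPrimes_span hπ hker hmin) (hJ P hmin)).2 s hsP
  rw [← hker, RingHom.mem_ker, map_mul, hs] at hts
  exact ht (hle (by simpa [Submodule.mem_colon_singleton] using hts))

omit hJ [IsRegularRing S] [IsNoetherianRing R] in
theorem height_comap_le_height_add_card [IsNoetherianRing S] (P : Ideal R) [P.IsPrime] :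
    (P.comap π).height ≤ P.height + Fintype.card κ := by
  have hsub : Set.range ρ ⊆ P.comap π := by
    rw [← Ideal.span_le (I := P.comap π), ← hker, RingHom.ker_eq_comap_bot]
    exact Ideal.comap_mono bot_le
  refine (Ideal.height_le_height_add_encard_of_subset (Set.range ρ) hsub).trans ?_
  gcongr
  · let e : (S ⧸ Ideal.span (Set.range ρ)) ≃+* R :=
      (Ideal.quotEquivOfEq hker.symm).trans (RingHom.quotientKerEquivOfSurjective hπ)
    have he : (e : (S ⧸ Ideal.span (Set.range ρ)) →+* R).comp (Ideal.Quotient.mk _) = π := by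
      ext x; rfl
    rw [← RingEquiv.height_map e]
    refine (congrArg Ideal.height ?_).le
    change Ideal.map (e : (S ⧸ Ideal.span (Set.range ρ)) →+* R) _ = P
    rw [Ideal.map_map, he, Ideal.map_comap_of_surjective π hπ]
  · rw [← Set.image_univ]
    refine (Set.encard_image_le _ _).trans ?_
    rw [Set.encard_univ, ENat.card_eq_coe_fintype_card]

end CompleteIntersection

theorem ringKrullDim_quotient_eq_coheight {R : Type*} [CommRing R] (I : Ideal R) [hI : I.IsPrime] :
    ringKrullDim (R ⧸ I) = Order.coheight (⟨I, hI⟩ : PrimeSpectrum R) := by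
  rw [ringKrullDim_quotient, Order.coheight_eq_krullDim_Ici]
  rfl

/-- The upper bound is height plus coheight at most the dimension of the polynomial ring. For the
lower bound take a maximal ideal `𝔪` over `𝔭`: its preimage has height `card ι`, so its own height
is at least `card ι - card κ`. The local ring at `𝔪` has depth equal to this height, which bounds
the dimension of its quotient by the associated prime `𝔭` from below. -/
theorem ringKrullDim_quotient_add_card {ι k R : Type v} {κ : Type*} [Finite ι] [Field k] [Fintype κ]
    [CommRing R] {π : MvPolynomial ι k →+* R} {ρ : κ → MvPolynomial ι k}
    (hπ : Function.Surjective π) (hker : RingHom.ker π = Ideal.span (Set.range ρ))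
    (hJ : ∀ 𝔭 ∈ minimalPrimes R, ∀ a : κ → MvPolynomial ι k, ∑ j, a j * ρ j ∈ (𝔭.comap π) ^ 2 →
      ∀ j, a j ∈ 𝔭.comap π) {𝔭 : Ideal R} (h𝔭 : 𝔭 ∈ minimalPrimes R) :
    ringKrullDim (R ⧸ 𝔭) + Fintype.card κ = Nat.card ι := by
  have : IsNoetherianRing R := isNoetherianRing_of_surjective _ _ π hπ
  have h𝔭p : 𝔭.IsPrime := h𝔭.1.1
  set x : PrimeSpectrum R := ⟨𝔭, h𝔭p⟩
  rw [ringKrullDim_quotient_eq_coheight]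
  have hmono : StrictMono (PrimeSpectrum.comap π) := fun a b hab =>
    lt_of_le_of_ne (Ideal.comap_mono hab.le) fun h => hab.ne
      (PrimeSpectrum.comap_injective_of_surjective π hπ h)
  refine le_antisymm ?_ ?_
  · have h1 := Order.coheight_le_coheight_apply_of_strictMono _ hmono x
    have h2 : (PrimeSpectrum.comap π x).asIdeal.height = Fintype.card κ :=
      (height_eq_and_forall_exists_mul_mem _ (comap_mem_minimalPrimes_span hπ hker h𝔭) (hJ 𝔭 h𝔭)).1
    rw [PrimeSpectrum.height_eq_orderHeight] at h2
    have h3 : ((Order.height (PrimeSpectrum.comap π x) + Order.coheight (PrimeSpectrum.comap π x) : ℕ∞) :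
        WithBot ℕ∞) ≤ ringKrullDim (MvPolynomial ι k) := by
      rw [ringKrullDim, Order.krullDim_eq_iSup_height_add_coheight_of_nonempty]
      exact_mod_cast le_iSup (fun a => Order.height a + Order.coheight a) (PrimeSpectrum.comap π x)
    rw [MvPolynomial.ringKrullDim_of_isNoetherianRing, ringKrullDim_eq_zero_of_field, zero_add, h2] at h3
    refine le_trans ?_ h3
    rw [add_comm]
    exact_mod_cast add_le_add_right h1 _
  · obtain ⟨𝔪, h𝔪, hle⟩ := Ideal.exists_le_maximal 𝔭 h𝔭p.ne_top
    obtain ⟨n, hn⟩ := ENat.ne_top_iff_exists.1 (Ideal.height_ne_top_of_isPrime (I := 𝔪))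
    have h1 := height_comap_le_height_add_card hπ hker 𝔪
    have hmax : (𝔪.comap π).IsMaximal := Ideal.comap_isMaximal_of_surjective π hπ
    rw [MvPolynomial.height_of_isMaximal k ι _ hmax, ← hn] at h1
    have h2 := hasDepthGE_localization_atPrime hπ hker hJ 𝔪 n hn.symm
    set y : Ideal (Localization.AtPrime 𝔪) := 𝔭.map (algebraMap R _)
    have hdisj : Disjoint (𝔪.primeCompl : Set R) 𝔭 :=
      Set.disjoint_left.2 fun a ha ha' => ha (hle ha')
    have hy : y.IsPrime := IsLocalization.isPrime_of_isPrime_disjoint 𝔪.primeCompl _ 𝔭 h𝔭p hdisj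
    have hcomap : y.comap (algebraMap R _) = 𝔭 :=
      IsLocalization.under_map_of_isPrime_disjoint 𝔪.primeCompl _ h𝔭p hdisj
    have hass : 𝔭 ∈ associatedPrimes R R := by
      refine Module.associatedPrimes.minimalPrimes_annihilator_subset_associatedPrimes R R ?_
      rwa [Module.annihilator_eq_bot.2 inferInstance]
    have h3 : y ∈ associatedPrimes (Localization.AtPrime 𝔪) (Localization.AtPrime 𝔪) :=
      Module.associatedPrimes.mem_associatedPrimes_of_comap_mem_associatedPrimes_of_isLocalizedModule
        𝔪.primeCompl (Algebra.linearMap R _) _ (by rwa [hcomap])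
    have h4 := h2.le_ringKrullDim_quotient h3
    rw [ringKrullDim_quotient_eq_coheight] at h4
    have h5 := Order.coheight_le_coheight_apply_of_strictMono
      (PrimeSpectrum.comap (algebraMap R (Localization.AtPrime 𝔪))) (fun a b hab =>
        lt_of_le_of_ne (Ideal.comap_mono hab.le) fun h => hab.ne
        (PrimeSpectrum.localization_comap_injective _ 𝔪.primeCompl h)) ⟨y, hy⟩
    have h6 : PrimeSpectrum.comap (algebraMap R (Localization.AtPrime 𝔪)) ⟨y, hy⟩ = x :=
      PrimeSpectrum.ext hcomap
    rw [h6] at h5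
    have h7 : (n : ℕ∞) ≤ Order.coheight x := le_trans (by exact_mod_cast h4) h5
    exact_mod_cast h1.trans (add_le_add_left h7 _)

namespace PhiNModule

/-! ### Ranks of sparse matrices -/

section Rank

variable {L : Type*} [Field L] {m n : Type*} [Fintype m] [Fintype n]

theorem rank_le_card_row_ne_zero (M : Matrix m n L) :
    M.rank ≤ Nat.card {i // ∃ j, M i j ≠ 0} := by
  classical
  let w : m → L := fun i => if ∃ j, M i j ≠ 0 then 1 else 0
  have h : M = Matrix.diagonal w * M := by
    ext i j
    rw [Matrix.diagonal_mul]
    by_cases hi : ∃ j, M i j ≠ 0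
    · simp [w, hi]
    · push Not at hi
      simp [w, hi]
  calc M.rank ≤ (Matrix.diagonal w).rank := by
        conv_lhs => rw [h]
        exact Matrix.rank_mul_le_left _ _
    _ = _ := by
        rw [Matrix.rank_diagonal, ← Nat.card_eq_fintype_card]
        refine Nat.card_congr (Equiv.subtypeEquivRight fun i => ?_)
        simp [w]

/-- The rank of the matrix of an injective partial function. -/
theorem rank_of_ite (r : m → n → Prop) [∀ i j, Decidable (r i j)]
    (hr : ∀ x y z, r x y → r x z → y = z) (hr' : ∀ x y z, r x z → r y z → x = y) :
    (Matrix.of fun i j => if r i j then (1 : L) else 0).rank = Nat.card {i // ∃ j, r i j} := by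
  classical
  set M : Matrix m n L := Matrix.of fun i j => if r i j then (1 : L) else 0
  refine le_antisymm ((rank_le_card_row_ne_zero M).trans_eq ?_) ?_
  · exact Nat.card_congr (Equiv.subtypeEquivRight fun i => by simp [M])
  · have h : M * M.transpose = Matrix.diagonal fun i => if ∃ j, r i j then 1 else 0 := by
      ext i i'
      rw [Matrix.mul_apply]
      simp only [M, Matrix.transpose_apply, Matrix.of_apply, mul_ite, mul_one, mul_zero, ← ite_and]
      rw [Matrix.diagonal_apply]
      by_cases hi : ∃ j, r i j
      · obtain ⟨j, hj⟩ := hi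
        rw [Finset.sum_eq_single j, if_pos (⟨j, hj⟩ : ∃ j, r i j)]
        · by_cases hii : i = i'
          · subst hii; simp [hj]
          · rw [if_neg hii, if_neg fun h => hii (hr' _ _ _ hj h.1)]
        · intro b _ hb
          exact if_neg fun h => hb (hr _ _ _ h.2 hj)
        · simp
      · rw [if_neg hi, ite_self]
        exact Finset.sum_eq_zero fun j _ => if_neg fun h => hi ⟨j, h.2⟩
    have h1 := Matrix.rank_mul_le_left M M.transpose
    rw [h, Matrix.rank_diagonal, ← Nat.card_eq_fintype_card] at h1
    refine le_trans (Nat.card_congr (Equiv.subtypeEquivRight fun i => ?_)).le h1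
    simp

end Rank

/-! ### Partitions and nilpotent Jordan matrices -/

section Partition

variable {d : ℕ}

/-- The rank of the `k`-th power of a nilpotent matrix whose Jordan type is the partition `π`. -/
def powRank (π : d.Partition) (k : ℕ) : ℕ := (π.parts.map fun x => x - k).sum

/-- For a single part `x`, the second difference of the truncated subtraction `k ↦ x - k` is the
indicator of `x = k + 1`. This recovers multiplicities from ranks. -/
theorem powRank_add_count (π : d.Partition) (k : ℕ) :
    powRank π k + powRank π (k + 2) = 2 * powRank π (k + 1) + π.parts.count (k + 1) := by
  unfold powRank
  induction π.parts using Multiset.induction_on with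
  | empty => simp
  | cons a s ih =>
    simp only [Multiset.map_cons, Multiset.sum_cons, Multiset.count_cons]
    split_ifs with h <;> omega

theorem powRank_zero (π : d.Partition) : powRank π 0 = d := by
  simp [powRank, π.parts_sum]

/-- A partition is determined by the function `powRank`. -/
theorem eq_of_powRank_eq {π μ : d.Partition} (h : ∀ k, powRank π (k + 1) = powRank μ (k + 1)) :
    π = μ := by
  have h' : ∀ k, powRank π k = powRank μ k := by
    rintro (_ | k)
    · rw [powRank_zero, powRank_zero]
    · exact h k
  ext k
  rcases k with _ | k
  · rw [Multiset.count_eq_zero_of_notMem, Multiset.count_eq_zero_of_notMem]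
    · exact fun h => (μ.parts_pos h).ne rfl
    · exact fun h => (π.parts_pos h).ne rfl
  · have h1 := powRank_add_count π k
    have h2 := powRank_add_count μ k
    simp only [h'] at h1
    omega

theorem exists_equiv_of_sort_eq {m : ℕ} (k : Fin m → ℕ) (π : d.Partition)
    (h : π.parts.sort (· ≤ ·) = List.ofFn k) :
    ∃ e : (Σ l, Fin (k l)) ≃ Fin d, ∀ x y,
      IsLink π (e x) (e y) ↔ x.1 = y.1 ∧ (y.2 : ℕ) = x.2 + 1 := by
  have hd : ∑ l, k l = d := by
    rw [← List.sum_ofFn, ← h, ← Multiset.sum_coe, Multiset.sort_eq, π.parts_sum]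
  -- Partial sums, constant from `m` on. The pair `(l, a)` is placed at position `s l + a`, and the
  -- partial sums excluded by `IsLink` are the starts of the intervals.
  let s : ℕ → ℕ := fun n => ((List.ofFn k).take n).sum
  have hs : ∀ l : Fin m, s (l + 1) = s l + k l := fun l => by
    simp only [s]
    rw [List.sum_take_succ _ _ (by simp)]
    simp
  have hmono : Monotone s := by
    refine monotone_nat_of_le_succ fun n => ?_
    by_cases hn : n < m
    · rw [hs ⟨n, hn⟩]; simp
    · simp only [s]
      rw [List.take_of_length_le (by simp; omega), List.take_of_length_le (by simp; omega)]
  let e : (Σ l, Fin (k l)) ≃ Fin d := finSigmaFinEquiv.trans (finCongr hd)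
  have he : ∀ x, (e x : ℕ) = s x.1 + x.2 := fun x => by
    simp only [e, Equiv.trans_apply, finCongr_apply_coe, finSigmaFinEquiv_apply, s]
    rw [← List.sum_ofFn]
    congr 2
    refine List.ext_getElem (by simp) fun i h1 h2 => ?_
    simp
  refine ⟨e, fun x y => ?_⟩
  rw [IsLink, h, he, he]
  change (s y.1 + y.2 = s x.1 + x.2 + 1 ∧ ∀ n, s n ≠ s x.1 + x.2 + 1) ↔ _
  have hx := x.2.2
  have hsx := hs x.1
  have hsy := hs y.1
  constructor
  · rintro ⟨h1, h2⟩
    have h3 := h2 (x.1 + 1)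
    have h4 : x.1 = y.1 := by
      rcases lt_trichotomy x.1 y.1 with h4 | h4 | h4
      · have := hmono (show (x.1 : ℕ) + 1 ≤ y.1 from h4)
        omega
      · exact h4
      · have := hmono (show (y.1 : ℕ) + 1 ≤ x.1 from h4)
        have := y.2.2
        omega
    have h5 : s y.1 = s x.1 := by rw [h4]
    exact ⟨h4, by omega⟩
  · rintro ⟨h1, h2⟩
    have h5 : s y.1 = s x.1 := by rw [h1]
    have h6 : k y.1 = k x.1 := by rw [h1]
    refine ⟨by omega, fun n hn => ?_⟩
    have hy : (x.2 : ℕ) + 1 < k x.1 := by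
      have := y.2.2
      omega
    rcases le_or_gt n x.1 with hnx | hnx
    · have := hmono hnx
      omega
    · have := hmono (show (x.1 : ℕ) + 1 ≤ n from hnx)
      omega

/-- The positions `0, …, d - 1` are partitioned into intervals of lengths `k₁ ≤ ⋯ ≤ kₘ`, with links
between consecutive elements of each interval. -/
theorem exists_equiv_isLink (π : d.Partition) :
    ∃ (m : ℕ) (k : Fin m → ℕ), (∀ l, 0 < k l) ∧ π.parts = Finset.univ.val.map k ∧
      ∃ e : (Σ l, Fin (k l)) ≃ Fin d, ∀ x y,
        IsLink π (e x) (e y) ↔ x.1 = y.1 ∧ (y.2 : ℕ) = x.2 + 1 := by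
  have h : List.ofFn (π.parts.sort (· ≤ ·)).get = π.parts.sort (· ≤ ·) := List.ofFn_get _
  have hk : ∀ l, 0 < (π.parts.sort (· ≤ ·)).get l := fun l =>
    π.parts_pos ((Multiset.mem_sort (· ≤ ·)).1 (List.get_mem _ _))
  refine ⟨_, (π.parts.sort (· ≤ ·)).get, hk, ?_, exists_equiv_of_sort_eq _ π h.symm⟩
  rw [Fin.univ_val_map, h, Multiset.sort_eq]

/-- A finite family of positive integers with sum `d` defines a partition of `d`. -/
theorem exists_partition {κ : Type*} [Fintype κ] (k : κ → ℕ) (hk : ∀ l, 0 < k l)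
    (hd : ∑ l, k l = d) :
    ∃ (π : d.Partition) (e : (Σ l, Fin (k l)) ≃ Fin d), ∀ x y,
      IsLink π (e x) (e y) ↔ x.1 = y.1 ∧ (y.2 : ℕ) = x.2 + 1 := by
  classical
  let c := Fintype.equivFin κ
  let k₁ : Fin (Fintype.card κ) → ℕ := k ∘ c.symm
  let τ : Fin (Fintype.card κ) ≃ κ := (Tuple.sort k₁).trans c.symm
  have hmon : Monotone (k ∘ τ) := Tuple.monotone_sort k₁
  let π : d.Partition :=
    { parts := Finset.univ.val.map (k ∘ τ)
      parts_pos := by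
        intro i hi
        obtain ⟨l, -, rfl⟩ := Multiset.mem_map.1 hi
        exact hk _
      parts_sum := by
        rw [← hd, ← τ.sum_comp]
        rfl }
  have hsort : π.parts.sort (· ≤ ·) = List.ofFn (k ∘ τ) := by
    refine List.Perm.eq_of_pairwise' (r := (· ≤ ·)) (Multiset.pairwise_sort _ _)
      (List.pairwise_ofFn.2 fun i j hij => hmon hij.le) ?_
    rw [← Multiset.coe_eq_coe, Multiset.sort_eq, ← Fin.univ_val_map]
  obtain ⟨e, he⟩ := exists_equiv_of_sort_eq _ π hsort
  let E : (Σ l, Fin ((k ∘ τ) l)) ≃ (Σ l, Fin (k l)) :=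
    Equiv.sigmaCongrLeft (β := fun l => Fin (k l)) τ
  refine ⟨π, E.symm.trans e, fun x y => ?_⟩
  obtain ⟨x, rfl⟩ := E.surjective x
  obtain ⟨y, rfl⟩ := E.surjective y
  rw [Equiv.trans_apply, Equiv.trans_apply, E.symm_apply_apply, E.symm_apply_apply, he]
  exact and_congr τ.injective.eq_iff.symm Iff.rfl

open scoped Classical in
theorem nilpotentJordan_pow_apply (π : d.Partition) (L : Type*) [Field L] {κ : Type*} [Fintype κ] {k : κ → ℕ}
    (e : (Σ l, Fin (k l)) ≃ Fin d) (he : ∀ x y,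
      IsLink π (e x) (e y) ↔ x.1 = y.1 ∧ (y.2 : ℕ) = x.2 + 1) (n : ℕ) (x y : Σ l, Fin (k l)) :
    (nilpotentJordan π L ^ n) (e x) (e y) = if x.1 = y.1 ∧ (y.2 : ℕ) = x.2 + n then 1 else 0 := by
  induction n generalizing y with
  | zero =>
    rw [pow_zero, Matrix.one_apply]
    refine if_congr ?_ rfl rfl
    rw [e.injective.eq_iff, Sigma.ext_iff]
    refine and_congr_right fun h => ?_
    obtain ⟨x, a⟩ := x
    obtain ⟨y, b⟩ := y
    obtain rfl : x = y := h
    simp [Fin.ext_iff, eq_comm]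
  | succ n ih =>
    rw [pow_succ, Matrix.mul_apply, ← e.sum_comp]
    have hJ : ∀ z, nilpotentJordan π L (e z) (e y) =
        if z.1 = y.1 ∧ (y.2 : ℕ) = z.2 + 1 then 1 else 0 := fun z => if_congr (he z y) rfl rfl
    simp only [ih, hJ, ite_mul, one_mul, zero_mul, ← ite_and]
    by_cases h : x.1 = y.1 ∧ (y.2 : ℕ) = x.2 + (n + 1)
    · rw [if_pos h]
      have hlt : (x.2 : ℕ) + n < k x.1 := by
        have := y.2.2
        have h6 : k y.1 = k x.1 := by rw [h.1]
        omega
      rw [Finset.sum_eq_single ⟨x.1, x.2 + n, hlt⟩, if_pos]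
      · exact ⟨⟨rfl, rfl⟩, h.1, by simp only; omega⟩
      · rintro ⟨z, c⟩ - hz
        refine if_neg fun h' => hz ?_
        obtain ⟨⟨h1, h2⟩, -⟩ := h'
        simp only at h1 h2
        subst h1
        simp [Fin.ext_iff, h2]
      · simp
    · rw [if_neg h]
      refine Finset.sum_eq_zero fun z _ => if_neg fun h' => h ⟨h'.1.1.trans h'.2.1, ?_⟩
      have := h'.1.2
      have := h'.2.2
      omega

theorem rank_nilpotentJordan_pow (π : d.Partition) (L : Type*) [Field L] (n : ℕ) :
    (nilpotentJordan π L ^ n).rank = powRank π n := by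
  classical
  obtain ⟨m, k, hk, hp, e, he⟩ := exists_equiv_isLink π
  have : nilpotentJordan π L ^ n = Matrix.reindex e e (Matrix.of fun x y =>
      if x.1 = y.1 ∧ (y.2 : ℕ) = x.2 + n then 1 else 0) := by
    ext i j
    obtain ⟨x, rfl⟩ := e.surjective i
    obtain ⟨y, rfl⟩ := e.surjective j
    rw [nilpotentJordan_pow_apply π L e he]
    simp
  rw [this, Matrix.rank_reindex,
    rank_of_ite (fun x y : Σ l, Fin (k l) => x.1 = y.1 ∧ (y.2 : ℕ) = x.2 + n)]
  · have E : {x : Σ l, Fin (k l) // ∃ y : Σ l, Fin (k l), x.1 = y.1 ∧ (y.2 : ℕ) = x.2 + n} ≃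
        Σ l, Fin (k l - n) :=
      { toFun := fun x => ⟨x.1.1, x.1.2, by
          obtain ⟨y, h1, h2⟩ := x.2
          have := y.2.2
          have h6 : k y.1 = k x.1.1 := by rw [h1]
          omega⟩
        invFun := fun x => ⟨⟨x.1, x.2, by omega⟩, ⟨x.1, x.2 + n, by omega⟩, rfl, rfl⟩
        left_inv := fun x => rfl
        right_inv := fun x => rfl }
    rw [Nat.card_congr E, Nat.card_eq_fintype_card, Fintype.card_sigma, powRank, hp,
      Multiset.map_map]
    simp [Finset.sum]
  · rintro ⟨x, a⟩ ⟨y, b⟩ ⟨z, c⟩ ⟨h1, h2⟩ ⟨h3, h4⟩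
    simp only at h1 h2 h3 h4
    subst h1 h3
    simp [Fin.ext_iff, h2, h4]
  · rintro ⟨x, a⟩ ⟨y, b⟩ ⟨z, c⟩ ⟨h1, h2⟩ ⟨h3, h4⟩
    simp only at h1 h2 h3 h4
    subst h1 h3
    have : a = b := Fin.ext (by omega)
    rw [this]

end Partition

end PhiNModule

namespace PhiNModule

open Polynomial

/-! ### Existence and uniqueness of the nilpotent Jordan form -/

section JordanForm

variable {L : Type*} [Field L] {d : ℕ}

theorem HasNilpotentJordanType.of_mul_eq {M S : Matrix (Fin d) (Fin d) L} {π : d.Partition}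
    (hS : IsUnit S) (h : M * S = S * nilpotentJordan π L) : HasNilpotentJordanType M π := by
  obtain ⟨S, rfl⟩ := hS
  refine ⟨S, ?_⟩
  rw [← h, mul_assoc, ← Units.val_mul, mul_inv_cancel, Units.val_one, mul_one]

theorem HasNilpotentJordanType.exists_mul_eq {M : Matrix (Fin d) (Fin d) L} {π : d.Partition}
    (h : HasNilpotentJordanType M π) :
    ∃ S : GL (Fin d) L, M * S.val = S.val * nilpotentJordan π L := by
  obtain ⟨S, rfl⟩ := h
  refine ⟨S, ?_⟩
  rw [mul_assoc, ← Units.val_mul, inv_mul_cancel, Units.val_one, mul_one]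

theorem HasNilpotentJordanType.conj {M : Matrix (Fin d) (Fin d) L} {π : d.Partition}
    (h : HasNilpotentJordanType M π) {S M' : Matrix (Fin d) (Fin d) L} (hS : IsUnit S)
    (h' : M' * S = S * M) : HasNilpotentJordanType M' π := by
  obtain ⟨T, hT⟩ := h.exists_mul_eq
  refine .of_mul_eq (hS.mul T.isUnit) ?_
  rw [← mul_assoc, h', mul_assoc, hT, mul_assoc]

theorem HasNilpotentJordanType.rank_pow {M : Matrix (Fin d) (Fin d) L} {π : d.Partition}
    (h : HasNilpotentJordanType M π) (k : ℕ) : (M ^ k).rank = powRank π k := by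
  obtain ⟨S, rfl⟩ := h
  rw [← rank_nilpotentJordan_pow π L k, Units.conj_pow,
    Matrix.rank_mul_eq_left_of_isUnit_det _ _ ((Matrix.isUnit_iff_isUnit_det _).1 S⁻¹.isUnit),
    Matrix.rank_mul_eq_right_of_isUnit_det _ _ ((Matrix.isUnit_iff_isUnit_det _).1 S.isUnit)]

theorem HasNilpotentJordanType.eq {M : Matrix (Fin d) (Fin d) L} {π μ : d.Partition}
    (h : HasNilpotentJordanType M π) (h' : HasNilpotentJordanType M μ) : π = μ :=
  eq_of_powRank_eq fun k => by rw [← h.rank_pow, h'.rank_pow]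

theorem exists_basis_quotient_X_pow (k : ℕ) :
    ∃ b : Module.Basis (Fin k) L (L[X] ⧸ L[X] ∙ (X : L[X]) ^ k),
      ∀ a, b a = Submodule.Quotient.mk (X ^ (a : ℕ)) := by
  let b : Module.Basis (Fin k) L (AdjoinRoot ((X : L[X]) ^ k)) :=
    (AdjoinRoot.powerBasis' (monic_X_pow k)).basis.reindex (finCongr (by simp))
  have hb : ∀ a, b a = AdjoinRoot.mk ((X : L[X]) ^ k) (X ^ (a : ℕ)) := fun a => by
    simp [b, PowerBasis.coe_basis]
  exact ⟨b, hb⟩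

/-- Letting `X` act as `T` makes `V` an `X`-power torsion module over the principal ideal domain
`L[X]`. The structure theorem splits it into modules `L[X] / X ^ k` with monomial bases. Blocks of
size zero may occur. -/
theorem exists_basis_of_isNilpotent {V : Type*} [AddCommGroup V] [Module L V]
    [FiniteDimensional L V] (T : V →ₗ[L] V) (hT : IsNilpotent T) :
    ∃ (m : ℕ) (k : Fin m → ℕ) (b : Module.Basis (Σ l, Fin (k l)) L V), ∀ l (a : Fin (k l)),
      T (b ⟨l, a⟩) = if h : (a : ℕ) + 1 < k l then b ⟨l, a + 1, h⟩ else 0 := by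
  obtain ⟨n, hn⟩ := hT
  have htor : Module.IsTorsion' (Module.AEval' T) (Submonoid.powers (X : L[X])) := by
    intro x
    obtain ⟨x, rfl⟩ := (Module.AEval'.of T).surjective x
    have h : (X : L[X]) ^ n • Module.AEval'.of T x = 0 := by
      rw [Module.AEval'.X_pow_smul_of, hn, zero_smul, map_zero]
    exact ⟨⟨X ^ n, Submonoid.mem_powers_iff _ _ |>.2 ⟨n, rfl⟩⟩, h⟩
  obtain ⟨m, k, ⟨e⟩⟩ := Module.torsion_by_prime_power_decomposition irreducible_X htor
  choose c hc using fun i => exists_basis_quotient_X_pow (L := L) (k i)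
  let b := ((DFinsupp.basis c).map (e.restrictScalars L).symm).map (Module.AEval'.of T).symm
  have hb : ∀ l a, b ⟨l, a⟩ = (Module.AEval'.of T).symm (e.symm (DFinsupp.single l (c l a))) :=
    fun l a => by
      have h : DFinsupp.basis c ⟨l, a⟩ = DFinsupp.single l (c l a) := by
        simp [DFinsupp.basis, DFinsupp.mapRange_single]
      rw [← h]
      rfl
  refine ⟨m, k, b, fun l a => ?_⟩
  have h1 : T (b ⟨l, a⟩) = (Module.AEval'.of T).symm
      (e.symm (DFinsupp.single l (Submodule.Quotient.mk (X ^ ((a : ℕ) + 1))))) := by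
    rw [hb, ← Module.AEval'.of_symm_X_smul, ← map_smul]
    congr 2
    refine (DFinsupp.single_smul (β := fun i => L[X] ⧸ L[X] ∙ (X : L[X]) ^ k i)
      (i := l) (X : L[X]) (c l a)).symm.trans ?_
    rw [hc, ← Submodule.Quotient.mk_smul, smul_eq_mul, ← pow_succ']
  rw [h1]
  split_ifs with h
  · rw [hb, hc]
  · have : (Submodule.Quotient.mk (X ^ ((a : ℕ) + 1)) : L[X] ⧸ L[X] ∙ (X : L[X]) ^ k l) = 0 := by
      rw [Submodule.Quotient.mk_eq_zero, Submodule.mem_span_singleton]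
      exact ⟨1, by rw [one_smul]; congr 1; have := a.2; omega⟩
    rw [this, DFinsupp.single_zero, map_zero, map_zero]

theorem exists_hasNilpotentJordanType {M : Matrix (Fin d) (Fin d) L} (hM : IsNilpotent M) :
    ∃ π, HasNilpotentJordanType M π := by
  obtain ⟨m, k, b, hb⟩ := exists_basis_of_isNilpotent (Matrix.toLin' M) (by
    obtain ⟨n, hn⟩ := hM
    exact ⟨n, by rw [← Matrix.toLin'_pow, hn, map_zero]⟩)
  -- Parts of a partition are positive, so empty blocks are dropped.
  let κ := {l // 0 < k l}
  have hd : ∑ l : κ, k l = d := by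
    have h1 := Module.finrank_eq_card_basis b
    rw [Module.finrank_fin_fun, Fintype.card_sigma] at h1
    simp only [Fintype.card_fin] at h1
    rw [h1]
    rw [← Finset.sum_filter_of_ne (p := fun l => 0 < k l) fun l _ h => Nat.pos_of_ne_zero h]
    exact (Finset.sum_subtype _ (by simp) _).symm
  obtain ⟨π, e, he⟩ := exists_partition (κ := κ) (fun l => k l) (fun l => l.2) hd
  -- Each block is reversed: multiplication by `X` raises the index of a basis vector, whereas the
  -- Jordan matrix with ones above the diagonal lowers it.
  let b' : (Σ l : κ, Fin (k l)) ≃ Σ l, Fin (k l) :=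
    { toFun := fun x => ⟨x.1, x.2.rev⟩
      invFun := fun x => ⟨⟨x.1, by have := x.2.2; omega⟩, x.2.rev⟩
      left_inv := fun x => by simp only [Fin.rev_rev]; rfl
      right_inv := fun x => by simp only [Fin.rev_rev] }
  let B : Module.Basis (Fin d) L (Fin d → L) := b.reindex (b'.symm.trans e)
  let S : Matrix (Fin d) (Fin d) L := Matrix.of fun i j => B j i
  refine ⟨π, .of_mul_eq (S := S) ?_ ?_⟩
  · rw [← Matrix.linearIndependent_cols_iff_isUnit]
    exact B.linearIndependent
  · ext i j
    obtain ⟨y, rfl⟩ := e.surjective j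
    have h1 : (M * S) i (e y) = Matrix.toLin' M (B (e y)) i := rfl
    have hB : ∀ y, B (e y) = b ⟨y.1, y.2.rev⟩ := fun y => by
      rw [Module.Basis.reindex_apply, Equiv.symm_trans_apply, Equiv.symm_symm, e.symm_apply_apply]
      rfl
    rw [h1, hB, hb, Matrix.mul_apply]
    have h2 : ∀ x, S i (e x) * nilpotentJordan π L (e x) (e y) = if x.1 = y.1 ∧ (y.2 : ℕ) = x.2 + 1 then
        b ⟨x.1, x.2.rev⟩ i else 0 := fun x => by
      simp only [nilpotentJordan, Matrix.of_apply, he, mul_ite, mul_one, mul_zero, S, hB]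
    rw [← e.sum_comp]
    simp only [h2]
    have hy := y.2.2
    have hrev := Fin.val_rev y.2
    split_ifs with h
    · have hlt : 0 < (y.2 : ℕ) := by omega
      rw [Finset.sum_eq_single ⟨y.1, y.2 - 1, by omega⟩, if_pos ⟨rfl, by simp only; omega⟩]
      · refine congrArg (fun c => b ⟨y.1, c⟩ i) (Fin.ext ?_)
        simp only [Fin.val_rev]
        omega
      · rintro ⟨z, c⟩ - hz
        refine if_neg fun h' => hz ?_
        obtain ⟨h1, h2⟩ := h'
        simp only at h1 h2
        subst h1
        simp only [Sigma.mk.injEq, heq_eq_eq, true_and, Fin.ext_iff]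
        omega
      · simp
    · symm
      refine Finset.sum_eq_zero fun z _ => if_neg fun h' => h ?_
      rw [Fin.val_rev]
      omega

end JordanForm

end PhiNModule

namespace PhiNModule

open Polynomial
open scoped Kronecker

/-! ### The linear map `n ↦ n A - q A n` and diagonalization -/

section Intertwiner

/-- The matrix of the linear map `n ↦ n A - q A n`. -/
def intertwiner {n R : Type*} [CommRing R] [Fintype n] [DecidableEq n] (q : R) (A : Matrix n n R) :
    Matrix (n × n) (n × n) R :=
  (1 : Matrix n n R) ⊗ₖ A.transpose - q • (A ⊗ₖ (1 : Matrix n n R))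

variable {n : Type*} [Fintype n] [DecidableEq n]

theorem map_intertwiner {R S : Type*} [CommRing R] [CommRing S] (g : R →+* S) (q : R)
    (A : Matrix n n R) : (intertwiner q A).map g = intertwiner (g q) (A.map g) := by
  ext ⟨i, j⟩ ⟨k, l⟩
  simp [intertwiner, Matrix.kroneckerMap_apply, Matrix.one_apply, apply_ite g]

variable {R : Type*} [CommRing R]

/-- The conjugating matrix `S ⊗ (S⁻¹)ᵀ` is that of the linear map `n ↦ S n S⁻¹`. -/
theorem intertwiner_conj (q : R) {A A' S : Matrix n n R} (hS : IsUnit S) (h : A * S = S * A') :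
    ∃ U : Matrix (n × n) (n × n) R, IsUnit U ∧
      intertwiner q A * U = U * intertwiner q A' := by
  obtain ⟨S, rfl⟩ := hS
  have h1 : S⁻¹.val * A = A' * S⁻¹.val := by
    rw [Units.inv_mul_eq_iff_eq_mul, ← mul_assoc, ← h, mul_assoc, Units.mul_inv, mul_one]
  refine ⟨S.val ⊗ₖ S⁻¹.val.transpose, ?_, ?_⟩
  · refine IsUnit.of_mul_eq_one (S⁻¹.val ⊗ₖ S.val.transpose) ?_
    rw [← Matrix.mul_kronecker_mul, ← Matrix.transpose_mul, Units.mul_inv, Matrix.transpose_one,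
      Matrix.one_kronecker_one]
  · simp only [intertwiner, Matrix.sub_mul, Matrix.mul_sub, Matrix.smul_mul, Matrix.mul_smul,
      ← Matrix.mul_kronecker_mul, one_mul, mul_one, h, ← Matrix.transpose_mul, h1]

theorem rank_eq_of_mul_eq_mul {m : Type*} [Fintype m] [DecidableEq m] {A A' U : Matrix m m R}
    (hU : IsUnit U) (h : A * U = U * A') : A.rank = A'.rank := by
  have hU' := (Matrix.isUnit_iff_isUnit_det _).1 hU
  rw [← Matrix.rank_mul_eq_left_of_isUnit_det U A hU', h,
    Matrix.rank_mul_eq_right_of_isUnit_det U A' hU']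

/-- For diagonal `A` the map is diagonal, with entries `c j - q * c i`. -/
theorem rank_intertwiner {L : Type*} [Field L] (q : L) {A S : Matrix n n L} {c : n → L}
    (hS : IsUnit S) (h : A * S = S * Matrix.diagonal c) :
    (intertwiner q A).rank = Nat.card {x : n × n // c x.2 ≠ q * c x.1} := by
  classical
  obtain ⟨U, hU, hU'⟩ := intertwiner_conj q hS h
  rw [rank_eq_of_mul_eq_mul hU hU']
  have : intertwiner q (Matrix.diagonal c) =
      Matrix.diagonal fun x : n × n => c x.2 - q * c x.1 := by
    ext ⟨i, j⟩ ⟨k, l⟩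
    simp only [intertwiner, Matrix.diagonal_transpose, Matrix.sub_apply, Matrix.smul_apply,
      Matrix.kroneckerMap_apply, Matrix.one_apply, Matrix.diagonal_apply, Prod.mk.injEq, smul_eq_mul]
    split_ifs <;> simp_all
  rw [this, Matrix.rank_diagonal, ← Nat.card_eq_fintype_card]
  exact Nat.card_congr (Equiv.subtypeEquivRight fun x => by rw [sub_ne_zero])

theorem card_eq_add_rank_intertwiner {L : Type*} [Field L] (q : L) {A S : Matrix n n L} {c : n → L}
    (hS : IsUnit S) (h : A * S = S * Matrix.diagonal c) :
    Nat.card {x : n × n // c x.2 = q * c x.1} + (intertwiner q A).rank =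
      Fintype.card n * Fintype.card n := by
  classical
  rw [rank_intertwiner q hS h, Nat.card_eq_fintype_card, Nat.card_eq_fintype_card,
    Fintype.card_subtype_compl, ← Fintype.card_prod]
  exact Nat.add_sub_cancel' (Fintype.card_subtype_le _)

theorem pow_mul_eq_of_mul_eq {q : R} {N A : Matrix n n R} (h : N * A = q • (A * N)) (k : ℕ) :
    N ^ k * A = q ^ k • (A * N ^ k) := by
  induction k with
  | zero => simp
  | succ k ih =>
    rw [pow_succ, mul_assoc, h, Matrix.mul_smul, ← mul_assoc, ih, Matrix.smul_mul, smul_smul,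
      mul_assoc, pow_succ' q]

/-- Over an algebraically closed field, a matrix without multiple eigenvalues is diagonalizable. -/
theorem exists_diagonal {L : Type*} [Field L] [IsAlgClosed L] {A : Matrix n n L}
    (h : A.charpoly.roots.Nodup) :
    ∃ (c : n → L) (S : Matrix n n L), Function.Injective c ∧ IsUnit S ∧
      A * S = S * Matrix.diagonal c := by
  classical
  have hcard : A.charpoly.roots.card = Fintype.card n := by
    rw [← (IsAlgClosed.splits A.charpoly).natDegree_eq_card_roots, Matrix.charpoly_natDegree_eq_dim]
  have hcard' : Fintype.card n = Fintype.card A.charpoly.roots.toFinset := by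
    rw [Fintype.card_coe, Multiset.toFinset_card_of_nodup h, hcard]
  let e := Fintype.equivOfCardEq hcard'
  let c : n → L := fun i => e i
  have hc : Function.Injective c := Subtype.val_injective.comp e.injective
  have hev : ∀ i, ∃ v, Module.End.HasEigenvector (Matrix.toLin' A) (c i) v := fun i => by
    apply Module.End.HasEigenvalue.exists_hasEigenvector
    rw [Module.End.hasEigenvalue_iff_isRoot_charpoly, Matrix.charpoly_toLin']
    exact isRoot_of_mem_roots (Multiset.mem_toFinset.1 (e i).2)
  choose v hv using hev
  refine ⟨c, (Matrix.of v).transpose, hc, ?_, ?_⟩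
  · rw [← Matrix.linearIndependent_cols_iff_isUnit]
    exact Module.End.eigenvectors_linearIndependent' _ c hc v hv
  · ext i j
    rw [Matrix.mul_diagonal]
    have h1 := congrFun (hv j).apply_eq_smul i
    rw [Matrix.toLin'_apply] at h1
    exact h1.trans (mul_comm _ _)

theorem charpoly_eq_prod_of_mul_eq {L : Type*} [Field L] {A S : Matrix n n L} {c : n → L}
    (hS : IsUnit S) (h : A * S = S * Matrix.diagonal c) :
    A.charpoly = ∏ i, (X - C (c i)) := by
  obtain ⟨S, rfl⟩ := hS
  have : A = S.val * Matrix.diagonal c * S⁻¹.val := by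
    rw [← h, mul_assoc, Units.mul_inv, mul_one]
  rw [this, Matrix.coe_units_inv, Matrix.charpoly_units_conj, Matrix.charpoly_diagonal]

omit [DecidableEq n] in
theorem roots_prod_X_sub_C_nodup_iff {L : Type*} [Field L] {c : n → L} :
    (∏ i, (X - C (c i))).roots.Nodup ↔ Function.Injective c := by
  have : (∏ i, (X - C (c i))).roots = Finset.univ.val.map c := by
    rw [← roots_multiset_prod_X_sub_C (Finset.univ.val.map c), Multiset.map_map]
    rfl
  rw [this, Multiset.nodup_map_iff_inj_on Finset.univ.nodup]
  exact ⟨fun h i j hij => h i (Finset.mem_univ _) j (Finset.mem_univ _) hij,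
    fun h i _ j _ hij => h hij⟩

end Intertwiner

/-! ### Solutions of `N A = q A N` and the maximal rank of `N` -/

section Good

variable {L : Type*} [Field L] {n : Type*} [Fintype n] [DecidableEq n] {q : L}
  {N A M S : Matrix n n L} {c : n → L}

theorem mul_sub_eq_zero_of_diagonal (hM : M * Matrix.diagonal c = q • (Matrix.diagonal c * M)) (i j : n) :
    M i j ≠ 0 → c j = q * c i := by
  intro h
  have h1 := congrFun₂ hM i j
  rw [Matrix.mul_diagonal, Matrix.smul_apply, Matrix.diagonal_mul, smul_eq_mul, ← mul_assoc,
    mul_comm (q * c i)] at h1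
  exact mul_left_cancel₀ h h1

/-- In an eigenbasis of `A`, the matrix of `N` is supported at pairs with `c j = q * c i`, and the
number of these pairs is the nullity of the intertwiner. The rank of `N` is at most its number of
nonzero rows; choosing a nonzero entry in each such row injects the rows into the pairs. -/
theorem rank_add_rank_intertwiner_le (hS : IsUnit S) (h : A * S = S * Matrix.diagonal c)
    (hN : N * A = q • (A * N)) : N.rank + (intertwiner q A).rank ≤ Fintype.card n * Fintype.card n := by
  rw [← card_eq_add_rank_intertwiner q hS h]
  gcongr
  obtain ⟨S, rfl⟩ := hS
  set M := S⁻¹.val * N * S.val with hM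
  have hNS : N * S.val = S.val * M := by
    rw [hM, ← mul_assoc, ← mul_assoc, Units.mul_inv, one_mul]
  have hMc : M * Matrix.diagonal c = q • (Matrix.diagonal c * M) := by
    have h2 : S.val * (M * Matrix.diagonal c) = S.val * (q • (Matrix.diagonal c * M)) := by
      rw [← mul_assoc, ← hNS, mul_assoc, ← h, ← mul_assoc, hN, Matrix.smul_mul, Matrix.mul_smul,
        mul_assoc, hNS, ← mul_assoc, h, mul_assoc]
    exact S.isUnit.mul_left_cancel h2
  rw [rank_eq_of_mul_eq_mul S.isUnit hNS]
  refine (rank_le_card_row_ne_zero M).trans ?_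
  choose! f hf using fun i (hi : ∃ j, M i j ≠ 0) => hi
  refine Nat.card_le_card_of_injective (fun i => ⟨(i.1, f i.1), mul_sub_eq_zero_of_diagonal hMc _ _ (hf _ i.2)⟩) ?_
  rintro ⟨i, hi⟩ ⟨j, hj⟩ h
  simp only [Subtype.mk.injEq, Prod.mk.injEq] at h
  exact Subtype.ext h.1

theorem rank_pow_add_rank_intertwiner_le [IsAlgClosed L] (hA : A.charpoly.roots.Nodup)
    (hN : N * A = q • (A * N)) (k : ℕ) :
    (N ^ k).rank + (intertwiner (q ^ k) A).rank ≤ Fintype.card n * Fintype.card n := by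
  obtain ⟨c, S, -, hS, h⟩ := exists_diagonal hA
  exact rank_add_rank_intertwiner_le hS h (pow_mul_eq_of_mul_eq hN k)

/-- If `A` has no multiple eigenvalues and if the rank of `N` is as large as permitted by the
relation `N A = q A N`, then in an eigenbasis of `A`, the matrix of `N` has nonzero entries exactly
at the pairs of eigenvalues which differ by the factor `q`. -/
theorem exists_diagonal_of_le_rank [IsAlgClosed L] (hA : A.charpoly.roots.Nodup)
    (hN : N * A = q • (A * N))
    (hr : Fintype.card n * Fintype.card n ≤ N.rank + (intertwiner q A).rank) :
    ∃ (c : n → L) (S M : Matrix n n L), Function.Injective c ∧ IsUnit S ∧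
      A * S = S * Matrix.diagonal c ∧ N * S = S * M ∧ ∀ i j, M i j ≠ 0 ↔ q * c i = c j := by
  obtain ⟨c, S, hc, hS, h⟩ := exists_diagonal hA
  obtain ⟨S, rfl⟩ := hS
  set M := S⁻¹.val * N * S.val with hM
  have hNS : N * S.val = S.val * M := by
    rw [hM, ← mul_assoc, ← mul_assoc, Units.mul_inv, one_mul]
  have hMc : M * Matrix.diagonal c = q • (Matrix.diagonal c * M) := by
    have h2 : S.val * (M * Matrix.diagonal c) = S.val * (q • (Matrix.diagonal c * M)) := by
      rw [← mul_assoc, ← hNS, mul_assoc, ← h, ← mul_assoc, hN, Matrix.smul_mul, Matrix.mul_smul,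
        mul_assoc, hNS, ← mul_assoc, h, mul_assoc]
    exact S.isUnit.mul_left_cancel h2
  refine ⟨c, S.val, M, hc, S.isUnit, h, hNS, fun i j => ⟨fun hij =>
    (mul_sub_eq_zero_of_diagonal hMc _ _ hij).symm, fun hij => ?_⟩⟩
  rw [← card_eq_add_rank_intertwiner q S.isUnit h, rank_eq_of_mul_eq_mul S.isUnit hNS] at hr
  have hr' := (Nat.le_of_add_le_add_right hr).trans (rank_le_card_row_ne_zero M)
  choose! f hf using fun i (hi : ∃ j, M i j ≠ 0) => hi
  -- The rank hypothesis leaves no room in this injection of nonzero rows into admissible pairs, so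
  -- it is bijective and every admissible pair carries a nonzero entry.
  let F : {i // ∃ j, M i j ≠ 0} → {x : n × n // c x.2 = q * c x.1} :=
    fun i => ⟨(i.1, f i.1), mul_sub_eq_zero_of_diagonal hMc _ _ (hf _ i.2)⟩
  have hF : Function.Injective F := by
    rintro ⟨i, hi⟩ ⟨j, hj⟩ h
    simp only [F, Subtype.mk.injEq, Prod.mk.injEq] at h
    exact Subtype.ext h.1
  have hF' : Function.Bijective F := (Nat.bijective_iff_injective_and_card F).2
    ⟨hF, le_antisymm (Nat.card_le_card_of_injective F hF) hr'⟩
  obtain ⟨⟨i', hi'⟩, h1⟩ := hF'.2 ⟨(i, j), hij.symm⟩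
  simp only [F, Subtype.mk.injEq, Prod.mk.injEq] at h1
  obtain ⟨rfl, rfl⟩ := h1
  exact hf _ hi'

/-- If `N A = q A N` with `A` invertible and `q` not a root of unity, then `N` is nilpotent. -/
theorem isNilpotent_of_mul_eq [IsAlgClosed L] (hq : Function.Injective fun k : ℕ => q ^ k)
    (hA : IsUnit A) (hN : N * A = q • (A * N)) : IsNilpotent N := by
  -- If `v` is an eigenvector for `μ`, then `A v` is one for `q * μ`. A nonzero eigenvalue would
  -- thus produce infinitely many.
  have hroot : ∀ μ : L, N.charpoly.IsRoot μ → N.charpoly.IsRoot (q * μ) := by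
    intro μ hμ
    rw [← Matrix.charpoly_toLin', ← Module.End.hasEigenvalue_iff_isRoot_charpoly] at hμ ⊢
    obtain ⟨v, hv⟩ := hμ.exists_hasEigenvector
    refine Module.End.hasEigenvalue_of_hasEigenvector (x := A.mulVec v) ?_
    rw [Module.End.hasEigenvector_iff, Module.End.mem_eigenspace_iff]
    have hv1 := hv.apply_eq_smul
    rw [Matrix.toLin'_apply] at hv1 ⊢
    refine ⟨?_, fun h => hv.2 (Matrix.mulVec_injective_of_isUnit hA (h.trans (Matrix.mulVec_zero A).symm))⟩
    rw [Matrix.mulVec_mulVec, hN, Matrix.smul_mulVec, ← Matrix.mulVec_mulVec, hv1,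
      Matrix.mulVec_smul, smul_smul]
  have h0 : ∀ μ ∈ N.charpoly.roots, μ = 0 := by
    intro μ hμ
    classical
    by_contra hμ0
    have hne := N.charpoly_monic.ne_zero
    have hpow : ∀ k : ℕ, q ^ k * μ ∈ N.charpoly.roots.toFinset := fun k => by
      rw [Multiset.mem_toFinset, mem_roots hne]
      induction k with
      | zero => simpa using (mem_roots hne).1 hμ
      | succ k ih => rw [pow_succ', mul_assoc]; exact hroot _ ih
    refine not_injective_infinite_finite
      (fun k : ℕ => (⟨q ^ k * μ, hpow k⟩ : N.charpoly.roots.toFinset)) fun a b hab => ?_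
    exact hq (mul_left_injective₀ hμ0 (congrArg Subtype.val hab))
  have hchar : N.charpoly = X ^ N.charpoly.roots.card := by
    conv_lhs => rw [(IsAlgClosed.splits N.charpoly).eq_prod_roots_of_monic N.charpoly_monic,
      Multiset.eq_replicate_card.2 h0]
    simp
  refine ⟨N.charpoly.roots.card, ?_⟩
  have := Matrix.aeval_self_charpoly N
  rwa [hchar, aeval_X_pow] at this

end Good

/-! ### Chains of eigenvalues with ratio `q` -/

section Chains

/-- The relation `q cᵢ = cⱼ` decomposes a finite family of distinct elements into chains. -/
theorem exists_equiv_isLink_of_injective {L X : Type*} [Field L] [Fintype X] {q : L} (hq0 : q ≠ 0)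
    (hq : Function.Injective fun k : ℕ => q ^ k) {c : X → L} (hc : Function.Injective c)
    (hc0 : ∀ x, c x ≠ 0) {d : ℕ} (hd : Fintype.card X = d) :
    ∃ (π : d.Partition) (e : X ≃ Fin d), ∀ x y, q * c x = c y ↔ IsLink π (e x) (e y) := by
  classical
  -- The heads of the chains. Below, `k s` is the length of the chain starting at `s`, finite
  -- because the powers of `q` are distinct.
  let κ := {s : X // ∀ x, q * c x ≠ c s}
  have hinj : ∀ {a : L}, a ≠ 0 → Function.Injective fun k : ℕ => q ^ k * a := fun ha =>
    (mul_left_injective₀ ha).comp hq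
  have hex : ∀ s : κ, ∃ m : ℕ, ∀ x, c x ≠ q ^ m * c s := fun s => by
    by_contra! h
    choose f hf using h
    exact not_injective_infinite_finite f fun a b hab => hinj (hc0 s) (by
      simp only [← hf, hab])
  let k : κ → ℕ := fun s => Nat.find (hex s)
  have hk : ∀ s (m : ℕ), m < k s → ∃ x, c x = q ^ m * c s := fun s m hm => by
    have := Nat.find_min (hex s) hm
    push Not at this
    exact this
  have hk' : ∀ s x, c x ≠ q ^ k s * c s := fun s => Nat.find_spec (hex s)
  have hkpos : ∀ s, 0 < k s := fun s => Nat.pos_of_ne_zero fun h0 => hk' s s (by rw [h0]; simp)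
  -- Cancelling the smaller power of `q` would give a head a predecessor. The bound on `a` is not
  -- strict because the lemma is later applied to the successor of a position, which may run past
  -- the end of its chain.
  have key : ∀ (s t : κ) (a b : ℕ), a ≤ k s → b < k t → q ^ a * c s = q ^ b * c t →
      s = t ∧ a = b := by
    intro s t a b ha hb h
    rcases lt_trichotomy a b with hab | hab | hab
    · obtain ⟨m, rfl⟩ := Nat.exists_eq_add_of_lt hab
      obtain ⟨x, hx⟩ := hk t m (by omega)
      refine absurd ?_ (s.2 x)
      refine mul_left_cancel₀ (pow_ne_zero a hq0) ?_
      rw [h, hx]; ring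
    · subst hab
      exact ⟨Subtype.ext (hc (mul_left_cancel₀ (pow_ne_zero a hq0) h)), rfl⟩
    · obtain ⟨m, rfl⟩ := Nat.exists_eq_add_of_lt hab
      obtain ⟨x, hx⟩ := hk s m (by omega)
      refine absurd ?_ (t.2 x)
      refine mul_left_cancel₀ (pow_ne_zero b hq0) ?_
      rw [← h, hx]; ring
  choose E hE using fun x : Σ s, Fin (k s) => hk x.1 x.2 x.2.2
  have hEbij : Function.Bijective E := by
    constructor
    · rintro ⟨s, a⟩ ⟨t, b⟩ h
      have h1 := hE ⟨s, a⟩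
      rw [h, hE] at h1
      obtain ⟨rfl, h2⟩ := key s t a b a.2.le b.2 h1.symm
      rw [Fin.ext h2]
    · intro x
      -- Division by `q` starting from `c x` leaves the finite family after finitely many steps; the
      -- last element reached is the head of the chain of `x`.
      have hex' : ∃ m : ℕ, ∀ y, c x ≠ q ^ m * c y := by
        by_contra! h
        choose f hf using h
        refine not_injective_infinite_finite f fun a b hab => hinj (hc0 (f a)) ?_
        simp only
        rw [← hf a, hab, ← hf b]
      obtain ⟨m, hm⟩ : ∃ m, Nat.find hex' = m + 1 := Nat.exists_eq_succ_of_ne_zero fun h0 => by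
        have := Nat.find_spec hex' x
        rw [h0] at this
        simp at this
      have hmin : ∀ l ≤ m, ∃ y, c x = q ^ l * c y := fun l hl => by
        have := Nat.find_min hex' (show l < _ by omega)
        push Not at this
        exact this
      obtain ⟨s, hs⟩ := hmin m le_rfl
      have hs' : ∀ y, q * c y ≠ c s := fun y hy => by
        have := Nat.find_spec hex' y
        rw [hm] at this
        refine this ?_
        rw [hs, ← hy]; ring
      have hlt : m < k ⟨s, hs'⟩ := by
        by_contra! hle
        obtain ⟨y, hy⟩ := hmin (m - k ⟨s, hs'⟩) (by omega)
        refine hk' ⟨s, hs'⟩ y ?_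
        refine mul_left_cancel₀ (pow_ne_zero (m - k ⟨s, hs'⟩) hq0) ?_
        rw [← hy, hs, ← mul_assoc, ← pow_add]
        congr 2
        omega
      refine ⟨⟨⟨s, hs'⟩, m, hlt⟩, hc ?_⟩
      rw [hE, hs]
  let F := Equiv.ofBijective E hEbij
  have hsum : ∑ s, k s = d := by
    rw [← hd, ← Fintype.card_congr F, Fintype.card_sigma]
    simp
  obtain ⟨π, e, he⟩ := exists_partition k hkpos hsum
  refine ⟨π, F.symm.trans e, fun x y => ?_⟩
  obtain ⟨x, rfl⟩ := F.surjective x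
  obtain ⟨y, rfl⟩ := F.surjective y
  rw [Equiv.trans_apply, Equiv.trans_apply, F.symm_apply_apply, F.symm_apply_apply, he]
  have hF : ∀ x, c (F x) = q ^ (x.2 : ℕ) * c x.1 := hE
  rw [hF, hF, ← mul_assoc, ← pow_succ']
  constructor
  · intro h
    obtain ⟨h1, h2⟩ := key _ _ _ _ x.2.2 y.2.2 h
    exact ⟨h1, h2.symm⟩
  · rintro ⟨h1, h2⟩
    have h3 : c x.1 = c y.1 := by rw [h1]
    rw [h2, h3]

end Chains

/-! ### Comparison of eigenvalue chains with Jordan blocks -/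

section JordanType

variable {L : Type*} [Field L] {d : ℕ}

/-- A diagonal change of basis normalizes the nonzero superdiagonal entries to one: the scaling
factors are cumulative products of the inverses of these entries, with factor one wherever the entry
vanishes. -/
theorem hasNilpotentJordanType_of_isLink {M : Matrix (Fin d) (Fin d) L} {π : d.Partition}
    (h : ∀ i j, M i j ≠ 0 ↔ IsLink π i j) : HasNilpotentJordanType M π := by
  classical
  let t : ℕ → L := fun m => if hm : m + 1 < d then
    if M ⟨m, by omega⟩ ⟨m + 1, hm⟩ ≠ 0 then (M ⟨m, by omega⟩ ⟨m + 1, hm⟩)⁻¹ else 1 else 1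
  have ht : ∀ m, t m ≠ 0 := fun m => by
    simp only [t]
    split_ifs with h1 h2
    · exact inv_ne_zero h2
    · exact one_ne_zero
    · exact one_ne_zero
  let D : Fin d → L := fun i => ∏ m ∈ Finset.range i, t m
  refine .of_mul_eq (S := Matrix.diagonal D) ?_ ?_
  · rw [Matrix.isUnit_diagonal, Pi.isUnit_iff]
    exact fun i => (Finset.prod_ne_zero_iff.2 fun m _ => ht m).isUnit
  · ext i j
    rw [Matrix.mul_diagonal, Matrix.diagonal_mul, nilpotentJordan, Matrix.of_apply]
    split_ifs with hij
    · have h1 := (h i j).2 hij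
      obtain ⟨i, hi⟩ := i
      obtain ⟨j, hj⟩ := j
      obtain rfl : j = i + 1 := hij.1
      have h2 : t i = (M ⟨i, hi⟩ ⟨i + 1, hj⟩)⁻¹ := by simp only [t, dif_pos hj, if_pos h1]
      simp only [D, Finset.prod_range_succ, h2]
      field_simp
    · rw [mul_zero, not_ne_iff.1 ((h i j).not.2 hij), zero_mul]

theorem hasNilpotentJordanType_of_equiv
    {M : Matrix (Fin d) (Fin d) L} {π : d.Partition} (e : Fin d ≃ Fin d)
    (h : ∀ i j, M i j ≠ 0 ↔ IsLink π (e i) (e j)) : HasNilpotentJordanType M π := by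
  have h1 : HasNilpotentJordanType (M.submatrix e.symm e.symm) π :=
    hasNilpotentJordanType_of_isLink fun i j => by simp [h]
  refine h1.conj (S := (1 : Matrix (Fin d) (Fin d) L).submatrix id e.symm) ?_ ?_
  · refine IsUnit.of_mul_eq_one ((1 : Matrix (Fin d) (Fin d) L).submatrix e.symm id) ?_
    rw [Matrix.submatrix_mul_equiv, one_mul, Matrix.submatrix_id_id]
  · rw [Matrix.submatrix_mul_equiv, one_mul]
    conv_lhs => rw [← Matrix.submatrix_id_id M]
    exact (Matrix.submatrix_mul_equiv M 1 id (Equiv.refl _) e.symm).trans (by rw [mul_one])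

/-- Under the maximality assumption on the rank of `N`, the chains of eigenvalues of `A` and the
Jordan type of `N` are described by the same partition. -/
theorem exists_partition_forall_iff [IsAlgClosed L] {q : ℕ} (hq0 : (q : L) ≠ 0)
    (hq : Function.Injective fun k : ℕ => (q : L) ^ k)
    {A N : Matrix (Fin d) (Fin d) L} (hA : IsUnit A) (hA' : A.charpoly.roots.Nodup)
    (hN : N * A = (q : L) • (A * N)) (hr : d * d ≤ N.rank + (intertwiner (q : L) A).rank) :
    ∃ π : d.Partition, ∀ μ, (HasEigenvalueChains q A μ ↔ μ = π) ∧
      (HasNilpotentJordanType N μ ↔ μ = π) := by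
  obtain ⟨c, S, M, hc, hS, hAS, hNS, hM⟩ := exists_diagonal_of_le_rank hA' hN (by simpa using hr)
  have hc0 : ∀ i, c i ≠ 0 := by
    have h1 := hA.mul hS
    rw [hAS] at h1
    have h2 : IsUnit (Matrix.diagonal c) := by
      rw [Matrix.isUnit_iff_isUnit_det] at h1 ⊢
      rw [Matrix.det_mul] at h1
      exact isUnit_of_mul_isUnit_right h1
    rw [Matrix.isUnit_diagonal, Pi.isUnit_iff] at h2
    exact fun i => (h2 i).ne_zero
  have hchar := charpoly_eq_prod_of_mul_eq hS hAS
  obtain ⟨π, e, he⟩ := exists_equiv_isLink_of_injective hq0 hq hc hc0 (Fintype.card_fin d)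
  have hJ : ∀ {μ : d.Partition} (f : Fin d ≃ Fin d)
      (_ : ∀ i j, (q : L) * c i = c j ↔ IsLink μ (f i) (f j)), HasNilpotentJordanType N μ :=
    fun f hf => (hasNilpotentJordanType_of_equiv f
      (fun i j => (hM i j).trans (hf i j))).conj hS hNS
  refine ⟨π, fun μ => ⟨⟨?_, ?_⟩, fun h => h.eq (hJ e he), fun h => h ▸ hJ e he⟩⟩
  · rintro ⟨c', hc', hlink⟩
    -- Any admissible ordering `c'` is a permutation of `c`. It therefore exhibits the Jordan type
    -- `μ` of the same `N`, and uniqueness of the Jordan type gives `μ = π`.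
    have hc'inj : Function.Injective c' := by
      rwa [← roots_prod_X_sub_C_nodup_iff, ← hc']
    have hex : ∀ i, ∃ j, c j = c' i := fun i => by
      have h1 : A.charpoly.eval (c' i) = 0 := by
        rw [hc', eval_prod]
        exact Finset.prod_eq_zero (Finset.mem_univ i) (by simp)
      rw [hchar, eval_prod, Finset.prod_eq_zero_iff] at h1
      obtain ⟨j, -, hj⟩ := h1
      rw [eval_sub, eval_X, eval_C, sub_eq_zero] at hj
      exact ⟨j, hj.symm⟩
    choose f hf using hex
    have hfinj : Function.Injective f := fun i j hij => hc'inj (by rw [← hf, ← hf, hij])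
    let F := Equiv.ofBijective f (Finite.injective_iff_bijective.1 hfinj)
    refine (hJ F.symm fun i j => ?_).eq (hJ e he)
    obtain ⟨i, rfl⟩ := F.surjective i
    obtain ⟨j, rfl⟩ := F.surjective j
    rw [F.symm_apply_apply, F.symm_apply_apply, ← hlink, ← hf, ← hf]
    rfl
  · rintro rfl
    refine ⟨c ∘ e.symm, ?_, fun i j => ?_⟩
    · rw [hchar, ← e.symm.prod_comp]
      rfl
    · rw [Function.comp_apply, Function.comp_apply, he, e.apply_symm_apply, e.apply_symm_apply]

end JordanType

end PhiNModule

namespace PhiNModule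

/-! ### The order of Frobenius -/

section Frobenius

variable {p : ℕ} [Fact p.Prime] {K₀ : Type*} [Field K₀] [Algebra ℚ_[p] K₀]
    [FiniteDimensional ℚ_[p] K₀] [Algebra ℤ_[p] K₀] [IsScalarTower ℤ_[p] ℚ_[p] K₀]

omit [FiniteDimensional ℚ_[p] K₀] [IsScalarTower ℤ_[p] ℚ_[p] K₀] in
theorem IsFrobenius.exists_pow_apply {φ : K₀ ≃ₐ[ℚ_[p]] K₀} (hφ : IsFrobenius p K₀ φ) (i : ℕ)
    (x : integralClosure ℤ_[p] K₀) : ∃ y : integralClosure ℤ_[p] K₀,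
      (φ ^ i) (x : K₀) = (x : K₀) ^ p ^ i + (p : K₀) * (y : K₀) := by
  induction i with
  | zero => exact ⟨0, by simp⟩
  | succ i ih =>
    obtain ⟨y, hy⟩ := ih
    obtain ⟨y₁, hy₁⟩ := hφ (x ^ p ^ i)
    obtain ⟨y₂, hy₂⟩ := hφ y
    refine ⟨y₁ + (y ^ p + p * y₂), ?_⟩
    rw [pow_succ', AlgEquiv.mul_apply, hy, map_add, map_mul, map_natCast, hy₂]
    push_cast at hy₁ ⊢
    rw [hy₁]
    ring

omit [FiniteDimensional ℚ_[p] K₀] in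
theorem isTorsionFree_padicInt : Module.IsTorsionFree ℤ_[p] K₀ := by
  have hinj : Function.Injective (algebraMap ℤ_[p] K₀) := by
    rw [IsScalarTower.algebraMap_eq ℤ_[p] ℚ_[p] K₀]
    exact (algebraMap ℚ_[p] K₀).injective.comp (IsFractionRing.injective ℤ_[p] ℚ_[p])
  have : FaithfulSMul ℤ_[p] K₀ := (faithfulSMul_iff_algebraMap_injective _ _).2 hinj
  infer_instance

/-- The ring of integers is free over `ℤ_[p]` of rank `f`; reduce the coordinates in a basis modulo
`p`. -/
theorem exists_surjective_integralClosure :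
    ∃ F : integralClosure ℤ_[p] K₀ →+ (Fin (Module.finrank ℚ_[p] K₀) → ZMod p),
      Function.Surjective F ∧ ∀ x, F (x * (p : integralClosure ℤ_[p] K₀)) = 0 := by
  have : Module.IsTorsionFree ℤ_[p] K₀ := isTorsionFree_padicInt
  have : Module.Free ℤ_[p] (integralClosure ℤ_[p] K₀) :=
    IsIntegralClosure.module_free ℤ_[p] ℚ_[p] K₀ _
  have : Module.Finite ℤ_[p] (integralClosure ℤ_[p] K₀) :=
    IsIntegralClosure.finite ℤ_[p] ℚ_[p] K₀ _
  have hrank : Module.finrank ℤ_[p] (integralClosure ℤ_[p] K₀) = Module.finrank ℚ_[p] K₀ :=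
    IsIntegralClosure.rank ℤ_[p] ℚ_[p] K₀ _
  let b := (Module.finBasis ℤ_[p] (integralClosure ℤ_[p] K₀)).reindex (finCongr hrank)
  refine ⟨{ toFun := fun x i => PadicInt.toZMod (b.equivFun x i)
            map_zero' := by ext; simp
            map_add' := fun x y => by ext; simp }, fun v => ?_, fun x => ?_⟩
  · choose w hw using fun i => ZMod.ringHom_surjective (PadicInt.toZMod (p := p)) (v i)
    refine ⟨b.equivFun.symm w, ?_⟩
    ext i
    change PadicInt.toZMod (b.equivFun (b.equivFun.symm w) i) = _
    rw [LinearEquiv.apply_symm_apply, hw]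
  · have h : x * (p : integralClosure ℤ_[p] K₀) = (p : ℤ_[p]) • x := by
      rw [Algebra.smul_def, mul_comm, map_natCast]
    ext i
    change PadicInt.toZMod (b.equivFun (x * (p : integralClosure ℤ_[p] K₀)) i) = 0
    rw [h, map_smul, Pi.smul_apply, smul_eq_mul, map_mul, map_natCast, ZMod.natCast_self, zero_mul]

/-- The residue ring `W / pW` has at least `p ^ f` elements. -/
theorem pow_finrank_le_natCard_quotient {k : Type*} [CommRing k] [Finite k]
    (π : integralClosure ℤ_[p] K₀ →+* k)
    (hπ : ∀ x, π x = 0 → ∃ y, x = y * (p : integralClosure ℤ_[p] K₀)) :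
    p ^ Module.finrank ℚ_[p] K₀ ≤ Nat.card k := by
  obtain ⟨F, hF, hker⟩ := exists_surjective_integralClosure (p := p) (K₀ := K₀)
  choose x hx using hF
  have hinj : Function.Injective fun v => π (x v) := fun v w h => by
    obtain ⟨y, hy⟩ := hπ (x v - x w) (by rw [map_sub, sub_eq_zero]; exact h)
    rw [← hx v, ← hx w, ← sub_eq_zero, ← map_sub, hy, hker]
  have h1 := Nat.card_le_card_of_injective _ hinj
  rwa [Nat.card_fun, Nat.card_zmod, Nat.card_eq_fintype_card, Fintype.card_fin] at h1

theorem natCard_le_of_forall_pow_eq {k : Type*} [CommRing k] [IsDomain k] {n : ℕ} (hn : 1 < n)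
    (h : ∀ x : k, x ^ n = x) : Finite k ∧ Nat.card k ≤ n := by
  classical
  let Q : Polynomial k := Polynomial.X ^ n - Polynomial.X
  have hdeg : Q.natDegree = n := by
    rw [Polynomial.natDegree_sub_eq_left_of_natDegree_lt (by simpa using hn),
      Polynomial.natDegree_X_pow]
  have hQ : Q ≠ 0 := fun h0 => by simp [h0] at hdeg; omega
  have hmem : ∀ x : k, x ∈ Q.roots.toFinset := fun x => by
    rw [Multiset.mem_toFinset, Polynomial.mem_roots hQ]
    simp [Q, h x]
  have : Fintype k := ⟨Q.roots.toFinset, hmem⟩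
  refine ⟨inferInstance, ?_⟩
  rw [Nat.card_eq_fintype_card]
  calc Fintype.card k ≤ Q.roots.toFinset.card := by
        rw [← Finset.card_univ]; exact Finset.card_le_card fun x _ => hmem x
    _ ≤ Q.roots.card := Multiset.toFinset_card_le _
    _ ≤ Q.natDegree := Polynomial.card_roots' _
    _ = n := hdeg

/-- If `φ ^ i = 1`, every element of the residue field is a root of `X ^ (p ^ i) - X`, so the
residue field has at most `p ^ i` elements. It has at least `p ^ f`. -/
theorem finrank_le_of_frobenius_pow_eq_one (hK₀ : IsUnramified p K₀) {φ : K₀ ≃ₐ[ℚ_[p]] K₀}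
    (hφ : IsFrobenius p K₀ φ) {i : ℕ} (hi : 0 < i) (h : φ ^ i = 1) :
    Module.finrank ℚ_[p] K₀ ≤ i := by
  have hp := (Fact.out : p.Prime)
  have hmax : (Ideal.span {(p : integralClosure ℤ_[p] K₀)}).IsMaximal := hK₀
  set k := integralClosure ℤ_[p] K₀ ⧸ Ideal.span {(p : integralClosure ℤ_[p] K₀)}
  have hdom : IsDomain k := Ideal.Quotient.isDomain _
  have h1 : ∀ x : k, x ^ p ^ i = x := by
    intro x
    obtain ⟨x, rfl⟩ := Ideal.Quotient.mk_surjective x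
    obtain ⟨y, hy⟩ := hφ.exists_pow_apply i x
    rw [h, AlgEquiv.one_apply] at hy
    have h2 : x = x ^ p ^ i + p * y := Subtype.ext (by push_cast; exact hy)
    conv_rhs => rw [h2]
    rw [map_add, map_mul, map_pow]
    have : Ideal.Quotient.mk (Ideal.span {(p : integralClosure ℤ_[p] K₀)}) p = 0 :=
      Ideal.Quotient.eq_zero_iff_mem.2 (Ideal.mem_span_singleton_self _)
    rw [this, zero_mul, add_zero]
  obtain ⟨hfin, hcard⟩ := natCard_le_of_forall_pow_eq (Nat.one_lt_pow hi.ne' hp.one_lt) h1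
  refine (Nat.pow_le_pow_iff_right hp.one_lt).1 ((pow_finrank_le_natCard_quotient (Ideal.Quotient.mk _) fun x hx => ?_).trans hcard)
  obtain ⟨y, hy⟩ := Ideal.mem_span_singleton'.1 (Ideal.Quotient.eq_zero_iff_mem.1 hx)
  exact ⟨y, hy.symm⟩

theorem orderOf_frobenius (hK₀ : IsUnramified p K₀) {φ : K₀ ≃ₐ[ℚ_[p]] K₀}
    (hφ : IsFrobenius p K₀ φ) : orderOf φ = Module.finrank ℚ_[p] K₀ := by
  refine le_antisymm ((orderOf_le_card_univ).trans AlgEquiv.card_le) ?_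
  exact finrank_le_of_frobenius_pow_eq_one hK₀ hφ (orderOf_pos φ) (pow_orderOf_eq_one φ)

end Frobenius

/-! ### Linear independence of the powers of Frobenius -/

section Embeddings

variable {p : ℕ} [Fact p.Prime] {K₀ : Type*} [Field K₀] [Algebra ℚ_[p] K₀]
    [FiniteDimensional ℚ_[p] K₀] {φ : K₀ ≃ₐ[ℚ_[p]] K₀}
    (hφ : orderOf φ = Module.finrank ℚ_[p] K₀)

include hφ

/-- A vanishing combination of rows is a linear relation between the homomorphisms `φ ^ i`, `i < f`.
These are distinct because `φ` has order `f`, hence independent by Dedekind. -/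
theorem isUnit_det_pow_finBasis :
    IsUnit (Matrix.of fun i j : Fin (Module.finrank ℚ_[p] K₀) =>
      (φ ^ (i : ℕ)) (Module.finBasis ℚ_[p] K₀ j)).det := by
  rw [← Matrix.isUnit_iff_isUnit_det, ← Matrix.linearIndependent_rows_iff_isUnit,
    Fintype.linearIndependent_iff]
  intro g hg
  have h1 := linearIndependent_toLinearMap ℚ_[p] K₀ K₀
  let F : Fin (Module.finrank ℚ_[p] K₀) → (K₀ →ₐ[ℚ_[p]] K₀) := fun i =>
    ((φ ^ (i : ℕ) : K₀ ≃ₐ[ℚ_[p]] K₀) : K₀ →ₐ[ℚ_[p]] K₀)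
  have hF : Function.Injective F := fun i j hij => by
    have h1 : φ ^ (i : ℕ) = φ ^ (j : ℕ) := by
      ext x
      exact DFunLike.congr_fun hij x
    exact Fin.ext (pow_injOn_Iio_orderOf (by simp [hφ]) (by simp [hφ]) h1)
  have h2 := h1.comp F hF
  rw [Fintype.linearIndependent_iff] at h2
  refine h2 g ?_
  refine (Module.finBasis ℚ_[p] K₀).ext fun j => ?_
  have := congrFun hg j
  simpa [F] using this

end Embeddings

end PhiNModule

namespace PhiNModule

/-! ### Decomposition of `D ⊗ K₀` into components -/

section Components

variable {p : ℕ} [Fact p.Prime] {K₀ : Type*} [Field K₀] [Algebra ℚ_[p] K₀]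
  (φ : K₀ ≃ₐ[ℚ_[p]] K₀) {R D D' : Type*} [CommRing R] [Algebra ℚ_[p] R] [CommRing D]
  [Algebra ℚ_[p] D] [CommRing D'] [Algebra ℚ_[p] D']

/-- The embedding `σ ∘ φ^i`. -/
def embPow (σ : K₀ →ₐ[ℚ_[p]] D) (i : ℕ) : K₀ →ₐ[ℚ_[p]] D :=
  σ.comp ((φ ^ i : K₀ ≃ₐ[ℚ_[p]] K₀) : K₀ →ₐ[ℚ_[p]] K₀)

theorem embPow_apply (σ : K₀ →ₐ[ℚ_[p]] D) (i : ℕ) (x : K₀) :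
    embPow φ σ i x = σ ((φ ^ i) x) := rfl

/-- The `i`-th component `a ⊗ b ↦ g a * σ (φ^i b)` of the evaluation at `g`. -/
def evalAt (g : R →ₐ[ℚ_[p]] D) (σ : K₀ →ₐ[ℚ_[p]] D) (i : ℕ) : (R ⊗[ℚ_[p]] K₀) →ₐ[ℚ_[p]] D :=
  Algebra.TensorProduct.productMap g (embPow φ σ i)

variable (g : R →ₐ[ℚ_[p]] D) (σ : K₀ →ₐ[ℚ_[p]] D)

@[simp]
theorem evalAt_tmul (i : ℕ) (a : R) (b : K₀) :
    evalAt φ g σ i (a ⊗ₜ b) = g a * σ ((φ ^ i) b) := by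
  simp [evalAt, embPow_apply]

theorem evalAt_frob (i : ℕ) (z : R ⊗[ℚ_[p]] K₀) :
    evalAt φ g σ i (frob p φ R z) = evalAt φ g σ (i + 1) z := by
  induction z using TensorProduct.induction_on with
  | zero => simp
  | tmul a b => simp [frob, pow_succ]
  | add x y hx hy => simp only [map_add, hx, hy]

theorem evalAt_frob_iterate (i m : ℕ) (z : R ⊗[ℚ_[p]] K₀) :
    evalAt φ g σ i ((frob p φ R)^[m] z) = evalAt φ g σ (i + m) z := by
  induction m generalizing i with
  | zero => rfl
  | succ m ih => rw [Function.iterate_succ_apply', evalAt_frob, ih, add_right_comm, add_assoc]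

theorem evalAt_embPow (m i : ℕ) (z : R ⊗[ℚ_[p]] K₀) :
    evalAt φ g (embPow φ σ m) i z = evalAt φ g σ (m + i) z := by
  induction z using TensorProduct.induction_on with
  | zero => simp
  | tmul a b => simp [embPow_apply, pow_add]
  | add x y hx hy => simp only [map_add, hx, hy]

theorem evalAt_comp (h : D →ₐ[ℚ_[p]] D') (i : ℕ) (z : R ⊗[ℚ_[p]] K₀) :
    evalAt φ (h.comp g) (h.comp σ) i z = h (evalAt φ g σ i z) := by
  induction z using TensorProduct.induction_on with
  | zero => simp
  | tmul a b => simp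
  | add x y hx hy => simp only [map_add, hx, hy]

theorem evalAt_id_map (i : ℕ) (z : R ⊗[ℚ_[p]] K₀) :
    evalAt φ (AlgHom.id ℚ_[p] D) σ i
      (Algebra.TensorProduct.map g (AlgHom.id ℚ_[p] K₀) z) = evalAt φ g σ i z := by
  induction z using TensorProduct.induction_on with
  | zero => simp
  | tmul a b => simp
  | add x y hx hy => simp only [map_add, hx, hy]

variable [FiniteDimensional ℚ_[p] K₀] (hφ : orderOf φ = Module.finrank ℚ_[p] K₀)

include hφ in
omit [FiniteDimensional ℚ_[p] K₀] in
theorem evalAt_add_finrank (i : ℕ) :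
    evalAt φ g σ (i + Module.finrank ℚ_[p] K₀) = evalAt φ g σ i := by
  rw [evalAt, evalAt, embPow, embPow, pow_add, ← hφ, pow_orderOf_eq_one, mul_one]

include hφ in
/-- For an algebra `D` over `K₀`, the ring `D ⊗ K₀` is a product of copies of `D`. -/
theorem evalAt_id_bijective : Function.Bijective fun (z : D ⊗[ℚ_[p]] K₀)
    (i : Fin (Module.finrank ℚ_[p] K₀)) => evalAt φ (AlgHom.id ℚ_[p] D) σ i z := by
  -- In coordinates, the family of evaluations is multiplication by the image of this invertible
  -- matrix of conjugates of a basis.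
  let V : Matrix (Fin (Module.finrank ℚ_[p] K₀)) (Fin (Module.finrank ℚ_[p] K₀)) K₀ :=
    Matrix.of fun i j => (φ ^ (i : ℕ)) (Module.finBasis ℚ_[p] K₀ j)
  have hV : IsUnit (V.map σ) :=
    ((Matrix.isUnit_iff_isUnit_det _).2 (isUnit_det_pow_finBasis hφ)).map σ.mapMatrix
  have h : ∀ z : D ⊗[ℚ_[p]] K₀, (fun i : Fin (Module.finrank ℚ_[p] K₀) =>
      evalAt φ (AlgHom.id ℚ_[p] D) σ i z) = (V.map σ).mulVec ((coords p K₀ D).equivFun z) := by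
    intro z
    ext i
    conv_lhs => rw [← (coords p K₀ D).sum_equivFun z]
    rw [map_sum, Matrix.mulVec, dotProduct]
    refine Finset.sum_congr rfl fun k _ => ?_
    have : ((coords p K₀ D).equivFun z k) • coords p K₀ D k =
        ((coords p K₀ D).equivFun z k) ⊗ₜ Module.finBasis ℚ_[p] K₀ k := by
      simp [coords, TensorProduct.smul_tmul']
    rw [this, evalAt_tmul, mul_comm]
    rfl
  rw [funext h]
  refine Function.Bijective.comp ⟨Matrix.mulVec_injective_of_isUnit hV, ?_⟩ (coords p K₀ D).equivFun.bijective
  exact Matrix.mulVec_surjective_iff_isUnit.2 hV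

include hφ in
theorem ext_evalAt_id {z w : D ⊗[ℚ_[p]] K₀} (h : ∀ i < Module.finrank ℚ_[p] K₀,
    evalAt φ (AlgHom.id ℚ_[p] D) σ i z = evalAt φ (AlgHom.id ℚ_[p] D) σ i w) : z = w :=
  (evalAt_id_bijective φ σ hφ).1 (funext fun i => h i i.2)

end Components

/-! ### The universal pair as a cyclic family of matrices -/

section Universal

variable {p : ℕ} [Fact p.Prime] {K₀ : Type*} [Field K₀] [Algebra ℚ_[p] K₀]
  [FiniteDimensional ℚ_[p] K₀] (φ : K₀ ≃ₐ[ℚ_[p]] K₀) {d : ℕ} {D : Type*} [CommRing D]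
  [Algebra ℚ_[p] D] (g : PRing p φ d →ₐ[ℚ_[p]] D) (σ : K₀ →ₐ[ℚ_[p]] D)

/-- The `i`-th component of the universal matrix `Φ` at `g`. -/
def compΦ (i : ℕ) : Matrix (Fin d) (Fin d) D := (univΦ p φ d).map (evalAt φ g σ i)

/-- The `i`-th component of the universal matrix `N` at `g`. -/
def compN (i : ℕ) : Matrix (Fin d) (Fin d) D := (univN p φ d).map (evalAt φ g σ i)

/-- The product `Φ_a Φ_{a+1} ⋯ Φ_{a+m-1}` of components. -/
def prodΦ {D : Type*} [CommRing D] (Φ : ℕ → Matrix (Fin d) (Fin d) D) (a m : ℕ) : Matrix (Fin d) (Fin d) D :=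
  ((List.range m).map fun i => Φ (a + i)).prod

/-- The zeroth component of `Φ^f` at `g`. -/
def compA : Matrix (Fin d) (Fin d) D := (phiPow p φ (univΦ p φ d)).map (evalAt φ g σ 0)

theorem compA_eq : compA φ g σ = prodΦ (compΦ φ g σ) 0 (Module.finrank ℚ_[p] K₀) := by
  rw [compA, phiPow, prodΦ]
  change (evalAt φ g σ 0).mapMatrix _ = _
  rw [map_list_prod, List.map_map]
  congr 2
  ext i a b
  simp [compΦ, evalAt_frob_iterate]

theorem isUnit_compΦ (i : ℕ) : IsUnit (compΦ φ g σ i) :=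
  (univ_rel p φ d).1.map (evalAt φ g σ i).mapMatrix

/-- The map `frob` shifts components by one, so the semilinear relation becomes linear relations
between consecutive components. The index runs over `ℕ`, with period `f`. -/
theorem compN_mul_compΦ (i : ℕ) :
    compN φ g σ i * compΦ φ g σ i = (p : D) • (compΦ φ g σ i * compN φ g σ (i + 1)) := by
  have h := congrArg (evalAt φ g σ i).mapMatrix (univ_rel p φ d).2
  rw [map_mul] at h
  refine h.trans ?_
  ext a b
  simp only [AlgHom.mapMatrix_apply, Matrix.map_apply, Matrix.smul_apply, smul_eq_mul, map_mul, map_natCast]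
  congr 1
  rw [Matrix.mul_apply, map_sum, Matrix.mul_apply]
  refine Finset.sum_congr rfl fun c _ => ?_
  rw [map_mul, Matrix.map_apply, evalAt_frob]
  rfl

theorem prodΦ_succ {D : Type*} [CommRing D] (Φ : ℕ → Matrix (Fin d) (Fin d) D) (a m : ℕ) :
    prodΦ Φ a (m + 1) = prodΦ Φ a m * Φ (a + m) := by
  simp [prodΦ, List.range_succ]

theorem prodΦ_succ' {D : Type*} [CommRing D] (Φ : ℕ → Matrix (Fin d) (Fin d) D) (a m : ℕ) :
    prodΦ Φ a (m + 1) = Φ a * prodΦ Φ (a + 1) m := by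
  simp only [prodΦ, List.range_succ_eq_map, List.map_cons, List.prod_cons, List.map_map]
  congr 3
  ext i : 1
  rw [Function.comp_apply, Nat.succ_eq_add_one, add_right_comm, add_assoc]

theorem isUnit_prodΦ {D : Type*} [CommRing D] {Φ : ℕ → Matrix (Fin d) (Fin d) D} (h : ∀ i, IsUnit (Φ i)) (a m : ℕ) :
    IsUnit (prodΦ Φ a m) := by
  induction m with
  | zero => simp [prodΦ]
  | succ m ih => rw [prodΦ_succ]; exact ih.mul (h _)

theorem isUnit_compA : IsUnit (compA φ g σ) := by
  rw [compA_eq]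
  exact isUnit_prodΦ (isUnit_compΦ φ g σ) _ _

theorem mul_prodΦ {D : Type*} [CommRing D] {Φ N : ℕ → Matrix (Fin d) (Fin d) D} {q : D}
    (h : ∀ i, N i * Φ i = q • (Φ i * N (i + 1))) (a m : ℕ) :
    N a * prodΦ Φ a m = q ^ m • (prodΦ Φ a m * N (a + m)) := by
  induction m with
  | zero => simp [prodΦ]
  | succ m ih =>
    rw [prodΦ_succ, ← mul_assoc, ih, Matrix.smul_mul, mul_assoc, h, Matrix.mul_smul, smul_smul,
      pow_succ, mul_assoc (prodΦ Φ a m), ← add_assoc]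

theorem compN_comp {D' : Type*} [CommRing D'] [Algebra ℚ_[p] D'] (h : D →ₐ[ℚ_[p]] D') (m : ℕ) :
    compN φ (h.comp g) (h.comp σ) m = (compN φ g σ m).map h := by
  ext i j
  simp [compN, evalAt_comp]

theorem compΦ_comp {D' : Type*} [CommRing D'] [Algebra ℚ_[p] D'] (h : D →ₐ[ℚ_[p]] D') (m : ℕ) :
    compΦ φ (h.comp g) (h.comp σ) m = (compΦ φ g σ m).map h := by
  ext i j
  simp [compΦ, evalAt_comp]

variable {φ} (hφ : orderOf φ = Module.finrank ℚ_[p] K₀)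
include hφ

theorem compΦ_add_finrank (i : ℕ) : compΦ φ g σ (i + Module.finrank ℚ_[p] K₀) = compΦ φ g σ i := by
  rw [compΦ, compΦ, evalAt_add_finrank φ g σ hφ]

theorem compN_add_finrank (i : ℕ) : compN φ g σ (i + Module.finrank ℚ_[p] K₀) = compN φ g σ i := by
  rw [compN, compN, evalAt_add_finrank φ g σ hφ]

/-- Moving `N` past all `f` factors produces `p ^ f` and returns to the component of index zero. -/
theorem compN_mul_compA : compN φ g σ 0 * compA φ g σ =
    ((p ^ Module.finrank ℚ_[p] K₀ : ℕ) : D) • (compA φ g σ * compN φ g σ 0) := by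
  have h := mul_prodΦ (compN_mul_compΦ φ g σ) 0 (Module.finrank ℚ_[p] K₀)
  rw [← compA_eq, compN_add_finrank g σ hφ] at h
  rw [h]
  push_cast
  rfl

/-- Changing the embedding changes the matrices `(Φ^f)₀` by conjugation. -/
theorem exists_isUnit_compA_embPow (m : ℕ) : ∃ P : Matrix (Fin d) (Fin d) D, IsUnit P ∧
    compA φ g σ * P = P * compA φ g (embPow φ σ m) ∧
    compN φ g σ 0 * P = (p : D) ^ m • (P * compN φ g (embPow φ σ m) 0) := by
  have hΦ : ∀ i, compΦ φ g (embPow φ σ m) i = compΦ φ g σ (m + i) := fun i => by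
    ext a b; simp [compΦ, evalAt_embPow]
  have hN : ∀ i, compN φ g (embPow φ σ m) i = compN φ g σ (m + i) := fun i => by
    ext a b; simp [compN, evalAt_embPow]
  refine ⟨prodΦ (compΦ φ g σ) 0 m, isUnit_prodΦ (isUnit_compΦ φ g σ) _ _, ?_, ?_⟩
  · have h2 : compA φ g (embPow φ σ m) = prodΦ (compΦ φ g σ) m (Module.finrank ℚ_[p] K₀) := by
      rw [compA_eq]
      simp only [prodΦ, hΦ, zero_add]
    rw [h2, compA_eq]
    clear h2 hΦ hN
    induction m with
    | zero => simp [prodΦ]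
    | succ m ih =>
      rw [prodΦ_succ, ← mul_assoc, ih, mul_assoc, mul_assoc]
      congr 1
      rw [zero_add, ← prodΦ_succ', prodΦ_succ, compΦ_add_finrank g σ hφ]
  · have := mul_prodΦ (compN_mul_compΦ φ g σ) 0 m
    rw [this, hN, add_zero, zero_add]

/-- Over an algebra `D` with an embedding `σ : K₀ → D`, the homomorphisms from the coordinate ring
of `P_{K₀,d}` to `D` are given by their components. -/
theorem exists_compΦ_compN_eq (Φ N : ℕ → Matrix (Fin d) (Fin d) D) (hΦ : ∀ i, IsUnit (Φ i))
    (hN : ∀ i < Module.finrank ℚ_[p] K₀, N i * Φ i = (p : D) • (Φ i * N (i + 1)))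
    (hN0 : N (Module.finrank ℚ_[p] K₀) = N 0) :
    ∃ g : PRing p φ d →ₐ[ℚ_[p]] D, ∀ i < Module.finrank ℚ_[p] K₀,
      compΦ φ g σ i = Φ i ∧ compN φ g σ i = N i := by
  have hex : ∀ F : ℕ → Matrix (Fin d) (Fin d) D, ∃ X : Matrix (Fin d) (Fin d) (D ⊗[ℚ_[p]] K₀),
      ∀ i < Module.finrank ℚ_[p] K₀, X.map (evalAt φ (AlgHom.id ℚ_[p] D) σ i) = F i := by
    intro F
    choose X hX using fun a b => (evalAt_id_bijective φ σ hφ).2 fun i => F i a b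
    refine ⟨Matrix.of X, fun i hi => ?_⟩
    ext a b
    exact congrFun (hX a b) ⟨i, hi⟩
  have hext : ∀ X Y : Matrix (Fin d) (Fin d) (D ⊗[ℚ_[p]] K₀), (∀ i < Module.finrank ℚ_[p] K₀,
      X.map (evalAt φ (AlgHom.id ℚ_[p] D) σ i) = Y.map (evalAt φ (AlgHom.id ℚ_[p] D) σ i)) → X = Y :=
    fun X Y h => by
      ext a b
      exact ext_evalAt_id φ σ hφ fun i hi => congrFun₂ (h i hi) a b
  choose Ψ hΨ using fun i => isUnit_iff_exists.1 (hΦ i)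
  obtain ⟨X, hX⟩ := hex Φ
  obtain ⟨X', hX'⟩ := hex Ψ
  obtain ⟨Y, hY⟩ := hex N
  have hpos : 0 < Module.finrank ℚ_[p] K₀ := Module.finrank_pos
  -- For the last index the shift wraps around to component zero, where the closing condition `hN0`
  -- is needed.
  have hY' : ∀ i < Module.finrank ℚ_[p] K₀,
      Y.map (evalAt φ (AlgHom.id ℚ_[p] D) σ (i + 1)) = N (i + 1) := by
    intro i hi
    rcases Nat.lt_or_ge (i + 1) (Module.finrank ℚ_[p] K₀) with h | h
    · exact hY _ h
    · have : i + 1 = 0 + Module.finrank ℚ_[p] K₀ := by omega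
      rw [this, evalAt_add_finrank φ _ _ hφ, hY 0 hpos, zero_add, hN0]
  have hXu : IsUnit X := by
    have h1 : X * X' = 1 := hext _ _ fun i hi => by
      rw [Matrix.map_mul, hX i hi, hX' i hi, (hΨ i).1, Matrix.map_one _ (map_zero _) (map_one _)]
    exact IsUnit.of_mul_eq_one _ h1
  have hrel : PhiNRel p φ X Y := hext _ _ fun i hi => by
    rw [Matrix.map_mul, hX i hi, hY i hi, hN i hi]
    have h2 : (Y.map (frob p φ D)).map (evalAt φ (AlgHom.id ℚ_[p] D) σ i) = N (i + 1) := by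
      rw [← hY' i hi]
      ext a b
      simp [evalAt_frob]
    rw [← h2, ← hX i hi, ← Matrix.map_mul]
    ext a b
    rw [Matrix.smul_apply, Matrix.map_apply, Matrix.map_apply, Matrix.smul_apply, smul_eq_mul,
      smul_eq_mul, map_mul, map_natCast]
  obtain ⟨g, ⟨hg1, hg2⟩, -⟩ := existsUnique_univ p φ d X Y hXu hrel
  refine ⟨g, fun i hi => ⟨?_, ?_⟩⟩
  · rw [← hX i hi, ← hg1]
    ext a b
    exact (evalAt_id_map φ g σ i _).symm
  · rw [← hY i hi, ← hg2]
    ext a b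
    exact (evalAt_id_map φ g σ i _).symm

theorem algHom_ext_of_components {g g' : PRing p φ d →ₐ[ℚ_[p]] D} (h : ∀ i < Module.finrank ℚ_[p] K₀,
      compΦ φ g σ i = compΦ φ g' σ i ∧ compN φ g σ i = compN φ g' σ i) : g = g' := by
  have key : ∀ X : Matrix (Fin d) (Fin d) (PRing p φ d ⊗[ℚ_[p]] K₀), (∀ i < Module.finrank ℚ_[p] K₀,
      X.map (evalAt φ g σ i) = X.map (evalAt φ g' σ i)) → baseChange p g X = baseChange p g' X := by
    intro X hX
    ext a b
    refine ext_evalAt_id φ σ hφ fun i hi => ?_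
    have := congrFun₂ (hX i hi) a b
    rw [baseChange, baseChange, Matrix.map_apply, Matrix.map_apply, evalAt_id_map, evalAt_id_map]
    exact this
  have hu := univ_rel p φ d
  have hrel : PhiNRel p φ (baseChange p g (univΦ p φ d)) (baseChange p g (univN p φ d)) := by
    have h1 := congrArg (baseChange p g) hu.2
    rw [baseChange_mul] at h1
    rw [PhiNRel, h1]
    have h2 : (baseChange p g (univN p φ d)).map (frob p φ D) =
        baseChange p g ((univN p φ d).map (frob p φ _)) := by
      ext a b
      simp only [baseChange, Matrix.map_apply, frob_map]
    rw [h2, ← baseChange_mul]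
    ext a b
    simp only [baseChange, Matrix.map_apply, Matrix.smul_apply, smul_eq_mul, map_mul, map_natCast]
  refine (existsUnique_univ p φ d _ _ ?_ hrel).unique ⟨rfl, rfl⟩
    ⟨(key _ fun i hi => (h i hi).1).symm, (key _ fun i hi => (h i hi).2).symm⟩
  exact hu.1.map (Algebra.TensorProduct.map g (AlgHom.id ℚ_[p] K₀)).mapMatrix

end Universal

end PhiNModule

/-! ### Detection of the rank by nonzero minors -/

section Minors

variable {m n L : Type*} [Fintype m] [Fintype n] [Field L]

theorem Matrix.exists_linearIndependent_row (M : Matrix m n L) {k : ℕ} (hk : M.rank = k) :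
    ∃ r : Fin k → m, LinearIndependent L (M.submatrix r id).row := by
  subst hk
  rw [Matrix.rank_eq_finrank_span_row]
  obtain ⟨f, hf, -, hli⟩ := Submodule.exists_fun_fin_finrank_span_eq L (Set.range M.row)
  choose r hr using hf
  refine ⟨r, ?_⟩
  exact (funext hr : (M.submatrix r id).row = f) ▸ hli

theorem Matrix.exists_det_submatrix_ne_zero (M : Matrix m n L) {k : ℕ} (hk : M.rank = k) :
    ∃ (r : Fin k → m) (c : Fin k → n), (M.submatrix r c).det ≠ 0 := by
  obtain ⟨r, hr⟩ := M.exists_linearIndependent_row hk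
  have h1 : (M.submatrix r id).transpose.rank = k := by
    rw [Matrix.rank_transpose, LinearIndependent.rank_matrix hr, Fintype.card_fin]
  obtain ⟨c, hc⟩ := (M.submatrix r id).transpose.exists_linearIndependent_row h1
  refine ⟨r, c, ?_⟩
  rw [← Matrix.det_transpose]
  exact ((Matrix.isUnit_iff_isUnit_det _).1
    (Matrix.linearIndependent_rows_iff_isUnit.1 hc)).ne_zero

omit [Fintype m] in
theorem Matrix.le_rank_of_det_submatrix_ne_zero (M : Matrix m n L) {k : ℕ} (r : Fin k → m)
    (c : Fin k → n) (h : (M.submatrix r c).det ≠ 0) : k ≤ M.rank := by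
  have h1 := M.rank_submatrix_le r c
  rwa [Matrix.rank_of_isUnit _ ((Matrix.isUnit_iff_isUnit_det _).2 h.isUnit), Fintype.card_fin] at h1

end Minors

namespace PhiNModule

/-! ### Semicontinuity of ranks and of separability under specialization -/

section Specialization

open Polynomial

variable {p : ℕ} [Fact p.Prime] {K₀ : Type*} [Field K₀] [Algebra ℚ_[p] K₀]
  [FiniteDimensional ℚ_[p] K₀] {φ : K₀ ≃ₐ[ℚ_[p]] K₀} (hφ : orderOf φ = Module.finrank ℚ_[p] K₀)
  {R : Type*} [CommRing R] [Algebra ℚ_[p] R]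

include hφ in
-- The right-hand side depends only on the kernel of `g`, not on `σ` or `D`. This is what permits
-- comparing points over unrelated fields with unrelated embeddings.
theorem forall_evalAt_eq_zero_iff {D : Type*} [CommRing D] [Algebra ℚ_[p] D] (g : R →ₐ[ℚ_[p]] D)
    (σ : K₀ →ₐ[ℚ_[p]] D) (z : R ⊗[ℚ_[p]] K₀) :
    (∀ i, evalAt φ g σ i z = 0) ↔ ∀ k, g ((coords p K₀ R).repr z k) = 0 := by
  have h1 : (∀ k, g ((coords p K₀ R).repr z k) = 0) ↔
      Algebra.TensorProduct.map g (AlgHom.id ℚ_[p] K₀) z = 0 := by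
    simp only [← coords_repr_map]
    rw [← (coords p K₀ D).repr.map_eq_zero_iff, Finsupp.ext_iff]
    rfl
  rw [h1]
  refine ⟨fun h => ext_evalAt_id φ σ hφ fun i _ => ?_, fun h i => ?_⟩
  · rw [evalAt_id_map, h, map_zero]
  · rw [← evalAt_id_map, h, map_zero]

include hφ in
/-- If an element vanishes at one point then it vanishes at any specialization, provided that its
vanishing does not depend on the components. -/
theorem evalAt_eq_zero_of_ker_le {D D' : Type*} [CommRing D] [Algebra ℚ_[p] D] [CommRing D']
    [Algebra ℚ_[p] D'] (g : R →ₐ[ℚ_[p]] D) (σ : K₀ →ₐ[ℚ_[p]] D) (g' : R →ₐ[ℚ_[p]] D')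
    (σ' : K₀ →ₐ[ℚ_[p]] D') (hle : RingHom.ker g ≤ RingHom.ker g') (z : R ⊗[ℚ_[p]] K₀)
    (h : ∀ i, evalAt φ g σ i z = 0) (i : ℕ) : evalAt φ g' σ' i z = 0 := by
  refine (forall_evalAt_eq_zero_iff hφ g' σ' z).2 (fun k => hle ?_) i
  exact (forall_evalAt_eq_zero_iff hφ g σ z).1 h k

variable {L L' : Type*} [Field L] [Algebra ℚ_[p] L] [Field L'] [Algebra ℚ_[p] L']

include hφ in
-- A minor larger than the rank at `g` vanishes there, hence at the specialization. Vanishing passes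
-- between the points only when it holds in all components simultaneously, so the rank must not
-- depend on the component.
theorem rank_map_evalAt_le {m n : Type*} [Fintype m] [Fintype n] (g : R →ₐ[ℚ_[p]] L)
    (σ : K₀ →ₐ[ℚ_[p]] L) (g' : R →ₐ[ℚ_[p]] L') (σ' : K₀ →ₐ[ℚ_[p]] L')
    (hle : RingHom.ker g ≤ RingHom.ker g') (X : Matrix m n (R ⊗[ℚ_[p]] K₀))
    (h : ∀ i, (X.map (evalAt φ g σ i)).rank = (X.map (evalAt φ g σ 0)).rank) :
    (X.map (evalAt φ g' σ' 0)).rank ≤ (X.map (evalAt φ g σ 0)).rank := by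
  obtain ⟨r, c, hrc⟩ := (X.map (evalAt φ g' σ' 0)).exists_det_submatrix_ne_zero rfl
  by_contra! hlt
  refine hrc ?_
  have hdet' : ∀ i : ℕ, evalAt φ g σ i (X.submatrix r c).det =
        ((X.map (evalAt φ g σ i)).submatrix r c).det := fun i => by
    rw [AlgHom.map_det]
    rfl
  have hdet : evalAt φ g' σ' 0 (X.submatrix r c).det =
        ((X.map (evalAt φ g' σ' 0)).submatrix r c).det := by
    rw [AlgHom.map_det]
    rfl
  rw [← hdet]
  refine evalAt_eq_zero_of_ker_le hφ g σ g' σ' hle _ (fun i => ?_) 0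
  rw [hdet']
  by_contra h0
  have := Matrix.le_rank_of_det_submatrix_ne_zero _ r c h0
  rw [h i] at this
  omega

variable {d : ℕ} (g : PRing p φ d →ₐ[ℚ_[p]] L)
    (σ : K₀ →ₐ[ℚ_[p]] L) (g' : PRing p φ d →ₐ[ℚ_[p]] L') (σ' : K₀ →ₐ[ℚ_[p]] L')
    (hle : RingHom.ker g ≤ RingHom.ker g')

theorem compA_embPow (i : ℕ) :
    (phiPow p φ (univΦ p φ d)).map (evalAt φ g σ i) = compA φ g (embPow φ σ i) := by
  ext a b; simp [compA, evalAt_embPow]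

theorem compN_embPow (i : ℕ) :
    (univN p φ d).map (evalAt φ g σ i) = compN φ g (embPow φ σ i) 0 := by
  ext a b; simp [compN, evalAt_embPow]

theorem map_univN_pow (i k : ℕ) :
    (univN p φ d ^ k).map (evalAt φ g σ i) = compN φ g (embPow φ σ i) 0 ^ k := by
  rw [← compN_embPow]
  exact map_pow (evalAt φ g σ i).mapMatrix _ _

theorem map_intertwiner_phiPow (q i : ℕ) :
    (intertwiner (q : PRing p φ d ⊗[ℚ_[p]] K₀) (phiPow p φ (univΦ p φ d))).map (evalAt φ g σ i) =
      intertwiner (q : L) (compA φ g (embPow φ σ i)) := by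
  rw [← compA_embPow]
  refine (map_intertwiner (evalAt φ g σ i : PRing p φ d ⊗[ℚ_[p]] K₀ →+* L) _ _).trans ?_
  rw [map_natCast]
  rfl

omit [FiniteDimensional ℚ_[p] K₀] in
theorem embPow_zero : embPow φ σ 0 = σ := by
  ext x
  simp [embPow_apply]

/-- The discriminant, up to sign, of the characteristic polynomial of `Φ^f`. -/
def discPhiPow (φ : K₀ ≃ₐ[ℚ_[p]] K₀) (d : ℕ) : PRing p φ d ⊗[ℚ_[p]] K₀ :=
  resultant (phiPow p φ (univΦ p φ d)).charpoly (derivative (phiPow p φ (univΦ p φ d)).charpoly)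
    d (d - 1)

theorem evalAt_discPhiPow_eq_zero_iff (i : ℕ) : evalAt φ g σ i (discPhiPow φ d) = 0 ↔
    ¬ (compA φ g (embPow φ σ i)).charpoly.Separable := by
  have : CharZero L := charZero_of_injective_algebraMap (algebraMap ℚ_[p] L).injective
  have h1 : evalAt φ g σ i (discPhiPow φ d) = resultant (compA φ g (embPow φ σ i)).charpoly
      (derivative (compA φ g (embPow φ σ i)).charpoly) := by
    -- The resultant is taken with the fixed degrees `d` and `d - 1`, so that it commutes with ring
    -- homomorphisms; in characteristic zero these are the true degrees.
    refine (resultant_map_map _ _ _ _ (evalAt φ g σ i : PRing p φ d ⊗[ℚ_[p]] K₀ →+* L)).symm.trans ?_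
    rw [← derivative_map, ← Matrix.charpoly_map, natDegree_derivative, Matrix.charpoly_natDegree_eq_dim, Fintype.card_fin,
      ← compA_embPow]
    rfl
  rw [h1, resultant_eq_zero_iff, and_iff_right (Or.inl (Matrix.charpoly_monic _).ne_zero)]
  rfl

include hφ

theorem rank_compN_embPow_pow (i k : ℕ) : (compN φ g (embPow φ σ i) 0 ^ k).rank =
    (compN φ g σ 0 ^ k).rank := by
  obtain ⟨P, hP, -, h1⟩ := exists_isUnit_compA_embPow g σ hφ i
  have : CharZero L := charZero_of_injective_algebraMap (algebraMap ℚ_[p] L).injective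
  have hp : (p : L) ^ i ≠ 0 := pow_ne_zero _ (Nat.cast_ne_zero.2 (Fact.out : p.Prime).ne_zero)
  have h2 : compN φ g σ 0 ^ k * P = P * ((p : L) ^ i • compN φ g (embPow φ σ i) 0) ^ k := by
    induction k with
    | zero => simp
    | succ k ih =>
      rw [pow_succ, mul_assoc, h1, ← Matrix.mul_smul, ← mul_assoc, ih, mul_assoc, ← pow_succ]
  rw [rank_eq_of_mul_eq_mul hP h2, _root_.smul_pow,
    Matrix.rank_smul_of_mem_nonZeroDivisors _ (mem_nonZeroDivisors_of_ne_zero (pow_ne_zero _ hp))]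

theorem rank_intertwiner_compA_embPow (q : L) (i : ℕ) :
    (intertwiner q (compA φ g (embPow φ σ i))).rank = (intertwiner q (compA φ g σ)).rank := by
  obtain ⟨P, hP, h1, -⟩ := exists_isUnit_compA_embPow g σ hφ i
  obtain ⟨U, hU, h2⟩ := intertwiner_conj q hP h1
  exact (rank_eq_of_mul_eq_mul hU h2).symm

theorem charpoly_compA_embPow (i : ℕ) :
    (compA φ g (embPow φ σ i)).charpoly = (compA φ g σ).charpoly := by
  obtain ⟨_, ⟨P, rfl⟩, h1, -⟩ := exists_isUnit_compA_embPow g σ hφ i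
  have h2 : compA φ g σ = P.val * compA φ g (embPow φ σ i) * P⁻¹.val := by
    rw [← h1, mul_assoc, Units.mul_inv, mul_one]
  rw [h2, Matrix.coe_units_inv, Matrix.charpoly_units_conj]

include hle

theorem rank_compN_pow_le (k : ℕ) :
    (compN φ g' σ' 0 ^ k).rank ≤ (compN φ g σ 0 ^ k).rank := by
  have h := rank_map_evalAt_le hφ g σ g' σ' hle (univN p φ d ^ k) fun i => by
    rw [map_univN_pow, map_univN_pow, embPow_zero, rank_compN_embPow_pow hφ]
  rwa [map_univN_pow, map_univN_pow, embPow_zero, embPow_zero] at h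

theorem rank_intertwiner_compA_le (q : ℕ) :
    (intertwiner (q : L') (compA φ g' σ')).rank ≤ (intertwiner (q : L) (compA φ g σ)).rank := by
  have h := rank_map_evalAt_le hφ g σ g' σ' hle
    (intertwiner (q : PRing p φ d ⊗[ℚ_[p]] K₀) (phiPow p φ (univΦ p φ d))) fun i => by
      rw [map_intertwiner_phiPow, map_intertwiner_phiPow, embPow_zero,
        rank_intertwiner_compA_embPow hφ]
  rwa [map_intertwiner_phiPow, map_intertwiner_phiPow, embPow_zero, embPow_zero] at h

theorem separable_compA (h : (compA φ g' σ').charpoly.Separable) :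
    (compA φ g σ).charpoly.Separable := by
  by_contra h0
  refine (evalAt_discPhiPow_eq_zero_iff g' σ' 0).1 (evalAt_eq_zero_of_ker_le hφ g σ g' σ' hle _
    (fun i => ?_) 0) (by rwa [embPow_zero])
  rwa [evalAt_discPhiPow_eq_zero_iff, charpoly_compA_embPow hφ]

end Specialization

end PhiNModule

namespace PhiNModule

/-! ### Frames putting `N` into a standard form -/

section Frames

variable {p : ℕ} [Fact p.Prime] {K₀ : Type*} [Field K₀] [Algebra ℚ_[p] K₀]
  [FiniteDimensional ℚ_[p] K₀] (φ : K₀ ≃ₐ[ℚ_[p]] K₀) {d : ℕ} {D : Type*} [CommRing D]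
  [Algebra ℚ_[p] D] (g : PRing p φ d →ₐ[ℚ_[p]] D) (σ : K₀ →ₐ[ℚ_[p]] D)

/-- The matrices `G₀, …, G_f` form bases of the components of a module with `N` given by powers of
`p` times `J`. -/
def IsFrame (J : Matrix (Fin d) (Fin d) D) (G : ℕ → (Matrix (Fin d) (Fin d) D)ˣ) : Prop :=
  ∀ i < Module.finrank ℚ_[p] K₀, compΦ φ g σ i = (G i).val * (G (i + 1))⁻¹.val ∧
    compN φ g σ i = ((p : ℚ_[p])⁻¹ ^ i) • ((G i).val * J * (G i)⁻¹.val)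

/-- The matrix of `Φ^f` with respect to a frame. -/
def frameMatrix (K₀ : Type*) [Field K₀] [Algebra ℚ_[p] K₀] {D : Type*} [CommRing D]
    (G : ℕ → (Matrix (Fin d) (Fin d) D)ˣ) : (Matrix (Fin d) (Fin d) D)ˣ :=
  (G (Module.finrank ℚ_[p] K₀))⁻¹ * G 0

variable {φ g σ} {J : Matrix (Fin d) (Fin d) D} {G : ℕ → (Matrix (Fin d) (Fin d) D)ˣ}

theorem natCast_smul_inv_pow_succ {M : Type*} [AddCommGroup M] [Module ℚ_[p] M] [Module D M]
    [IsScalarTower ℚ_[p] D M] (i : ℕ) (x : M) :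
    (p : D) • ((p : ℚ_[p])⁻¹ ^ (i + 1)) • x = ((p : ℚ_[p])⁻¹ ^ i) • x := by
  have hp : (p : ℚ_[p]) ≠ 0 := Nat.cast_ne_zero.2 (Fact.out : p.Prime).ne_zero
  have h1 : (p : D) = algebraMap ℚ_[p] D p := by simp
  rw [h1, algebraMap_smul, smul_smul, pow_succ', ← mul_assoc, mul_inv_cancel₀ hp, one_mul]

theorem natCast_pow_smul_inv_pow {M : Type*} [AddCommGroup M] [Module ℚ_[p] M] [Module D M]
    [IsScalarTower ℚ_[p] D M] (i : ℕ) (x : M) :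
    ((p : D) ^ i) • ((p : ℚ_[p])⁻¹ ^ i) • x = x := by
  have hp : (p : ℚ_[p]) ≠ 0 := Nat.cast_ne_zero.2 (Fact.out : p.Prime).ne_zero
  have h1 : (p : D) ^ i = algebraMap ℚ_[p] D (p ^ i) := by simp
  rw [h1, algebraMap_smul, smul_smul, ← mul_pow, mul_inv_cancel₀ hp, one_pow, one_smul]

/-- The prescribed `N_i` satisfy the consecutive relations automatically. The condition on the frame
matrix says exactly that the family closes up, that is, `N_f = N_0`. -/
theorem exists_isFrame (hφ : orderOf φ = Module.finrank ℚ_[p] K₀) (σ : K₀ →ₐ[ℚ_[p]] D)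
    (h : J * (frameMatrix (p := p) K₀ G).val =
      ((p ^ Module.finrank ℚ_[p] K₀ : ℕ) : D) • ((frameMatrix (p := p) K₀ G).val * J)) :
    ∃ g : PRing p φ d →ₐ[ℚ_[p]] D, IsFrame φ g σ J G := by
  refine exists_compΦ_compN_eq (φ := φ) (d := d) σ hφ
    (fun i => (G i).val * (G (i + 1))⁻¹.val)
    (fun i => ((p : ℚ_[p])⁻¹ ^ i) • ((G i).val * J * (G i)⁻¹.val))
    (fun i => (G i * (G (i + 1))⁻¹).isUnit) (fun i _ => ?_) ?_
  · rw [Matrix.mul_smul, natCast_smul_inv_pow_succ, Matrix.smul_mul]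
    simp only [mul_assoc, Units.inv_mul_cancel_left]
  · set f := Module.finrank ℚ_[p] K₀
    have h1 : (G f).val = (G 0).val * (frameMatrix (p := p) K₀ G)⁻¹.val := by
      rw [← Units.val_mul]
      congr 1
      simp [frameMatrix, f]
    have h2 : (G f)⁻¹.val = (frameMatrix (p := p) K₀ G).val * (G 0)⁻¹.val := by
      rw [← Units.val_mul]
      congr 1
      simp [frameMatrix, f]
    have h3 : (G f).val * J * (G f)⁻¹.val = ((p : D) ^ f) • ((G 0).val * J * (G 0)⁻¹.val) := by
      rw [h1, h2, mul_assoc, mul_assoc, ← mul_assoc J, h, Matrix.smul_mul, Matrix.mul_smul, Matrix.mul_smul,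
        Nat.cast_pow]
      congr 1
      simp only [mul_assoc, Units.inv_mul_cancel_left]
    rw [h3, smul_comm, natCast_pow_smul_inv_pow, pow_zero, one_smul]

/-- The basis `S` is transported along the module: `G_i = (Φ_0 ⋯ Φ_{i-1})⁻¹ S`. The frame matrix is
then `S⁻¹ A S`, which inherits the relation of `A` with `N_0`. -/
theorem exists_isFrame_of_mul_eq (hφ : orderOf φ = Module.finrank ℚ_[p] K₀)
    {S : Matrix (Fin d) (Fin d) D} (hS : IsUnit S) (h : compN φ g σ 0 * S = S * J) :
    ∃ G, (G 0).val = S ∧ IsFrame φ g σ J G ∧ J * (frameMatrix (p := p) K₀ G).val =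
      ((p ^ Module.finrank ℚ_[p] K₀ : ℕ) : D) • ((frameMatrix (p := p) K₀ G).val * J) := by
  obtain ⟨S, rfl⟩ := hS
  choose P hP using fun i => isUnit_prodΦ (isUnit_compΦ φ g σ) 0 i
  have h0 : compN φ g σ 0 = S.val * J * S⁻¹.val := by rw [← h, mul_assoc, Units.mul_inv, mul_one]
  have hJ : J = S⁻¹.val * compN φ g σ 0 * S.val := by rw [mul_assoc, h, Units.inv_mul_cancel_left]
  refine ⟨fun i => (P i)⁻¹ * S, ?_, fun i _ => ⟨?_, ?_⟩, ?_⟩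
  · have : P 0 = 1 := Units.ext (by rw [hP]; simp [prodΦ])
    simp [this]
  · have h1 := hP (i + 1)
    rw [prodΦ_succ, ← hP i, zero_add] at h1
    rw [← Units.val_mul]
    simp only [mul_inv_rev, inv_inv]
    rw [mul_assoc, mul_inv_cancel_left, Units.val_mul, h1, Units.inv_mul_cancel_left]
  · have h1 := mul_prodΦ (compN_mul_compΦ φ g σ) 0 i
    rw [← hP i, zero_add] at h1
    have h2 : compN φ g σ i = ((p : ℚ_[p])⁻¹ ^ i) • ((p : D) ^ i) • compN φ g σ i := by
      rw [smul_comm, natCast_pow_smul_inv_pow]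
    rw [h2]
    congr 1
    rw [mul_inv_rev, inv_inv, Units.val_mul, Units.val_mul, hJ]
    simp only [mul_assoc, Units.mul_inv_cancel_left]
    rw [h1, Matrix.mul_smul, Units.inv_mul_cancel_left]
  · have h1 : (frameMatrix (p := p) K₀ fun i => (P i)⁻¹ * S).val =
        S⁻¹.val * compA φ g σ * S.val := by
      have h3 : P 0 = 1 := Units.ext (by rw [hP]; simp [prodΦ])
      rw [compA_eq, ← hP]
      simp [frameMatrix, h3]
    rw [h1, hJ]
    have h2 := compN_mul_compA g σ hφ
    simp only [mul_assoc, Units.mul_inv_cancel_left]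
    rw [← mul_assoc (compN φ g σ 0), h2, Matrix.smul_mul, Matrix.mul_smul, mul_assoc]

theorem prodΦ_eq_of_isFrame (h : IsFrame φ g σ J G) :
    compA φ g σ = (G 0).val * (G (Module.finrank ℚ_[p] K₀))⁻¹.val := by
  have key : ∀ m ≤ Module.finrank ℚ_[p] K₀,
      prodΦ (compΦ φ g σ) 0 m = (G 0).val * (G m)⁻¹.val := fun m => by
    induction m with
    | zero => simp [prodΦ]
    | succ m ih =>
      intro hm
      rw [prodΦ_succ, ih (by omega), zero_add, (h m hm).1, mul_assoc, Units.inv_mul_cancel_left]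
  rw [compA_eq, key _ le_rfl]

theorem compA_mul_of_isFrame (h : IsFrame φ g σ J G) :
    compA φ g σ * (G 0).val = (G 0).val * (frameMatrix (p := p) K₀ G).val := by
  rw [prodΦ_eq_of_isFrame h, frameMatrix, Units.val_mul, mul_assoc]

theorem compN_mul_of_isFrame (h : IsFrame φ g σ J G) :
    compN φ g σ 0 * (G 0).val = (G 0).val * J := by
  rw [(h 0 Module.finrank_pos).2, pow_zero, one_smul, mul_assoc, Units.inv_mul, mul_one]

theorem IsFrame.map {D' : Type*} [CommRing D'] [Algebra ℚ_[p] D'] (h : IsFrame φ g σ J G)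
    (ψ : D →ₐ[ℚ_[p]] D') : IsFrame φ (ψ.comp g) (ψ.comp σ) (J.map ψ)
      fun i => Units.map (MonoidHomClass.toMonoidHom (ψ.mapMatrix (m := Fin d))) (G i) := by
  intro i hi
  rw [compΦ_comp, compN_comp, (h i hi).1, (h i hi).2]
  have hm : ∀ M N : Matrix (Fin d) (Fin d) D, (M * N).map ψ = M.map ψ * N.map ψ :=
    fun M N => map_mul ψ.mapMatrix M N
  constructor
  · rw [hm]
    rfl
  · have : ∀ (r : ℚ_[p]) (M : Matrix (Fin d) (Fin d) D), (r • M).map ψ = r • M.map ψ :=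
      fun r M => map_smul ψ.mapMatrix r M
    rw [this, hm, hm]
    rfl

theorem IsFrame.eq_of_forall {g' : PRing p φ d →ₐ[ℚ_[p]] D}
    {G' : ℕ → (Matrix (Fin d) (Fin d) D)ˣ} (hφ : orderOf φ = Module.finrank ℚ_[p] K₀)
    (h : IsFrame φ g σ J G) (h' : IsFrame φ g' σ J G')
    (hG : ∀ i ≤ Module.finrank ℚ_[p] K₀, G i = G' i) : g = g' :=
  algHom_ext_of_components σ hφ fun i hi => by
    rw [(h i hi).1, (h i hi).2, (h' i hi).1, (h' i hi).2, hG i hi.le, hG (i + 1) hi]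
    exact ⟨rfl, rfl⟩

end Frames

end PhiNModule

/-- Take a section of `f` over its range and extend it linearly to `W`. Such a generalized inverse
`g` makes `1 - g f` a projection onto the kernel of `f`. -/
theorem LinearMap.exists_comp_comp_eq_self {K V W : Type*} [Field K] [AddCommGroup V] [Module K V]
    [AddCommGroup W] [Module K W] (f : V →ₗ[K] W) : ∃ g : W →ₗ[K] V, f ∘ₗ g ∘ₗ f = f := by
  obtain ⟨s, hs⟩ := f.rangeRestrict.exists_rightInverse_of_surjective f.range_rangeRestrict
  obtain ⟨g, hg⟩ := s.exists_extend
  refine ⟨g, LinearMap.ext fun v => ?_⟩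
  have h1 : g (f v) = s (f.rangeRestrict v) := LinearMap.congr_fun hg (f.rangeRestrict v)
  have h2 := LinearMap.congr_fun hs (f.rangeRestrict v)
  rw [LinearMap.comp_apply, LinearMap.comp_apply, h1]
  exact congrArg Subtype.val h2

theorem Matrix.exists_mul_mul_eq_self {K m : Type*} [Field K] [Fintype m] [DecidableEq m]
    (T : Matrix m m K) : ∃ T' : Matrix m m K, T * (T' * T) = T := by
  obtain ⟨g, hg⟩ := (Matrix.toLin' T).exists_comp_comp_eq_self
  refine ⟨LinearMap.toMatrix' g, Matrix.toLin'.injective ?_⟩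
  rw [Matrix.toLin'_mul, Matrix.toLin'_mul, Matrix.toLin'_toMatrix', hg]

namespace PhiNModule

theorem intertwiner_mulVec {n R : Type*} [CommRing R] [Fintype n] [DecidableEq n] (q : R)
    (A M : Matrix n n R) (i j : n) :
    (intertwiner q A).mulVec (fun x => M x.1 x.2) (i, j) = (M * A - q • (A * M)) i j := by
  simp only [intertwiner, Matrix.mulVec, dotProduct, Fintype.sum_prod_type, Matrix.sub_apply,
    Matrix.smul_apply, Matrix.kroneckerMap_apply, sub_mul, Finset.sum_sub_distrib, Matrix.one_apply,
    Matrix.transpose_apply, Matrix.mul_apply, smul_eq_mul, mul_ite, ite_mul, one_mul, zero_mul,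
    mul_one, mul_zero, Finset.sum_ite_eq, Finset.mem_univ, if_true, Finset.mul_sum]
  congr 1
  · rw [Finset.sum_comm]
    simp [mul_comm]
  · simp [mul_assoc]

/-- Dividing by `q` presents the solutions `C` as the kernel of an intertwiner for `J` rather than
for `C`. -/
theorem intertwiner_mulVec_eq_zero_iff {n R : Type*} [CommRing R] [Fintype n] [DecidableEq n] {q q' : R}
    (hq : q' * q = 1) (J C : Matrix n n R) :
    (intertwiner q' J).mulVec (fun x => C x.1 x.2) = 0 ↔ J * C = q • (C * J) := by
  have h1 : (intertwiner q' J).mulVec (fun x => C x.1 x.2) = 0 ↔ C * J - q' • (J * C) = 0 := by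
    rw [funext_iff, ← Matrix.ext_iff, Prod.forall]
    simp only [intertwiner_mulVec]
    rfl
  rw [h1, sub_eq_zero]
  constructor
  · intro h
    rw [h, smul_smul, mul_comm q q', hq, one_smul]
  · intro h
    rw [h, smul_smul, hq, one_smul]

/-! ### The variety of frames and its generic point -/

section Generic

variable (p : ℕ) [Fact p.Prime] {K₀ : Type*} [Field K₀] [Algebra ℚ_[p] K₀]
  {d : ℕ}

/-- The polynomial ring over `K₀` in the coordinates of matrices `G_i` and `Z`. -/
abbrev ParamRing (K₀ : Type*) [Field K₀] (d : ℕ) := MvPolynomial (Option ℕ × Fin d × Fin d) K₀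

/-- The generic matrices `G_i`, for an index `some i`, and `Z`, for the index `none`. -/
def paramMat (K₀ : Type*) [Field K₀] (d : ℕ) (i : Option ℕ) :
    Matrix (Fin d) (Fin d) (ParamRing K₀ d) :=
  Matrix.of fun a b => MvPolynomial.X (i, a, b)

/-- The inverse of `p ^ f`. -/
def invQ (K₀ : Type*) [Field K₀] [Algebra ℚ_[p] K₀] : K₀ :=
  ((p ^ Module.finrank ℚ_[p] K₀ : ℕ) : K₀)⁻¹

/-- A generalized inverse of the linear map `C ↦ C J - q⁻¹ J C`. -/
def pseudoInverse (J : Matrix (Fin d) (Fin d) K₀) :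
    Matrix (Fin d × Fin d) (Fin d × Fin d) K₀ :=
  (Matrix.exists_mul_mul_eq_self (intertwiner (invQ p K₀) J)).choose

theorem mul_pseudoInverse_mul (J : Matrix (Fin d) (Fin d) K₀) :
    intertwiner (invQ p K₀) J * (pseudoInverse p J * intertwiner (invQ p K₀) J) =
      intertwiner (invQ p K₀) J :=
  (Matrix.exists_mul_mul_eq_self (intertwiner (invQ p K₀) J)).choose_spec

theorem invQ_mul : invQ p K₀ * ((p ^ Module.finrank ℚ_[p] K₀ : ℕ) : K₀) = 1 := by
  have : CharZero K₀ := charZero_of_injective_algebraMap (algebraMap ℚ_[p] K₀).injective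
  exact inv_mul_cancel₀ (Nat.cast_ne_zero.2 (pow_ne_zero _ (Fact.out : p.Prime).ne_zero))

/-- The generic solution of `J C = q C J`. -/
def paramSol (J : Matrix (Fin d) (Fin d) K₀) : Matrix (Fin d) (Fin d) (ParamRing K₀ d) :=
  Matrix.of fun a b => paramMat K₀ d none a b - ((pseudoInverse p J).map MvPolynomial.C).mulVec
    (((intertwiner (invQ p K₀) J).map MvPolynomial.C).mulVec
      fun x => paramMat K₀ d none x.1 x.2) (a, b)

/-- With `T` the intertwiner and `T'` its generalized inverse, the generic solution is `(1 - T' T)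
Z`, and `T (1 - T' T) = 0`. -/
theorem mul_paramSol (J : Matrix (Fin d) (Fin d) K₀) :
    J.map MvPolynomial.C * paramSol p J = ((p ^ Module.finrank ℚ_[p] K₀ : ℕ) : ParamRing K₀ d) •
      (paramSol p J * J.map MvPolynomial.C) := by
  have hq : (MvPolynomial.C (invQ p K₀) : ParamRing K₀ d) *
      ((p ^ Module.finrank ℚ_[p] K₀ : ℕ) : ParamRing K₀ d) = 1 := by
    rw [← map_natCast (MvPolynomial.C (σ := Option ℕ × Fin d × Fin d) (R := K₀)), ← map_mul,
      invQ_mul, map_one]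
  rw [← intertwiner_mulVec_eq_zero_iff hq, ← map_intertwiner]
  have h : (fun x : Fin d × Fin d => paramSol p J x.1 x.2) =
      (fun x => paramMat K₀ d none x.1 x.2) - ((pseudoInverse p J).map MvPolynomial.C).mulVec
        (((intertwiner (invQ p K₀) J).map MvPolynomial.C).mulVec
          fun x => paramMat K₀ d none x.1 x.2) := rfl
  rw [h, Matrix.mulVec_sub, Matrix.mulVec_mulVec, Matrix.mulVec_mulVec, ← Matrix.map_mul,
    ← Matrix.map_mul, mul_assoc, mul_pseudoInverse_mul, sub_self]

/-- The projection `1 - T' T` fixes the kernel of `T`, so every solution over any ring is a value of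
the generic solution. -/
theorem map_paramSol {J : Matrix (Fin d) (Fin d) K₀} {L : Type*} [CommRing L]
    (ψ : ParamRing K₀ d →+* L) (h : (J.map MvPolynomial.C).map ψ * (paramMat K₀ d none).map ψ =
      ((p ^ Module.finrank ℚ_[p] K₀ : ℕ) : L) •
        ((paramMat K₀ d none).map ψ * (J.map MvPolynomial.C).map ψ)) :
    (paramSol p J).map ψ = (paramMat K₀ d none).map ψ := by
  have hq : ψ (MvPolynomial.C (invQ p K₀) : ParamRing K₀ d) *
      ((p ^ Module.finrank ℚ_[p] K₀ : ℕ) : L) = 1 := by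
    rw [← map_natCast (ψ.comp MvPolynomial.C), ← RingHom.comp_apply, ← map_mul, invQ_mul, map_one]
  rw [← intertwiner_mulVec_eq_zero_iff hq, ← map_intertwiner, ← map_intertwiner] at h
  ext a b
  rw [Matrix.map_apply, paramSol, Matrix.of_apply, map_sub, Matrix.map_apply, sub_eq_self,
    RingHom.map_mulVec]
  have : ψ ∘ ((intertwiner (invQ p K₀) J).map MvPolynomial.C).mulVec
      (fun x => paramMat K₀ d none x.1 x.2) = 0 := by
    ext x
    rw [Function.comp_apply, RingHom.map_mulVec]
    exact congrFun h x
  rw [this, Matrix.mulVec_zero]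
  rfl

/-- The determinant to be inverted in order to make the generic matrices invertible. -/
def paramDet (J : Matrix (Fin d) (Fin d) K₀) : ParamRing K₀ d :=
  (∏ i ∈ Finset.range (Module.finrank ℚ_[p] K₀), (paramMat K₀ d (some i)).det) * (paramSol p J).det

/-- The homomorphism with given values of the generic matrices. -/
def paramEval {L : Type*} [CommRing L] (σ : K₀ →+* L) (G : ℕ → Matrix (Fin d) (Fin d) L)
    (C : Matrix (Fin d) (Fin d) L) : ParamRing K₀ d →+* L :=
  MvPolynomial.eval₂Hom σ fun x => x.1.elim (C x.2.1 x.2.2) fun i => G i x.2.1 x.2.2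

theorem map_some_paramEval {L : Type*} [CommRing L] (σ : K₀ →+* L) (G : ℕ → Matrix (Fin d) (Fin d) L)
    (C : Matrix (Fin d) (Fin d) L) (i : ℕ) :
    (paramMat K₀ d (some i)).map (paramEval σ G C) = G i := by
  ext a b
  simp [paramMat, paramEval]

theorem map_paramSol_paramEval {J : Matrix (Fin d) (Fin d) K₀} {L : Type*} [CommRing L] (σ : K₀ →+* L)
    (G : ℕ → Matrix (Fin d) (Fin d) L) (C : Matrix (Fin d) (Fin d) L)
    (h : J.map σ * C = ((p ^ Module.finrank ℚ_[p] K₀ : ℕ) : L) • (C * J.map σ)) :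
    (paramSol p J).map (paramEval σ G C) = C := by
  have h1 : (paramMat K₀ d none).map (paramEval σ G C) = C := by
    ext a b
    simp [paramMat, paramEval]
  have h2 : (J.map MvPolynomial.C).map (paramEval σ G C) = J.map σ := by
    ext a b
    simp [paramEval]
  rw [map_paramSol, h1]
  rw [h1, h2, h]

theorem isUnit_paramEval_paramDet {J : Matrix (Fin d) (Fin d) K₀} {L : Type*} [CommRing L] (σ : K₀ →+* L)
    (G : ℕ → (Matrix (Fin d) (Fin d) L)ˣ) (C : (Matrix (Fin d) (Fin d) L)ˣ)
    (h : J.map σ * C.val = ((p ^ Module.finrank ℚ_[p] K₀ : ℕ) : L) • (C.val * J.map σ)) :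
    IsUnit (paramEval σ (fun i => (G i).val) C.val (paramDet p J)) := by
  rw [paramDet, map_mul, map_prod, RingHom.map_det, RingHom.mapMatrix_apply,
    map_paramSol_paramEval p _ _ _ h]
  refine IsUnit.mul ?_ ((Matrix.isUnit_iff_isUnit_det _).1 C.isUnit)
  rw [IsUnit.prod_iff]
  intro i _
  rw [RingHom.map_det, RingHom.mapMatrix_apply, map_some_paramEval]
  exact (Matrix.isUnit_iff_isUnit_det _).1 (G i).isUnit

/-- The coordinate ring of the variety of frames. -/
abbrev FrameRing (J : Matrix (Fin d) (Fin d) K₀) := Localization.Away (paramDet p J)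

variable {p} [FiniteDimensional ℚ_[p] K₀] {φ : K₀ ≃ₐ[ℚ_[p]] K₀} (hφ : orderOf φ = Module.finrank ℚ_[p] K₀)
include hφ

/-- The irreducible closed subset of the points where `N₀` is conjugate to `J` over the residue
field is the closure of the image of the generic point of the variety of frames. -/
theorem exists_genericFrame (J : Matrix (Fin d) (Fin d) K₀) :
    ∃ (g : PRing p φ d →ₐ[ℚ_[p]] FrameRing p J) (G : ℕ → (Matrix (Fin d) (Fin d) (FrameRing p J))ˣ),
      IsFrame φ g (IsScalarTower.toAlgHom ℚ_[p] K₀ (FrameRing p J))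
        (J.map (algebraMap K₀ (FrameRing p J))) G ∧
      (∀ i < Module.finrank ℚ_[p] K₀, (G i).val =
        (paramMat K₀ d (some i)).map (algebraMap (ParamRing K₀ d) (FrameRing p J))) ∧
      (frameMatrix (p := p) K₀ G).val = (paramSol p J).map (algebraMap (ParamRing K₀ d) (FrameRing p J)) := by
  set f := Module.finrank ℚ_[p] K₀ with hf
  have hdet : ∀ M : Matrix (Fin d) (Fin d) (ParamRing K₀ d), M.det ∣ paramDet p J →
      IsUnit (M.map (algebraMap (ParamRing K₀ d) (FrameRing p J))) := fun M hM => by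
    rw [Matrix.isUnit_iff_isUnit_det]
    have h1 : IsUnit (algebraMap (ParamRing K₀ d) (FrameRing p J) (paramDet p J)) :=
      IsLocalization.Away.algebraMap_isUnit _
    have := isUnit_of_dvd_unit (map_dvd (algebraMap (ParamRing K₀ d) (FrameRing p J)) hM) h1
    rwa [RingHom.map_det] at this
  have hG : ∀ i < f, IsUnit ((paramMat K₀ d (some i)).map (algebraMap (ParamRing K₀ d) (FrameRing p J))) :=
    fun i hi => hdet _ (Dvd.dvd.mul_right (Finset.dvd_prod_of_mem
      (fun i => (paramMat K₀ d (some i)).det) (Finset.mem_range.2 hi)) _)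
  obtain ⟨C, hC⟩ := hdet (paramSol p J) (Dvd.intro_left _ rfl)
  choose! G hG using hG
  have hpos : 0 < f := Module.finrank_pos
  -- The matrix `G_f` is not free: it is set to `G_0 C⁻¹`, which makes the frame matrix equal to
  -- `C`.
  have hfr : frameMatrix (p := p) K₀ (fun i => if i < f then G i else G 0 * C⁻¹) = C := by
    simp [frameMatrix, ← hf, hpos]
  obtain ⟨g, hg⟩ := exists_isFrame (φ := φ) (J := J.map (algebraMap K₀ (FrameRing p J)))
    (G := fun i => if i < f then G i else G 0 * C⁻¹) hφ
    (IsScalarTower.toAlgHom ℚ_[p] K₀ (FrameRing p J)) (by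
      have h1 := congrArg (algebraMap (ParamRing K₀ d) (FrameRing p J)).mapMatrix (mul_paramSol p J)
      have h2 : (J.map MvPolynomial.C).map (algebraMap (ParamRing K₀ d) (FrameRing p J)) =
          J.map (algebraMap K₀ (FrameRing p J)) := Matrix.ext fun a b =>
        (IsScalarTower.algebraMap_apply K₀ (ParamRing K₀ d) (FrameRing p J) (J a b)).symm
      have h3 : ∀ (n : ℕ) (M : Matrix (Fin d) (Fin d) (ParamRing K₀ d)),
          (algebraMap (ParamRing K₀ d) (FrameRing p J)).mapMatrix ((n : ParamRing K₀ d) • M) =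
            (n : FrameRing p J) • (algebraMap (ParamRing K₀ d) (FrameRing p J)).mapMatrix M := fun n M => by
        ext a b
        simp
      rw [h3, map_mul, map_mul, RingHom.mapMatrix_apply, RingHom.mapMatrix_apply, h2, ← hC] at h1
      rw [hfr, h1])
  refine ⟨g, _, hg, fun i hi => ?_, ?_⟩
  · rw [if_pos hi, hG i hi]
  · rw [hfr, hC]

end Generic

end PhiNModule

theorem Nat.Prime.pow_mul_one_add_mul_eq_iff {p : ℕ} (hp : p.Prime) (a b l m : ℕ) :
    p ^ a * (1 + p * l) = p ^ b * (1 + p * m) ↔ a = b ∧ l = m := by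
  refine ⟨fun h => ?_, by rintro ⟨rfl, rfl⟩; rfl⟩
  have hnd : ∀ l, ¬ p ∣ 1 + p * l := fun l h => by
    rw [Nat.dvd_add_left (dvd_mul_right p l)] at h
    exact hp.one_lt.ne' (Nat.dvd_one.1 h)
  have key : ∀ a b l m, p ^ a * (1 + p * l) = p ^ b * (1 + p * m) → a ≤ b := by
    intro a b l m h
    have h1 : p ^ a ∣ p ^ b * (1 + p * m) := h ▸ dvd_mul_right _ _
    exact (Nat.pow_dvd_pow_iff_le_right hp.one_lt).1
      (Nat.Coprime.dvd_of_dvd_mul_right (((hp.coprime_iff_not_dvd.2 (hnd m)).pow_left a)) h1)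
  obtain rfl := le_antisymm (key _ _ _ _ h) (key _ _ _ _ h.symm)
  have h1 := Nat.eq_of_mul_eq_mul_left (pow_pos hp.pos a) h
  exact ⟨rfl, Nat.eq_of_mul_eq_mul_left hp.pos (Nat.add_left_cancel h1)⟩

namespace PhiNModule

/-- The position `a` of block `l` gets the label `p ^ (f * a) * (1 + p * l)`. Multiplication by `p ^
f` moves one step along a block, and the prime-to-`p` part `1 + p * l` separates the blocks. These
labels serve as eigenvalues. -/
theorem exists_forall_nilpotentJordan_pow_apply {d : ℕ} (π : d.Partition) (L : Type*) [Field L] {p f : ℕ}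
    (hp : p.Prime) (hf : 0 < f) : ∃ t : Fin d → ℕ, Function.Injective t ∧ (∀ i, t i ≠ 0) ∧
      ∀ k i j, (nilpotentJordan π L ^ k) i j = if t j = (p ^ f) ^ k * t i then 1 else 0 := by
  obtain ⟨m, k, hk, hπ, e, he⟩ := exists_equiv_isLink π
  let s : (Σ l, Fin (k l)) → ℕ := fun x => p ^ (f * x.2) * (1 + p * x.1)
  have hs : ∀ n x y, s y = (p ^ f) ^ n * s x ↔ x.1 = y.1 ∧ (y.2 : ℕ) = x.2 + n := by
    intro n x y
    simp only [s]
    rw [← mul_assoc, ← pow_mul, ← pow_add, hp.pow_mul_one_add_mul_eq_iff, ← mul_add,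
      Nat.mul_right_inj hf.ne', add_comm n, Fin.val_inj, and_comm, eq_comm (a := x.1)]
  refine ⟨s ∘ e.symm, ?_, ?_, ?_⟩
  · refine Function.Injective.comp ?_ e.symm.injective
    intro x y h
    have := (hs 0 y x).1 (by rw [h, pow_zero, one_mul])
    obtain ⟨x, a⟩ := x
    obtain ⟨y, b⟩ := y
    obtain ⟨h1, h2⟩ := this
    simp only at h1 h2
    subst h1
    simp [Fin.ext_iff, h2]
  · intro i
    exact mul_ne_zero (pow_ne_zero _ hp.ne_zero) (by omega)
  · intro n i j
    obtain ⟨x, rfl⟩ := e.surjective i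
    obtain ⟨y, rfl⟩ := e.surjective j
    rw [nilpotentJordan_pow_apply π L e he]
    simp only [Function.comp_apply, Equiv.symm_apply_apply]
    by_cases h : x.1 = y.1 ∧ (y.2 : ℕ) = x.2 + n
    · rw [if_pos h, if_pos ((hs n x y).2 h)]
    · rw [if_neg h, if_neg fun h' => h ((hs n x y).1 h')]

/-- The pairs with `t j = q ^ k * t i` are counted twice: as the rank of the `k`-th power of the
Jordan matrix, a partial injection, and as the nullity of the intertwiner. -/
theorem natCard_add_rank_intertwiner_diagonal {d : ℕ} (π : d.Partition) {L : Type*} [Field L] [CharZero L]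
    {q : ℕ} (hq : q ≠ 0) {t : Fin d → ℕ} (ht : Function.Injective t)
    (h : ∀ k i j, (nilpotentJordan π L ^ k) i j = if t j = q ^ k * t i then 1 else 0) (k : ℕ) :
    powRank π k + (intertwiner ((q : L) ^ k) (Matrix.diagonal fun i => (t i : L))).rank = d * d := by
  have h1 := card_eq_add_rank_intertwiner ((q : L) ^ k) (isUnit_one (M := Matrix (Fin d) (Fin d) L))
    (A := Matrix.diagonal fun i => (t i : L)) (c := fun i => (t i : L)) (by rw [mul_one, one_mul])
  rw [Fintype.card_fin] at h1
  rw [← h1]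
  congr 1
  have h2 : nilpotentJordan π L ^ k =
      Matrix.of fun i j => if t j = q ^ k * t i then (1 : L) else 0 := by
    ext i j
    rw [h]
    rfl
  rw [← rank_nilpotentJordan_pow π L k, h2, rank_of_ite (fun i j => t j = q ^ k * t i)
    (fun x y z h h' => ht (h.trans h'.symm))
    (fun x y z h h' => ht (Nat.eq_of_mul_eq_mul_left (pow_pos (Nat.pos_of_ne_zero hq) k) (h.symm.trans h')))]
  refine Nat.card_congr ⟨fun x => ⟨(x.1, x.2.choose), ?_⟩, fun x => ⟨x.1.1, x.1.2, ?_⟩, ?_, ?_⟩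
  · have := x.2.choose_spec
    exact_mod_cast this
  · have := x.2
    exact_mod_cast this
  · rintro ⟨x, hx⟩
    rfl
  · rintro ⟨⟨x, y⟩, hx⟩
    have h3 : t y = q ^ k * t x := by exact_mod_cast hx
    have h4 : ∃ j, t j = q ^ k * t x := ⟨y, h3⟩
    simp only [Subtype.mk.injEq, Prod.mk.injEq, true_and]
    exact ht (h4.choose_spec.trans h3.symm)

theorem map_nilpotentJordan {d : ℕ} (π : d.Partition) {K L : Type*} [Field K] [Field L] (σ : K →+* L) :
    (nilpotentJordan π K).map σ = nilpotentJordan π L := by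
  ext i j
  simp [nilpotentJordan, apply_ite σ]

/-! ### Universality of the generic frame, and a special point -/

section Generic

variable {p : ℕ} [Fact p.Prime] {K₀ : Type*} [Field K₀] [Algebra ℚ_[p] K₀] {d : ℕ}
  [FiniteDimensional ℚ_[p] K₀] {φ : K₀ ≃ₐ[ℚ_[p]] K₀} (hφ : orderOf φ = Module.finrank ℚ_[p] K₀)

/-- The homomorphism corresponding to the generic point of the variety of frames. -/
def genericPoint (J : Matrix (Fin d) (Fin d) K₀) : PRing p φ d →ₐ[ℚ_[p]] FrameRing p J :=
  (exists_genericFrame hφ J).choose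

/-- A conjugation of `N_0` to `J` yields a frame over `D`. Its matrices `G_0, …, G_{f-1}` and its
frame matrix are values of the generic ones, and the point is recovered from the frame. -/
theorem exists_comp_genericPoint_eq (J : Matrix (Fin d) (Fin d) K₀) {D : Type*} [CommRing D]
    [Algebra ℚ_[p] D] (g : PRing p φ d →ₐ[ℚ_[p]] D) (σ : K₀ →ₐ[ℚ_[p]] D)
    {S : Matrix (Fin d) (Fin d) D} (hS : IsUnit S) (h : compN φ g σ 0 * S = S * J.map σ) :
    ∃ ψ : FrameRing p J →ₐ[ℚ_[p]] D, ψ.comp (genericPoint hφ J) = g := by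
  obtain ⟨Γ, hΓ, hΓ1, hΓ2⟩ := (exists_genericFrame hφ J).choose_spec
  change IsFrame φ (genericPoint hφ J) _ _ _ at hΓ
  obtain ⟨G, -, hG, hG1⟩ := exists_isFrame_of_mul_eq hφ hS h
  set f := Module.finrank ℚ_[p] K₀ with hf
  set C := frameMatrix (p := p) K₀ G with hC
  let ψ₀ : ParamRing K₀ d →+* D := paramEval (σ : K₀ →+* D) (fun i => (G i).val) C.val
  have hu : IsUnit (ψ₀ (paramDet p J)) := isUnit_paramEval_paramDet p (σ : K₀ →+* D) G C hG1
  let ψ₁ : FrameRing p J →+* D := IsLocalization.Away.lift (paramDet p J) hu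
  have hψ₁ : ∀ x, ψ₁ (algebraMap (ParamRing K₀ d) _ x) = ψ₀ x := fun x =>
    IsLocalization.Away.lift_eq (paramDet p J) hu x
  have hψK : ∀ x, ψ₁ (algebraMap K₀ _ x) = σ x := fun x => by
    rw [IsScalarTower.algebraMap_apply K₀ (ParamRing K₀ d) (FrameRing p J), hψ₁]
    simp [ψ₀, paramEval]
  let ψ : FrameRing p J →ₐ[ℚ_[p]] D := { ψ₁ with
    commutes' := fun x => by
      rw [IsScalarTower.algebraMap_apply ℚ_[p] K₀ (FrameRing p J)]
      exact (hψK _).trans (σ.commutes x) }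
  have hψ : ∀ x, ψ x = ψ₁ x := fun x => rfl
  have hσ : ψ.comp (IsScalarTower.toAlgHom ℚ_[p] K₀ (FrameRing p J)) = σ := AlgHom.ext hψK
  have h1 := hΓ.map ψ
  have hJ : (J.map (algebraMap K₀ (FrameRing p J))).map ψ = J.map σ :=
    Matrix.ext fun a b => hψK (J a b)
  rw [hσ, hJ] at h1
  refine ⟨ψ, h1.eq_of_forall hφ hG fun i hi => ?_⟩
  have hpos : 0 < f := Module.finrank_pos
  have hmap : ∀ i < f, Units.map (MonoidHomClass.toMonoidHom (ψ.mapMatrix (m := Fin d))) (Γ i) = G i :=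
    fun i hi => Units.ext <| by
      have h2 : (Γ i).val.map ψ = (G i).val := by
        rw [hΓ1 i hi, ← map_some_paramEval (σ : K₀ →+* D) (fun i => (G i).val) C.val i]
        exact Matrix.ext fun a b => hψ₁ _
      exact h2
  rcases hi.lt_or_eq with hi | rfl
  · exact hmap i hi
  · have h3 : Units.map (MonoidHomClass.toMonoidHom (ψ.mapMatrix (m := Fin d)))
        (frameMatrix (p := p) K₀ Γ) = C := Units.ext <| by
      have h4 : (frameMatrix (p := p) K₀ Γ).val.map ψ = C.val := by
        rw [hΓ2, ← map_paramSol_paramEval p (σ : K₀ →+* D) (fun i => (G i).val) C.val hG1]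
        exact Matrix.ext fun a b => hψ₁ _
      exact h4
    have h5 : Γ f = Γ 0 * (frameMatrix (p := p) K₀ Γ)⁻¹ := by simp [frameMatrix, hf]
    have h6 : G f = G 0 * C⁻¹ := by simp [hC, frameMatrix, hf]
    rw [h5, map_mul, map_inv, h3, hmap 0 hpos, h6]

theorem exists_compN_genericPoint (J : Matrix (Fin d) (Fin d) K₀) :
    ∃ S : Matrix (Fin d) (Fin d) (FrameRing p J), IsUnit S ∧
      compN φ (genericPoint hφ J) (IsScalarTower.toAlgHom ℚ_[p] K₀ (FrameRing p J)) 0 * S =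
        S * J.map (algebraMap K₀ (FrameRing p J)) := by
  obtain ⟨Γ, hΓ, -⟩ := (exists_genericFrame hφ J).choose_spec
  exact ⟨_, (Γ 0).isUnit, compN_mul_of_isFrame hΓ⟩

/-- A point with values in `K₀` at which `N₀` has Jordan type `π` and `Φ^f` is diagonal, with the
eigenvalues as generic as possible. -/
theorem exists_special (hφ : orderOf φ = Module.finrank ℚ_[p] K₀) (π : d.Partition) :
    IsDomain (FrameRing p (nilpotentJordan π K₀)) ∧ ∃ g : PRing p φ d →ₐ[ℚ_[p]] K₀,
      (∃ S, IsUnit S ∧ compN φ g (AlgHom.id ℚ_[p] K₀) 0 * S = S * nilpotentJordan π K₀) ∧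
      (compA φ g (AlgHom.id ℚ_[p] K₀)).charpoly.Separable ∧
      ∀ k, powRank π k + (intertwiner (((p ^ Module.finrank ℚ_[p] K₀) ^ k : ℕ) : K₀)
        (compA φ g (AlgHom.id ℚ_[p] K₀))).rank = d * d := by
  have : CharZero K₀ := charZero_of_injective_algebraMap (algebraMap ℚ_[p] K₀).injective
  have hp : p.Prime := Fact.out
  have hpos : 0 < Module.finrank ℚ_[p] K₀ := Module.finrank_pos
  obtain ⟨t, ht, ht0, htJ⟩ := exists_forall_nilpotentJordan_pow_apply π K₀ hp hpos
  set f := Module.finrank ℚ_[p] K₀ with hf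
  let c : Fin d → K₀ˣ := fun i => Units.mk0 (t i : K₀) (Nat.cast_ne_zero.2 (ht0 i))
  let C : (Matrix (Fin d) (Fin d) K₀)ˣ := ⟨Matrix.diagonal fun i => (c i).val,
    Matrix.diagonal fun i => (c i)⁻¹.val, by simp [Matrix.diagonal_mul_diagonal],
    by simp [Matrix.diagonal_mul_diagonal]⟩
  have hCv : C.val = Matrix.diagonal fun i => (t i : K₀) := rfl
  have hJC : nilpotentJordan π K₀ * C.val = ((p ^ f : ℕ) : K₀) • (C.val * nilpotentJordan π K₀) := by
    ext i j
    have := htJ 1 i j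
    rw [pow_one, pow_one] at this
    rw [hCv, Matrix.mul_diagonal, Matrix.smul_apply, Matrix.diagonal_mul, this]
    split_ifs with h
    · rw [h]
      push_cast
      simp
    · simp
  have hJid : (nilpotentJordan π K₀).map (RingHom.id K₀) = nilpotentJordan π K₀ := by
    ext i j; rfl
  refine ⟨?_, ?_⟩
  -- The determinant to be inverted is nonzero, since it takes a unit value at this explicit frame.
  · have hu := isUnit_paramEval_paramDet p (RingHom.id K₀) (J := nilpotentJordan π K₀)
      (fun _ => 1) C (by rw [hJid]; exact hJC)
    refine IsLocalization.isDomain_localization (powers_le_nonZeroDivisors_of_noZeroDivisors ?_)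
    intro h0
    rw [h0, map_zero] at hu
    exact not_isUnit_zero hu
  -- Only `G_0` is nontrivial, so that both the frame matrix and `Φ^f` are the diagonal matrix `C`.
  · let G : ℕ → (Matrix (Fin d) (Fin d) K₀)ˣ := fun i => if i = 0 then C else 1
    have hG : frameMatrix (p := p) K₀ G = C := by simp [frameMatrix, G, hf ▸ hpos.ne']
    obtain ⟨g, hg⟩ := exists_isFrame (φ := φ) (G := G) (J := nilpotentJordan π K₀) hφ
      (AlgHom.id ℚ_[p] K₀) (by rw [hG]; exact hJC)
    have hA : compA φ g (AlgHom.id ℚ_[p] K₀) = C.val := by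
      have := compA_mul_of_isFrame hg
      rw [hG] at this
      exact (Units.mul_left_inj C).1 this
    refine ⟨g, ⟨_, (G 0).isUnit, compN_mul_of_isFrame hg⟩, ?_, fun k => ?_⟩
    · rw [hA, hCv, Matrix.charpoly_diagonal]
      rw [Polynomial.separable_prod_X_sub_C_iff]
      exact Nat.cast_injective.comp ht
    · rw [hA, hCv, ← natCard_add_rank_intertwiner_diagonal π (pow_ne_zero _ hp.ne_zero) ht htJ k]
      push_cast
      rfl

end Generic

end PhiNModule

/-! ### The strata of given Jordan type and the minimal primes -/

namespace PhiNModule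

universe v

variable {p : ℕ} [Fact p.Prime] {K₀ : Type v} [Field K₀] [Algebra ℚ_[p] K₀] {d : ℕ}
  [FiniteDimensional ℚ_[p] K₀] {φ : K₀ ≃ₐ[ℚ_[p]] K₀} (hφ : orderOf φ = Module.finrank ℚ_[p] K₀)

/-- The ideal of the closure of the set of points at which `N₀` has Jordan type `π`. -/
def genericIdeal (π : d.Partition) : Ideal (PRing p φ d) :=
  RingHom.ker (genericPoint hφ (nilpotentJordan π K₀))

theorem isPrime_genericIdeal (π : d.Partition) : (genericIdeal hφ π).IsPrime := by
  have := (exists_special hφ π).1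
  exact RingHom.ker_isPrime _

theorem genericIdeal_le_ker {L : Type*} [Field L] [Algebra ℚ_[p] L] (g : PRing p φ d →ₐ[ℚ_[p]] L)
    (σ : K₀ →ₐ[ℚ_[p]] L) {π : d.Partition} (h : HasNilpotentJordanType (compN φ g σ 0) π) :
    genericIdeal hφ π ≤ RingHom.ker g := by
  obtain ⟨S, hS⟩ := h.exists_mul_eq
  obtain ⟨ψ, rfl⟩ := exists_comp_genericPoint_eq hφ (nilpotentJordan π K₀) g σ S.isUnit (by
    rw [hS]
    congr 1
    exact (map_nilpotentJordan π (σ : K₀ →+* L)).symm)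
  intro x hx
  rw [RingHom.mem_ker, AlgHom.comp_apply]
  rw [genericIdeal, RingHom.mem_ker] at hx
  rw [hx, map_zero]

theorem exists_point_genericIdeal (π : d.Partition) :
    ∃ (L : Type v) (_ : Field L) (_ : Algebra ℚ_[p] L) (_ : IsAlgClosed L)
      (g : PRing p φ d →ₐ[ℚ_[p]] L) (σ : K₀ →ₐ[ℚ_[p]] L), RingHom.ker g = genericIdeal hφ π ∧
        HasNilpotentJordanType (compN φ g σ 0) π := by
  have := (exists_special hφ π).1
  set D := FrameRing p (nilpotentJordan π K₀) with hD
  let ι : D →ₐ[ℚ_[p]] AlgebraicClosure (FractionRing D) := IsScalarTower.toAlgHom ℚ_[p] _ _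
  have hι : Function.Injective ι := by
    change Function.Injective (algebraMap D (AlgebraicClosure (FractionRing D)))
    rw [IsScalarTower.algebraMap_eq D (FractionRing D)]
    exact (algebraMap (FractionRing D) _).injective.comp (IsFractionRing.injective D _)
  obtain ⟨S, hS, h⟩ := exists_compN_genericPoint hφ (nilpotentJordan π K₀)
  refine ⟨AlgebraicClosure (FractionRing D), inferInstance, inferInstance, inferInstance,
    ι.comp (genericPoint hφ (nilpotentJordan π K₀)),
    ι.comp (IsScalarTower.toAlgHom ℚ_[p] K₀ D), ?_, ?_⟩
  · ext x
    rw [genericIdeal, RingHom.mem_ker, RingHom.mem_ker, AlgHom.comp_apply,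
      map_eq_zero_iff ι hι]
  · refine .of_mul_eq (hS.map ι.mapMatrix) ?_
    rw [compN_comp]
    have h1 := congrArg ι.mapMatrix h
    rw [map_mul, map_mul] at h1
    refine h1.trans ?_
    congr 1
    exact map_nilpotentJordan π (ι.toRingHom.comp (algebraMap K₀ D))

theorem natCast_pow_injective {L : Type*} [Field L] [CharZero L] {q : ℕ} (hq : 1 < q) :
    Function.Injective fun k : ℕ => (q : L) ^ k := by
  intro a b h
  refine Nat.pow_right_injective hq (Nat.cast_injective (R := L) ?_)
  rw [Nat.cast_pow _ a, Nat.cast_pow _ b]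
  exact h

include hφ in
theorem isNilpotent_compN {L : Type*} [Field L] [Algebra ℚ_[p] L] [IsAlgClosed L]
    (g : PRing p φ d →ₐ[ℚ_[p]] L) (σ : K₀ →ₐ[ℚ_[p]] L) : IsNilpotent (compN φ g σ 0) := by
  have : CharZero L := charZero_of_injective_algebraMap (algebraMap ℚ_[p] L).injective
  exact isNilpotent_of_mul_eq (natCast_pow_injective
    (Nat.one_lt_pow Module.finrank_pos.ne' (Fact.out : p.Prime).one_lt))
    (isUnit_compA φ g σ) (compN_mul_compA g σ hφ)

section Point

variable {L : Type*} [Field L] [Algebra ℚ_[p] L] (g : PRing p φ d →ₐ[ℚ_[p]] L)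
  (σ : K₀ →ₐ[ℚ_[p]] L) {π : d.Partition} (hg : RingHom.ker g = genericIdeal hφ π)

include hg

/-- The special point lies in the closure of the stratum and has distinct eigenvalues; separability
is an open condition. -/
theorem separable_of_ker_eq : (compA φ g σ).charpoly.Separable := by
  obtain ⟨-, g₀, ⟨S, hS, h1⟩, h2, -⟩ := exists_special hφ π
  refine separable_compA hφ g σ g₀ _ ?_ h2
  rw [hg]
  exact genericIdeal_le_ker hφ g₀ _ (.of_mul_eq hS h1)

theorem rank_compN_pow_of_ker_eq (k : ℕ) : (compN φ g σ 0 ^ k).rank = powRank π k := by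
  obtain ⟨L', _, _, _, g', σ', hg', h⟩ := exists_point_genericIdeal hφ π
  rw [← h.rank_pow]
  exact le_antisymm (rank_compN_pow_le hφ g' σ' g σ (by rw [hg, hg']) k)
    (rank_compN_pow_le hφ g σ g' σ' (by rw [hg, hg']) k)

/-- Equality holds at the special point, and the rank of the intertwiner can only grow under
generization. -/
theorem le_powRank_add_rank_of_ker_eq (k : ℕ) : d * d ≤ powRank π k +
    (intertwiner (((p ^ Module.finrank ℚ_[p] K₀) ^ k : ℕ) : L) (compA φ g σ)).rank := by
  obtain ⟨-, g₀, ⟨S, hS, h1⟩, -, h2⟩ := exists_special hφ π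
  rw [← h2 k]
  gcongr
  refine rank_intertwiner_compA_le hφ g σ g₀ _ ?_ _
  rw [hg]
  exact genericIdeal_le_ker hφ g₀ _ (.of_mul_eq hS h1)

theorem le_rank_add_rank_of_ker_eq : d * d ≤ (compN φ g σ 0).rank +
    (intertwiner ((p ^ Module.finrank ℚ_[p] K₀ : ℕ) : L) (compA φ g σ)).rank := by
  have h1 := le_powRank_add_rank_of_ker_eq hφ g σ hg 1
  rwa [← rank_compN_pow_of_ker_eq hφ g σ hg 1, pow_one, pow_one] at h1

theorem roots_nodup_of_ker_eq : (compA φ g σ).charpoly.roots.Nodup :=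
  Polynomial.nodup_roots (separable_of_ker_eq hφ g σ hg)

theorem hasNilpotentJordanType_of_ker_eq [IsAlgClosed L] : HasNilpotentJordanType (compN φ g σ 0) π := by
  obtain ⟨μ, hμ⟩ := exists_hasNilpotentJordanType (isNilpotent_compN hφ g σ)
  obtain rfl : μ = π := eq_of_powRank_eq fun k => by
    rw [← hμ.rank_pow, rank_compN_pow_of_ker_eq hφ g σ hg]
  exact hμ

end Point

/-- Semicontinuity of the rank of `N_0 ^ k` gives one inequality between the functions `powRank`.
For the other, the intertwiner rank is semicontinuous in the same direction, while it is
complementary to `powRank` at both points: at most at `μ`, since the eigenvalues are distinct, and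
at least at `π`. -/
theorem eq_of_genericIdeal_le {π μ : d.Partition} (h : genericIdeal hφ μ ≤ genericIdeal hφ π) :
    μ = π := by
  obtain ⟨L, _, _, _, g, σ, hg, -⟩ := exists_point_genericIdeal hφ μ
  obtain ⟨L', _, _, _, g', σ', hg', -⟩ := exists_point_genericIdeal hφ π
  rw [← hg, ← hg'] at h
  refine eq_of_powRank_eq fun k => le_antisymm ?_ ?_
  · have h1 := rank_pow_add_rank_intertwiner_le (roots_nodup_of_ker_eq hφ g σ hg)
      (compN_mul_compA g σ hφ) (k + 1)
    have h2 := le_powRank_add_rank_of_ker_eq hφ g' σ' hg' (k + 1)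
    have h3 := rank_intertwiner_compA_le hφ g σ g' σ' h
      ((p ^ Module.finrank ℚ_[p] K₀) ^ (k + 1))
    rw [rank_compN_pow_of_ker_eq hφ g σ hg, Fintype.card_fin, ← Nat.cast_pow] at h1
    omega
  · have h1 := rank_compN_pow_le hφ g σ g' σ' h (k + 1)
    rwa [rank_compN_pow_of_ker_eq hφ g σ hg, rank_compN_pow_of_ker_eq hφ g' σ' hg'] at h1

theorem genericIdeal_injective : Function.Injective (genericIdeal (d := d) hφ) :=
  fun _ _ h => eq_of_genericIdeal_le hφ h.le

/-- Over the algebraic closure of the residue field `N_0` is nilpotent, hence of some Jordan type.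
-/
theorem exists_genericIdeal_le (𝔮 : Ideal (PRing p φ d)) [𝔮.IsPrime] :
    ∃ π, genericIdeal hφ π ≤ 𝔮 := by
  let L := AlgebraicClosure 𝔮.ResidueField
  let g : PRing p φ d →ₐ[ℚ_[p]] L := IsScalarTower.toAlgHom ℚ_[p] _ _
  let σ : K₀ →ₐ[ℚ_[p]] L := IsAlgClosed.lift
  obtain ⟨π, hπ⟩ := exists_hasNilpotentJordanType (isNilpotent_compN hφ g σ)
  refine ⟨π, (genericIdeal_le_ker hφ g σ hπ).trans_eq ?_⟩
  change RingHom.ker (algebraMap (PRing p φ d) L) = 𝔮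
  rw [IsScalarTower.algebraMap_eq (PRing p φ d) 𝔮.ResidueField L, ← RingHom.comap_ker,
    (RingHom.injective_iff_ker_eq_bot _).1 (algebraMap 𝔮.ResidueField L).injective,
    ← RingHom.ker_eq_comap_bot, Ideal.ker_algebraMap_residueField]

/-- The irreducible components of `P_{K₀,d}` correspond to the partitions of `d`. -/
theorem range_genericIdeal : Set.range (genericIdeal (d := d) hφ) = minimalPrimes (PRing p φ d) := by
  ext 𝔮
  constructor
  · rintro ⟨π, rfl⟩
    refine ⟨⟨isPrime_genericIdeal hφ π, bot_le⟩, fun 𝔮 h𝔮 hle => ?_⟩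
    have := h𝔮.1
    obtain ⟨μ, hμ⟩ := exists_genericIdeal_le hφ 𝔮
    rwa [← eq_of_genericIdeal_le hφ (hμ.trans hle)]
  · intro h
    have := h.1.1
    obtain ⟨π, hπ⟩ := exists_genericIdeal_le hφ 𝔮
    exact ⟨π, le_antisymm hπ (h.2 ⟨isPrime_genericIdeal hφ π, bot_le⟩ hπ)⟩

end PhiNModule

/-! ### Solvability of the linearized equations -/

namespace PhiNModule

variable {n L : Type*} [Fintype n] [DecidableEq n] [Field L] [IsAlgClosed L]

/-- At a pair with `q * c i ≠ c j` the entry of `N` is found by division by `c j - q * c i`. At the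
remaining pairs this coefficient vanishes, and a diagonal `X` must solve `M i j * (x j - q * x i) =
h i j`. This is possible because the chains have no cycles. As `M` vanishes at the pairs of the
first kind, `X` does not disturb them. -/
theorem exists_diagonal_solution {q : L} (hq : Function.Injective fun k : ℕ => q ^ k) {c : n → L}
    (hc : Function.Injective c) (hc0 : ∀ i, c i ≠ 0) {M : Matrix n n L}
    (hM : ∀ i j, M i j ≠ 0 ↔ q * c i = c j) (h : Matrix n n L) :
    ∃ N X : Matrix n n L, N * Matrix.diagonal c - q • (Matrix.diagonal c * N) + M * X - q • (X * M) = h := by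
  classical
  have hq0 : q ≠ 0 := by
    rintro rfl
    have : (1 : ℕ) = 2 := hq (by simp)
    omega
  let E : Matrix n n L := Matrix.of fun i j => if q * c i = c j then 1 else 0
  have hE : IsNilpotent E := by
    refine isNilpotent_of_mul_eq (A := Matrix.diagonal c) hq ?_ ?_
    · rw [Matrix.isUnit_iff_isUnit_det, Matrix.det_diagonal, isUnit_iff_ne_zero]
      exact Finset.prod_ne_zero_iff.2 fun i _ => hc0 i
    · ext i j
      rw [Matrix.mul_diagonal, Matrix.smul_apply, Matrix.diagonal_mul, smul_eq_mul, ← mul_assoc]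
      simp only [E, Matrix.of_apply]
      split_ifs with h
      · rw [h, mul_comm]
      · simp
  have hE' : IsNilpotent (q • E.transpose) := by
    obtain ⟨k, hk⟩ := hE
    exact ⟨k, by rw [smul_pow, ← Matrix.transpose_pow, hk, Matrix.transpose_zero, smul_zero]⟩
  -- Each `j` has at most one predecessor `i`, so the operator `1 - q Eᵀ` sends `x` to `x j - q * x
  -- i`; it is invertible by nilpotency. The sum on the right selects this predecessor.
  obtain ⟨x, hx⟩ := (Matrix.mulVec_surjective_iff_isUnit.2 hE'.isUnit_one_sub)
    fun j => ∑ i, E i j * (h i j / M i j)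
  have hsum : ∀ (F : n → L) (i j), q * c i = c j → ∑ k, E k j * F k = F i := by
    intro F i j hij
    rw [Finset.sum_eq_single i]
    · simp [E, hij]
    · intro k _ hk
      have : q * c k ≠ c j := fun h' => hk (hc (mul_left_cancel₀ hq0 (h'.trans hij.symm)))
      simp [E, this]
    · simp
  have hx' : ∀ i j, q * c i = c j → x j - q * x i = h i j / M i j := by
    intro i j hij
    have h1 := congrFun hx j
    rw [Matrix.sub_mulVec, Matrix.one_mulVec, Matrix.smul_mulVec, Pi.sub_apply, Pi.smul_apply] at h1
    simp only [Matrix.mulVec, dotProduct, Matrix.transpose_apply, smul_eq_mul] at h1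
    rwa [hsum _ i j hij, hsum (fun k => h k j / M k j) i j hij] at h1
  refine ⟨Matrix.of fun i j => h i j / (c j - q * c i), Matrix.diagonal x, ?_⟩
  ext i j
  rw [Matrix.sub_apply, Matrix.add_apply, Matrix.sub_apply, Matrix.mul_diagonal, Matrix.smul_apply,
    Matrix.diagonal_mul, Matrix.mul_diagonal, Matrix.smul_apply, Matrix.diagonal_mul,
    Matrix.of_apply, smul_eq_mul, smul_eq_mul]
  by_cases hij : q * c i = c j
  · have h1 := hx' i j hij
    rw [eq_div_iff ((hM i j).2 hij)] at h1
    rw [← h1, hij]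
    ring
  · have h0 : M i j = 0 := by
      by_contra h0
      exact hij ((hM i j).1 h0)
    have h1 : c j - q * c i ≠ 0 := sub_ne_zero.2 fun h => hij h.symm
    rw [h0]
    field_simp
    ring

/-- The linearization of the equation `N A = q A N` is surjective at a pair of matrices for which
`A` has distinct eigenvalues and `N` is as generic as possible. -/
theorem exists_linearized_solution {q : L} (hq : Function.Injective fun k : ℕ => q ^ k)
    {A N : Matrix n n L} (hA : IsUnit A) (hA' : A.charpoly.roots.Nodup) (hN : N * A = q • (A * N))
    (hr : Fintype.card n * Fintype.card n ≤ N.rank + (intertwiner q A).rank) (h : Matrix n n L) :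
    ∃ ν X : Matrix n n L, ν * A - q • (A * ν) + N * X - q • (X * N) = h := by
  obtain ⟨c, S, M, hc, ⟨S, rfl⟩, h1, h2, h3⟩ := exists_diagonal_of_le_rank hA' hN hr
  have hc0 : ∀ i, c i ≠ 0 := by
    have h4 : IsUnit (Matrix.diagonal c) := by
      have : Matrix.diagonal c = S⁻¹.val * A * S.val := by
        rw [mul_assoc, h1, Units.inv_mul_cancel_left]
      rw [this]
      exact (S⁻¹.isUnit.mul hA).mul S.isUnit
    rw [Matrix.isUnit_iff_isUnit_det, Matrix.det_diagonal, isUnit_iff_ne_zero,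
      Finset.prod_ne_zero_iff] at h4
    exact fun i => h4 i (Finset.mem_univ i)
  obtain ⟨ν, X, h5⟩ := exists_diagonal_solution hq hc hc0 h3 (S⁻¹.val * h * S.val)
  have h1' : A = S.val * Matrix.diagonal c * S⁻¹.val := by
    rw [← h1, mul_assoc, Units.mul_inv, mul_one]
  have h2' : N = S.val * M * S⁻¹.val := by
    rw [← h2, mul_assoc, Units.mul_inv, mul_one]
  refine ⟨S.val * ν * S⁻¹.val, S.val * X * S⁻¹.val, ?_⟩
  have h6 : h = S.val * (S⁻¹.val * h * S.val) * S⁻¹.val := by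
    simp only [mul_assoc, Units.mul_inv_cancel_left, Units.mul_inv, mul_one]
  rw [h6, ← h5, h1', h2']
  simp only [mul_assoc, Units.inv_mul_cancel_left, mul_add, mul_sub, add_mul, sub_mul,
    Matrix.mul_smul, Matrix.smul_mul]

variable {d : ℕ}

omit [IsAlgClosed L] in
/-- The linearization of the equations `N_i Φ_i = p Φ_i N_{i+1}` reduces to the linearization of
`N_0 A = p^f A N_0`. -/
theorem exists_linearized_cyclic_solution {r : L} (hr0 : r ≠ 0) {f : ℕ} (hf : 0 < f)
    {Φ N : ℕ → Matrix (Fin d) (Fin d) L} (hΦ : ∀ i, IsUnit (Φ i))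
    (hN : ∀ i, N i * Φ i = r • (Φ i * N (i + 1)))
    (hN0 : N f = N 0)
    (hsurj : ∀ h, ∃ ν X, ν * prodΦ Φ 0 f - r ^ f • (prodΦ Φ 0 f * ν) + N 0 * X - r ^ f • (X * N 0) = h)
    (H : ℕ → Matrix (Fin d) (Fin d) L) :
    ∃ a ν : ℕ → Matrix (Fin d) (Fin d) L, ν f = ν 0 ∧ ∀ i,
      ν i * Φ i + N i * a i - r • (a i * N (i + 1) + Φ i * ν (i + 1)) = H i := by
  choose P hP using fun i => isUnit_prodΦ hΦ 0 i
  have hPN : ∀ i, N i = (r ^ i)⁻¹ • ((P i)⁻¹.val * N 0 * (P i).val) := fun i => by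
    rw [mul_assoc, hP, mul_prodΦ hN, zero_add, ← hP, Matrix.mul_smul, Units.inv_mul_cancel_left,
      smul_smul, inv_mul_cancel₀ (pow_ne_zero _ hr0), one_smul]
  have hPs : ∀ i, (P (i + 1)).val = (P i).val * Φ i := fun i => by
    rw [hP, hP, prodΦ_succ, zero_add]
  have hΦP : ∀ i, Φ i = (P i)⁻¹.val * (P (i + 1)).val := fun i => by
    rw [hPs, Units.inv_mul_cancel_left]
  have hP0 : P 0 = 1 := Units.ext (by rw [hP]; simp [prodΦ])
  -- Transport along `P_i = Φ_0 ⋯ Φ_{i-1}` brings all equations to index zero, where they read `μ_i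
  -- + N_0 x_i - x_i N_0 - μ_{i+1} = h_i`. These determine `μ` recursively from `ν₀`.
  let h : ℕ → Matrix (Fin d) (Fin d) L := fun i => r ^ i • ((P i).val * H i * (P (i + 1))⁻¹.val)
  obtain ⟨ν₀, X, hX⟩ := hsurj ((∑ i ∈ Finset.range f, h i) * (P f).val)
  -- A single correction at index zero suffices, because only the closing condition remains to be
  -- met.
  let x : ℕ → Matrix (Fin d) (Fin d) L := fun i => if i = 0 then X * (P f)⁻¹.val else 0
  let μ : ℕ → Matrix (Fin d) (Fin d) L := fun i =>
    ν₀ + ∑ j ∈ Finset.range i, (N 0 * x j - x j * N 0 - h j)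
  have hμ : ∀ i, μ i + (N 0 * x i - x i * N 0) - μ (i + 1) = h i := fun i => by
    simp only [μ, Finset.sum_range_succ]
    abel
  -- The closing condition `ν f = ν 0` in transported form; it is the solved equation `hX`
  -- multiplied by the inverse of `P f`.
  have hμf : μ f = r ^ f • ((P f).val * ν₀ * (P f)⁻¹.val) := by
    have hs : ∑ j ∈ Finset.range f, (N 0 * x j - x j * N 0) =
        N 0 * (X * (P f)⁻¹.val) - X * (P f)⁻¹.val * N 0 := by
      rw [Finset.sum_eq_single 0]
      · simp [x]
      · intro j _ hj
        simp [x, hj]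
      · intro h
        exact absurd (Finset.mem_range.2 hf) h
    have hA : (P f)⁻¹.val * N 0 = r ^ f • (N 0 * (P f)⁻¹.val) := by
      have := hPN f
      rw [hN0] at this
      conv_rhs => rw [this]
      rw [Matrix.smul_mul, smul_smul, mul_inv_cancel₀ (pow_ne_zero _ hr0), one_smul, mul_assoc,
        Units.mul_inv, mul_one]
    have h1 : ν₀ * (P f).val * (P f)⁻¹.val - r ^ f • ((P f).val * ν₀) * (P f)⁻¹.val +
        N 0 * X * (P f)⁻¹.val - r ^ f • (X * N 0) * (P f)⁻¹.val = ∑ i ∈ Finset.range f, h i := by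
      rw [← hP] at hX
      rw [← sub_mul, ← add_mul, ← sub_mul, hX, mul_assoc, Units.mul_inv, mul_one]
    simp only [μ]
    rw [Finset.sum_sub_distrib, hs, ← h1, mul_assoc X, hA, mul_assoc ν₀, Units.mul_inv, mul_one,
      Matrix.smul_mul, Matrix.smul_mul, Matrix.mul_smul]
    simp only [mul_assoc]
    abel
  refine ⟨fun i => (P i)⁻¹.val * x i * (P (i + 1)).val,
    fun i => (r ^ i)⁻¹ • ((P i)⁻¹.val * μ i * (P i).val), ?_, fun i => ?_⟩
  · simp only [hμf, hP0]
    rw [Matrix.mul_smul, Matrix.smul_mul, smul_smul, inv_mul_cancel₀ (pow_ne_zero _ hr0), one_smul]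
    simp [μ, mul_assoc]
  · have hH : H i = (r ^ i)⁻¹ • ((P i)⁻¹.val * h i * (P (i + 1)).val) := by
      simp only [h]
      rw [Matrix.mul_smul, Matrix.smul_mul, smul_smul, inv_mul_cancel₀ (pow_ne_zero _ hr0), one_smul]
      simp only [mul_assoc, Units.inv_mul_cancel_left, Units.inv_mul, mul_one]
    have hr1 : r * (r ^ (i + 1))⁻¹ = (r ^ i)⁻¹ := by
      rw [pow_succ, mul_inv, mul_comm, mul_assoc, inv_mul_cancel₀ hr0, mul_one]
    rw [hH, ← hμ, hPN i, hPN (i + 1), hΦP i]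
    simp only [mul_sub, mul_add, sub_mul, add_mul, Matrix.smul_mul, Matrix.mul_smul, smul_sub, smul_add,
      smul_smul, hr1, mul_assoc, Units.mul_inv_cancel_left]
    abel

end PhiNModule

namespace PhiNModule

/-! ### Matrices over the dual numbers -/

section Dual

variable {n L : Type*} [Fintype n] [DecidableEq n] [Field L]

/-- The matrix `X + ε x` over the dual numbers. -/
def dualMatrix (X x : Matrix n n L) : Matrix n n (DualNumber L) :=
  X.map TrivSqZeroExt.inl + (DualNumber.eps : DualNumber L) • x.map TrivSqZeroExt.inl

omit [DecidableEq n] in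
theorem dualMatrix_mul (X x Y y : Matrix n n L) :
    dualMatrix X x * dualMatrix Y y = dualMatrix (X * Y) (x * Y + X * y) := by
  have hm : ∀ X Y : Matrix n n L, (X * Y).map (TrivSqZeroExt.inl : L → DualNumber L) =
      X.map TrivSqZeroExt.inl * Y.map TrivSqZeroExt.inl := fun X Y =>
    Matrix.map_mul (f := TrivSqZeroExt.inlHom L L)
  have ha : ∀ X Y : Matrix n n L, (X + Y).map (TrivSqZeroExt.inl : L → DualNumber L) =
      X.map TrivSqZeroExt.inl + Y.map TrivSqZeroExt.inl := fun X Y =>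
    Matrix.map_add (TrivSqZeroExt.inlHom L L) (map_add (TrivSqZeroExt.inlHom L L)) X Y
  simp only [dualMatrix, add_mul, mul_add, Matrix.smul_mul, Matrix.mul_smul, smul_smul,
    DualNumber.eps_mul_eps, zero_smul, add_zero, hm, ha, smul_add]
  abel

omit [Fintype n] in
theorem dualMatrix_one : dualMatrix (1 : Matrix n n L) 0 = 1 := by
  ext i j <;> simp [dualMatrix, Matrix.one_apply, apply_ite]

omit [Fintype n] [DecidableEq n] in
theorem dualMatrix_sub (X x Y y : Matrix n n L) :
    dualMatrix X x - dualMatrix Y y = dualMatrix (X - Y) (x - y) := by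
  ext i j <;> simp [dualMatrix]

omit [Fintype n] [DecidableEq n] in
theorem natCast_smul_dualMatrix (q : ℕ) (X x : Matrix n n L) :
    (q : DualNumber L) • dualMatrix X x = dualMatrix ((q : L) • X) ((q : L) • x) := by
  ext i j <;> simp [dualMatrix]

end Dual

/-! ### The defining equations and first-order deformations of points -/

section Lift

variable {p : ℕ} [Fact p.Prime] {K₀ : Type*} [Field K₀] [Algebra ℚ_[p] K₀]
  (φ : K₀ ≃ₐ[ℚ_[p]] K₀)

theorem evalAt_map {R R' D : Type*} [CommRing R] [Algebra ℚ_[p] R] [CommRing R'] [Algebra ℚ_[p] R']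
    [CommRing D] [Algebra ℚ_[p] D] (h : R →ₐ[ℚ_[p]] R') (g : R' →ₐ[ℚ_[p]] D)
    (σ : K₀ →ₐ[ℚ_[p]] D) (i : ℕ) (z : R ⊗[ℚ_[p]] K₀) :
    evalAt φ g σ i (Algebra.TensorProduct.map h (AlgHom.id ℚ_[p] K₀) z) =
      evalAt φ (g.comp h) σ i z := by
  induction z using TensorProduct.induction_on with
  | zero => simp
  | tmul a b => simp
  | add x y hx hy => simp only [map_add, hx, hy]

variable [FiniteDimensional ℚ_[p] K₀] {d : ℕ}

variable (p) in
/-- The matrices whose entries have as coordinates the equations of `P_{K₀,d}`. -/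
def relMat (d : ℕ) (s : Fin 2) : Matrix (Fin d) (Fin d) (PolyRing p K₀ d ⊗[ℚ_[p]] K₀) :=
  ![genMat p K₀ d 0 * genMat p K₀ d 1 - 1,
    genMat p K₀ d 2 * genMat p K₀ d 0 - (p : PolyRing p K₀ d ⊗[ℚ_[p]] K₀) •
      (genMat p K₀ d 0 * (genMat p K₀ d 2).map (frob p φ _))] s

/-- The equations of `P_{K₀,d}`. -/
def relPoly (d : ℕ) (x : Fin 2 × Fin d × Fin d × Fin (Module.finrank ℚ_[p] K₀)) : PolyRing p K₀ d :=
  (coords p K₀ _).repr (relMat p φ d x.1 x.2.1 x.2.2.1) x.2.2.2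

theorem relIdeal_eq_span : relIdeal p φ d = Ideal.span (Set.range (relPoly φ d)) := by
  rw [relIdeal]
  congr 1
  ext a
  simp only [Set.mem_union, Set.mem_ofPred_eq, Set.mem_range, Prod.exists, Fin.exists_fin_two,
    relPoly, relMat, Matrix.cons_val_zero, Matrix.cons_val_one, eq_comm (a := a)]

variable {φ} (hφ : orderOf φ = Module.finrank ℚ_[p] K₀) {L : Type*} [Field L] [Algebra ℚ_[p] L]

/-- The components of the generic matrices at a point. -/
def genComp (φ : K₀ ≃ₐ[ℚ_[p]] K₀) {D : Type*} [CommRing D] [Algebra ℚ_[p] D]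
    (γ : PolyRing p K₀ d →ₐ[ℚ_[p]] D) (σ : K₀ →ₐ[ℚ_[p]] D) (s : Fin 3)
    (i : ℕ) : Matrix (Fin d) (Fin d) D := (genMat p K₀ d s).map (evalAt φ γ σ i)

include hφ

theorem exists_polyRing_hom {D : Type*} [CommRing D] [Algebra ℚ_[p] D] (σ : K₀ →ₐ[ℚ_[p]] D)
    (V : Fin 3 → ℕ → Matrix (Fin d) (Fin d) D) : ∃ γ : PolyRing p K₀ d →ₐ[ℚ_[p]] D,
      ∀ s, ∀ i < Module.finrank ℚ_[p] K₀, genComp φ γ σ s i = V s i := by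
  choose X hX using fun s a b => (evalAt_id_bijective φ σ hφ).2 fun i => V s i a b
  let γ : PolyRing p K₀ d →ₐ[ℚ_[p]] D :=
    MvPolynomial.aeval fun x => (coords p K₀ D).repr (X x.1 x.2.1 x.2.2.1) x.2.2.2
  refine ⟨γ, fun s i hi => ?_⟩
  have h := (baseChange_genMat_eq_iff p γ s (Matrix.of (X s))).2 fun i j k => by simp [γ]
  ext a b
  have h1 := congrFun₂ h a b
  rw [baseChange, Matrix.map_apply, Matrix.of_apply] at h1
  rw [genComp, Matrix.map_apply, ← evalAt_id_map, h1]
  exact congrFun (hX s a b) ⟨i, hi⟩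

theorem polyRing_hom_ext {D : Type*} [CommRing D] [Algebra ℚ_[p] D] (σ : K₀ →ₐ[ℚ_[p]] D)
    {γ γ' : PolyRing p K₀ d →ₐ[ℚ_[p]] D}
    (h : ∀ s, ∀ i < Module.finrank ℚ_[p] K₀, genComp φ γ σ s i = genComp φ γ' σ s i) : γ = γ' := by
  apply MvPolynomial.algHom_ext
  rintro ⟨s, i, j, k⟩
  have h1 : baseChange p γ (genMat p K₀ d s) = baseChange p γ' (genMat p K₀ d s) := by
    ext a b
    refine ext_evalAt_id φ σ hφ fun i hi => ?_
    rw [baseChange, baseChange, Matrix.map_apply, Matrix.map_apply, evalAt_id_map, evalAt_id_map]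
    exact congrFun₂ (h s i hi) a b
  rw [(baseChange_genMat_eq_iff p γ s _).1 h1, (baseChange_genMat_eq_iff p γ' s _).1 rfl]

/-- The deformations of a point to the dual numbers. -/
theorem exists_polyRing_hom_dualNumber (γ : PolyRing p K₀ d →ₐ[ℚ_[p]] L) (σ : K₀ →ₐ[ℚ_[p]] L)
    (V : Fin 3 → ℕ → Matrix (Fin d) (Fin d) L) :
    ∃ γ' : PolyRing p K₀ d →ₐ[ℚ_[p]] DualNumber L,
      (TrivSqZeroExt.fstHom ℚ_[p] L L).comp γ' = γ ∧ ∀ s, ∀ i < Module.finrank ℚ_[p] K₀,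
        genComp φ γ' ((TrivSqZeroExt.inlAlgHom ℚ_[p] L L).comp σ) s i =
          dualMatrix (genComp φ γ σ s i) (V s i) := by
  obtain ⟨γ', hγ'⟩ := exists_polyRing_hom hφ ((TrivSqZeroExt.inlAlgHom ℚ_[p] L L).comp σ)
    fun s i => dualMatrix (genComp φ γ σ s i) (V s i)
  refine ⟨γ', polyRing_hom_ext hφ σ fun s i hi => ?_, hγ'⟩
  have h1 : (TrivSqZeroExt.fstHom ℚ_[p] L L).comp ((TrivSqZeroExt.inlAlgHom ℚ_[p] L L).comp σ) = σ := by
    ext x; simp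
  ext a b
  have h2 := congrArg (TrivSqZeroExt.fstHom ℚ_[p] L L) (congrFun₂ (hγ' s i hi) a b)
  rw [genComp, Matrix.map_apply, ← evalAt_comp, h1] at h2
  rw [genComp, Matrix.map_apply, h2]
  simp [dualMatrix]

omit hφ in
theorem map_relMat_zero {D : Type*} [CommRing D] [Algebra ℚ_[p] D]
    (γ : PolyRing p K₀ d →ₐ[ℚ_[p]] D) (σ : K₀ →ₐ[ℚ_[p]] D) (i : ℕ) :
    (relMat p φ d 0).map (evalAt φ γ σ i) = genComp φ γ σ 0 i * genComp φ γ σ 1 i - 1 := by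
  change (evalAt φ γ σ i).mapMatrix _ = _
  rw [relMat, Matrix.cons_val_zero, map_sub, map_mul, map_one]
  rfl

omit hφ in
theorem map_relMat_one {D : Type*} [CommRing D] [Algebra ℚ_[p] D]
    (γ : PolyRing p K₀ d →ₐ[ℚ_[p]] D) (σ : K₀ →ₐ[ℚ_[p]] D) (i : ℕ) :
    (relMat p φ d 1).map (evalAt φ γ σ i) = genComp φ γ σ 2 i * genComp φ γ σ 0 i -
      (p : D) • (genComp φ γ σ 0 i * genComp φ γ σ 2 (i + 1)) := by
  have h1 : ((genMat p K₀ d 2).map (frob p φ _)).map (evalAt φ γ σ i) = genComp φ γ σ 2 (i + 1) := by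
    ext a b
    simp [genComp, evalAt_frob]
  have h2 : ∀ M : Matrix (Fin d) (Fin d) (PolyRing p K₀ d ⊗[ℚ_[p]] K₀), (evalAt φ γ σ i).mapMatrix
      ((p : PolyRing p K₀ d ⊗[ℚ_[p]] K₀) • M) = (p : D) • (evalAt φ γ σ i).mapMatrix M := fun M => by
    ext a b
    simp only [AlgHom.mapMatrix_apply, Matrix.map_apply, Matrix.smul_apply, smul_eq_mul, map_mul, map_natCast]
  change (evalAt φ γ σ i).mapMatrix _ = _
  rw [relMat, Matrix.cons_val_one, Matrix.cons_val_zero, map_sub, map_mul, h2, map_mul, ← h1]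
  rfl

theorem genComp_add_finrank {D : Type*} [CommRing D] [Algebra ℚ_[p] D]
    (γ : PolyRing p K₀ d →ₐ[ℚ_[p]] D) (σ : K₀ →ₐ[ℚ_[p]] D) (s : Fin 3) :
    genComp φ γ σ s (Module.finrank ℚ_[p] K₀) = genComp φ γ σ s 0 := by
  rw [genComp, genComp, ← evalAt_add_finrank φ γ σ hφ 0, zero_add]

omit hφ [FiniteDimensional ℚ_[p] K₀] in
theorem evalAt_eps_smul (σ : K₀ →ₐ[ℚ_[p]] L) (i : ℕ) (z : L ⊗[ℚ_[p]] K₀) :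
    evalAt φ (AlgHom.id ℚ_[p] (DualNumber L)) ((TrivSqZeroExt.inlAlgHom ℚ_[p] L L).comp σ) i
      ((DualNumber.eps : DualNumber L) • Algebra.TensorProduct.map
        (TrivSqZeroExt.inlAlgHom ℚ_[p] L L) (AlgHom.id ℚ_[p] K₀) z) =
      DualNumber.eps * TrivSqZeroExt.inl (evalAt φ (AlgHom.id ℚ_[p] L) σ i z) := by
  induction z using TensorProduct.induction_on with
  | zero => simp
  | tmul a b => simp [TensorProduct.smul_tmul', mul_assoc]
  | add x y hx hy => simp only [map_add, smul_add, hx, hy, TrivSqZeroExt.inl_add, mul_add]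

set_option maxHeartbeats 800000 in
/-- If the linearized equations can be solved at a point, then the differentials of the equations
of `P_{K₀,d}` are linearly independent at this point. -/
theorem mem_ker_of_sum_mem_sq (γ : PolyRing p K₀ d →ₐ[ℚ_[p]] L) (σ : K₀ →ₐ[ℚ_[p]] L)
    (hγ : ∀ x, γ (relPoly φ d x) = 0)
    (hsol : ∀ H : ℕ → Matrix (Fin d) (Fin d) L, ∃ a ν : ℕ → Matrix (Fin d) (Fin d) L,
      ν (Module.finrank ℚ_[p] K₀) = ν 0 ∧ ∀ i, ν i * genComp φ γ σ 0 i + genComp φ γ σ 2 i * a i -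
        (p : L) • (a i * genComp φ γ σ 2 (i + 1) + genComp φ γ σ 0 i * ν (i + 1)) = H i)
    (c : Fin 2 × Fin d × Fin d × Fin (Module.finrank ℚ_[p] K₀) → PolyRing p K₀ d)
    (hc : ∑ x, c x * relPoly φ d x ∈ (RingHom.ker γ) ^ 2) (x) : c x ∈ RingHom.ker γ := by
  classical
  -- The target is a deformation along which the equation `x` has derivative one and all other
  -- equations have derivative zero.
  let t : Fin 2 × Fin d × Fin d × Fin (Module.finrank ℚ_[p] K₀) → L := Pi.single x 1
  let T : Fin 2 → Matrix (Fin d) (Fin d) (L ⊗[ℚ_[p]] K₀) := fun s => Matrix.of fun a b =>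
    (coords p K₀ L).equivFun.symm fun k => t (s, a, b, k)
  let τ : Fin 2 → ℕ → Matrix (Fin d) (Fin d) L := fun s i =>
    (T s).map (evalAt φ (AlgHom.id ℚ_[p] L) σ i)
  have hrel : ∀ s i, (relMat p φ d s).map (evalAt φ γ σ i) = 0 := fun s i => by
    ext a b
    rw [Matrix.map_apply, Matrix.zero_apply]
    have h : ∀ k, γ ((coords p K₀ _).repr (relMat p φ d s a b) k) = 0 := fun k => hγ (s, a, b, k)
    exact (forall_evalAt_eq_zero_iff hφ γ σ (relMat p φ d s a b)).2 h i
  have h1 : ∀ i, genComp φ γ σ 0 i * genComp φ γ σ 1 i = 1 := fun i => by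
    rw [← sub_eq_zero, ← map_relMat_zero, hrel]
  have h2 : ∀ i, genComp φ γ σ 2 i * genComp φ γ σ 0 i -
      (p : L) • (genComp φ γ σ 0 i * genComp φ γ σ 2 (i + 1)) = 0 := fun i => by
    rw [← map_relMat_one, hrel]
  obtain ⟨a, ν, hν, haν⟩ := hsol (τ 1)
  -- With `Φ' = Φ⁻¹`, the middle direction `b` is dictated by `a Φ' + Φ b = τ 0`; the other two
  -- directions come from the linearized equation in `N`.
  obtain ⟨γ', hγ', hV⟩ := exists_polyRing_hom_dualNumber hφ γ σ
    ![a, fun i => genComp φ γ σ 1 i * (τ 0 i - a i * genComp φ γ σ 1 i), ν]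
  let σ' : K₀ →ₐ[ℚ_[p]] DualNumber L := (TrivSqZeroExt.inlAlgHom ℚ_[p] L L).comp σ
  have hV2 : ∀ i < Module.finrank ℚ_[p] K₀, genComp φ γ' σ' 2 (i + 1) = dualMatrix (genComp φ γ σ 2 (i + 1)) (ν (i + 1)) := by
    intro i hi
    rcases Nat.lt_or_ge (i + 1) (Module.finrank ℚ_[p] K₀) with h | h
    · exact hV 2 _ h
    · have h3 : i + 1 = Module.finrank ℚ_[p] K₀ := le_antisymm hi h
      rw [h3, hν, genComp_add_finrank hφ, genComp_add_finrank hφ]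
      exact hV 2 0 (by omega)
  have hcomp : ∀ s, ∀ i < Module.finrank ℚ_[p] K₀, (relMat p φ d s).map (evalAt φ γ' σ' i) = dualMatrix 0 (τ s i) := by
    intro s i hi
    have e0 : genComp φ γ' σ' 0 i = dualMatrix (genComp φ γ σ 0 i) (a i) := hV 0 i hi
    have e1 : genComp φ γ' σ' 1 i = dualMatrix (genComp φ γ σ 1 i)
      (genComp φ γ σ 1 i * (τ 0 i - a i * genComp φ γ σ 1 i)) := hV 1 i hi
    have e2 : genComp φ γ' σ' 2 i = dualMatrix (genComp φ γ σ 2 i) (ν i) := hV 2 i hi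
    fin_cases s
    · refine (map_relMat_zero γ' σ' i).trans ?_
      rw [e0, e1, dualMatrix_mul, ← dualMatrix_one, dualMatrix_sub, h1, sub_self, ← mul_assoc, h1,
        one_mul, sub_zero, add_sub_cancel]
      rfl
    · refine (map_relMat_one γ' σ' i).trans ?_
      rw [e0, e2, hV2 i hi, dualMatrix_mul, dualMatrix_mul, natCast_smul_dualMatrix,
        dualMatrix_sub, h2, haν]
      rfl
  have hval : ∀ y, γ' (relPoly φ d y) = DualNumber.eps * TrivSqZeroExt.inl (t y) := by
    rintro ⟨s, i, j, k⟩
    have h3 : Algebra.TensorProduct.map γ' (AlgHom.id ℚ_[p] K₀) (relMat p φ d s i j) =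
        (DualNumber.eps : DualNumber L) • Algebra.TensorProduct.map
          (TrivSqZeroExt.inlAlgHom ℚ_[p] L L) (AlgHom.id ℚ_[p] K₀) (T s i j) := by
      refine ext_evalAt_id φ σ' hφ fun l hl => ?_
      rw [evalAt_id_map]
      refine (congrFun₂ (hcomp s l hl) i j).trans ?_
      rw [evalAt_eps_smul]
      simp [dualMatrix, τ]
    rw [relPoly, ← coords_repr_map, h3, map_smul, Finsupp.smul_apply, coords_repr_map, smul_eq_mul]
    congr 1
    simp only [T, Matrix.of_apply]
    rw [← Module.Basis.equivFun_apply, LinearEquiv.apply_symm_apply]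
    rfl
  have hfst : ∀ y, TrivSqZeroExt.fst (γ' y) = γ y := fun y => AlgHom.congr_fun hγ' y
  -- Elements of the kernel map to multiples of `ε`, so products of two of them vanish. Applied to
  -- the given combination, only the term of index `x` survives and yields the vanishing of `γ (c
  -- x)`.
  have hsq : ∀ y ∈ (RingHom.ker γ) ^ 2, γ' y = 0 := by
    intro y hy
    rw [pow_two] at hy
    refine Submodule.mul_induction_on hy (fun u hu v hv => ?_) fun u v hu hv => by rw [map_add, hu, hv, add_zero]
    have hu' := (hfst u).trans hu
    have hv' := (hfst v).trans hv
    rw [map_mul]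
    ext <;> simp [hu', hv']
  have h5 := congrArg TrivSqZeroExt.snd (hsq _ hc)
  rw [map_sum, TrivSqZeroExt.snd_sum] at h5
  simp only [map_mul, hval] at h5
  rw [Finset.sum_eq_single x] at h5
  · simpa [t, hfst] using h5
  · intro y _ hy
    simp [t, hy]
  · simp

end Lift

end PhiNModule

/-! ### Geometry of the coordinate ring -/

namespace PhiNModule

variable {p : ℕ} [Fact p.Prime] {K₀ : Type*} [Field K₀] [Algebra ℚ_[p] K₀] {d : ℕ}
  [FiniteDimensional ℚ_[p] K₀] {φ : K₀ ≃ₐ[ℚ_[p]] K₀} (hφ : orderOf φ = Module.finrank ℚ_[p] K₀)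

theorem ker_toAlgHom_geomField (y : PrimeSpectrum (PRing p φ d)) :
    RingHom.ker (IsScalarTower.toAlgHom ℚ_[p] (PRing p φ d) (GeomField p φ d y)) = y.asIdeal := by
  change RingHom.ker (algebraMap (PRing p φ d) (GeomField p φ d y)) = y.asIdeal
  rw [IsScalarTower.algebraMap_eq (PRing p φ d) y.asIdeal.ResidueField (GeomField p φ d y),
    ← RingHom.comap_ker,
    (RingHom.injective_iff_ker_eq_bot _).1 (algebraMap y.asIdeal.ResidueField _).injective,
    ← RingHom.ker_eq_comap_bot, Ideal.ker_algebraMap_residueField]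

include hφ

/-- The differentials of the equations of `P_{K₀,d}` are linearly independent at the generic
points. -/
theorem mem_comap_of_sum_mem_sq (𝔭 : Ideal (PRing p φ d)) (h𝔭 : 𝔭 ∈ minimalPrimes (PRing p φ d))
    (c : Fin 2 × Fin d × Fin d × Fin (Module.finrank ℚ_[p] K₀) → PolyRing p K₀ d)
    (hc : ∑ x, c x * relPoly φ d x ∈ (𝔭.comap (mkP p φ d : PolyRing p K₀ d →+* PRing p φ d)) ^ 2)
    (x) : c x ∈ 𝔭.comap (mkP p φ d : PolyRing p K₀ d →+* PRing p φ d) := by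
  let y : PrimeSpectrum (PRing p φ d) := ⟨𝔭, h𝔭.1.1⟩
  let g : PRing p φ d →ₐ[ℚ_[p]] GeomField p φ d y := IsScalarTower.toAlgHom ℚ_[p] _ _
  let σ : K₀ →ₐ[ℚ_[p]] GeomField p φ d y := IsAlgClosed.lift
  have : CharZero (GeomField p φ d y) :=
    charZero_of_injective_algebraMap (algebraMap ℚ_[p] (GeomField p φ d y)).injective
  have hker : RingHom.ker g = 𝔭 := ker_toAlgHom_geomField y
  obtain ⟨π, hπ⟩ := (range_genericIdeal hφ).symm.subset h𝔭
  have hgπ : RingHom.ker g = genericIdeal hφ π := hker.trans hπ.symm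
  have hγ : RingHom.ker (g.comp (mkP p φ d)) =
      𝔭.comap (mkP p φ d : PolyRing p K₀ d →+* PRing p φ d) := by
    ext z
    rw [Ideal.mem_comap, ← hker]
    rfl
  have hp0 : (p : GeomField p φ d y) ≠ 0 := Nat.cast_ne_zero.2 (Fact.out : p.Prime).ne_zero
  have h0 : ∀ i, genComp φ (g.comp (mkP p φ d)) σ 0 i = compΦ φ g σ i := fun i => by
    ext a b
    exact (evalAt_map φ (mkP p φ d) g σ i _).symm
  have h2 : ∀ i, genComp φ (g.comp (mkP p φ d)) σ 2 i = compN φ g σ i := fun i => by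
    ext a b
    exact (evalAt_map φ (mkP p φ d) g σ i _).symm
  rw [← hγ] at hc ⊢
  refine mem_ker_of_sum_mem_sq hφ (g.comp (mkP p φ d)) σ (fun x => ?_) (fun H => ?_) c hc x
  · rw [AlgHom.comp_apply, mkP_eq_zero p φ d, map_zero]
    rw [relIdeal_eq_span]
    exact Ideal.subset_span ⟨x, rfl⟩
  · simp only [h0, h2]
    refine exists_linearized_cyclic_solution hp0 Module.finrank_pos (isUnit_compΦ φ g σ)
      (compN_mul_compΦ φ g σ) ?_ ?_ H
    · rw [← compN_add_finrank g σ hφ 0, zero_add]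
    · rw [← compA_eq, ← Nat.cast_pow]
      refine exists_linearized_solution (natCast_pow_injective
        (Nat.one_lt_pow Module.finrank_pos.ne' (Fact.out : p.Prime).one_lt)) (isUnit_compA φ g σ)
        (roots_nodup_of_ker_eq hφ g σ hgπ) (compN_mul_compA g σ hφ) ?_
      rw [Fintype.card_fin]
      exact le_rank_add_rank_of_ker_eq hφ g σ hgπ

omit hφ in
theorem mkP_surjective : Function.Surjective (mkP p φ d : PolyRing p K₀ d →+* PRing p φ d) :=
  Ideal.Quotient.mk_surjective

omit hφ in
theorem ker_mkP : RingHom.ker (mkP p φ d : PolyRing p K₀ d →+* PRing p φ d) =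
    Ideal.span (Set.range (relPoly φ d)) := by
  rw [← relIdeal_eq_span]
  exact Ideal.mk_ker

omit hφ in
theorem isNoetherianRing_pRing : IsNoetherianRing (PRing p φ d) :=
  isNoetherianRing_of_surjective _ _ _ mkP_surjective

theorem isCohenMacaulayLocalRing_pRing (𝔭 : Ideal (PRing p φ d)) [𝔭.IsPrime] :
    IsCohenMacaulayLocalRing (Localization.AtPrime 𝔭) :=
  have := isNoetherianRing_pRing (φ := φ) (d := d)
  isCohenMacaulayLocalRing_localization_atPrime mkP_surjective ker_mkP
    (mem_comap_of_sum_mem_sq hφ) 𝔭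

theorem isReduced_pRing : IsReduced (PRing p φ d) :=
  have := isNoetherianRing_pRing (φ := φ) (d := d)
  isReduced_of_completeIntersection mkP_surjective ker_mkP (mem_comap_of_sum_mem_sq hφ)

/-- There are `3 f d ^ 2` coordinates and `2 f d ^ 2` equations, the auxiliary inverse of `Φ` being
included in both counts. -/
theorem ringKrullDim_pRing_quotient (𝔭 : Ideal (PRing p φ d)) (h𝔭 : 𝔭 ∈ minimalPrimes (PRing p φ d)) :
    ringKrullDim (PRing p φ d ⧸ 𝔭) = (Module.finrank ℚ_[p] K₀ * d ^ 2 : ℕ) := by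
  have h := ringKrullDim_quotient_add_card mkP_surjective ker_mkP (mem_comap_of_sum_mem_sq hφ) h𝔭
  rw [Nat.card_eq_fintype_card, Fintype.card_prod, Fintype.card_prod, Fintype.card_prod,
    Fintype.card_prod, Fintype.card_prod, Fintype.card_prod, Fintype.card_fin, Fintype.card_fin,
    Fintype.card_fin, Fintype.card_fin] at h
  generalize ringKrullDim (PRing p φ d ⧸ 𝔭) = x at h ⊢
  set f := Module.finrank ℚ_[p] K₀
  have h3 : 3 * (d * (d * f)) = f * d ^ 2 + 2 * (d * (d * f)) := by ring
  rw [h3, Nat.cast_add] at h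
  exact ENat.WithBot.add_natCast_cancel.1 h

end PhiNModule

/-! ### Passage from rings to affine schemes -/

theorem IsCohenMacaulayLocalRing.of_ringEquiv {A B : Type u} [CommRing A] [CommRing B] [IsLocalRing A]
    [IsLocalRing B] (h : IsCohenMacaulayLocalRing A) (e : A ≃+* B) : IsCohenMacaulayLocalRing B := by
  obtain ⟨h1, rs, h2, h3⟩ := h
  refine ⟨isNoetherianRing_of_ringEquiv A e, rs.map e, ?_, ?_⟩
  · refine (e.toAddEquiv.isRegular_congr (List.forall₂_map_right_iff.mpr
      (List.forall₂_same.mpr fun r _ x => ?_))).1 h2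
    exact map_mul e r x
  · rw [List.length_map, h3, ringKrullDim_eq_of_ringEquiv e]

theorem isCohenMacaulayScheme_spec {R : CommRingCat.{u}} [IsNoetherianRing R]
    (h : ∀ (𝔭 : Ideal R) [_h : 𝔭.IsPrime], IsCohenMacaulayLocalRing (Localization.AtPrime 𝔭)) :
    IsCohenMacaulayScheme (Spec R) :=
  ⟨inferInstance, fun x => (h (PrimeSpectrum.asIdeal x) (_h := PrimeSpectrum.isPrime x)).of_ringEquiv
    (Spec.stalkIso R x).commRingCatIsoToRingEquiv.symm⟩

theorem PrimeSpectrum.topologicalKrullDim_zeroLocus {R : Type u} [CommRing R] (I : Ideal R) :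
    topologicalKrullDim (PrimeSpectrum.zeroLocus (I : Set R)) = ringKrullDim (R ⧸ I) := by
  rw [← PrimeSpectrum.topologicalKrullDim_eq_ringKrullDim]
  have h := PrimeSpectrum.isEmbedding_comap_of_surjective _ (Ideal.Quotient.mk I)
    Ideal.Quotient.mk_surjective
  have hr : Set.range (PrimeSpectrum.comap (Ideal.Quotient.mk I)) = PrimeSpectrum.zeroLocus I := by
    rw [range_comap_of_surjective _ _ Ideal.Quotient.mk_surjective, Ideal.mk_ker]
  rw [← hr]
  exact (IsHomeomorph.topologicalKrullDim_eq _ h.toHomeomorph.isHomeomorph).symm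

theorem isEquidimensionalOfDim_spec {R : CommRingCat.{u}} {n : ℕ}
    (h : ∀ 𝔭 ∈ minimalPrimes R, ringKrullDim (R ⧸ 𝔭) = n) : IsEquidimensionalOfDim (Spec R) n := by
  intro Z hZ
  obtain ⟨𝔭, h𝔭, rfl⟩ := (PrimeSpectrum.zeroLocus_minimalPrimes R).symm.subset hZ
  exact (PrimeSpectrum.topologicalKrullDim_zeroLocus 𝔭).trans (h 𝔭 h𝔭)

theorem isGenericallySmooth_of_perfectField {K : Type u} [Field K] [PerfectField K] {X : Scheme.{u}}
    [IsReduced X] (f : X ⟶ Spec (.of K)) [LocallyOfFinitePresentation f] : IsGenericallySmooth f := by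
  refine ⟨f.smoothLocus, f.dense_smoothLocus_of_perfectField, ?_⟩
  rw [← Scheme.Hom.smoothLocus_eq_top_iff, ← Scheme.Hom.preimage_smoothLocus_eq]
  simp

theorem mem_genericPoints_primeSpectrum_iff {R : Type u} [CommRing R] (y : PrimeSpectrum R) :
    y ∈ genericPoints (PrimeSpectrum R) ↔ y.asIdeal ∈ minimalPrimes R := by
  rw [← PrimeSpectrum.vanishingIdeal_singleton, PrimeSpectrum.vanishingIdeal_mem_minimalPrimes]
  rfl

/-! ### Generic points and their partitions -/

namespace PhiNModule

variable {p : ℕ} [Fact p.Prime] {K₀ : Type*} [Field K₀] [Algebra ℚ_[p] K₀] {d : ℕ}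
  [FiniteDimensional ℚ_[p] K₀] {φ : K₀ ≃ₐ[ℚ_[p]] K₀} (hφ : orderOf φ = Module.finrank ℚ_[p] K₀)

theorem evalZero_eq (y : PrimeSpectrum (PRing p φ d)) (σ : K₀ →ₐ[ℚ_[p]] GeomField p φ d y) :
    evalZero p φ d y σ = evalAt φ
      (IsScalarTower.toAlgHom ℚ_[p] (PRing p φ d) (GeomField p φ d y)) σ 0 := by
  rw [evalAt, embPow_zero]
  rfl

theorem phiPowZero_eq (y : PrimeSpectrum (PRing p φ d)) (σ : K₀ →ₐ[ℚ_[p]] GeomField p φ d y) :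
    phiPowZero p φ d y σ = compA φ
      (IsScalarTower.toAlgHom ℚ_[p] (PRing p φ d) (GeomField p φ d y)) σ := by
  rw [phiPowZero, evalZero_eq]
  rfl

theorem monodromyZero_eq (y : PrimeSpectrum (PRing p φ d)) (σ : K₀ →ₐ[ℚ_[p]] GeomField p φ d y) :
    monodromyZero p φ d y σ = compN φ
      (IsScalarTower.toAlgHom ℚ_[p] (PRing p φ d) (GeomField p φ d y)) σ 0 := by
  rw [monodromyZero, evalZero_eq]
  rfl

theorem locallyOfFinitePresentation_pStruct : LocallyOfFinitePresentation (PStruct p φ d) := by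
  rw [PStruct, LocallyOfFinitePresentation.SpecMap_iff]
  change (algebraMap ℚ_[p] (PRing p φ d)).FinitePresentation
  rw [RingHom.finitePresentation_algebraMap, ← Algebra.FinitePresentation.of_finiteType]
  exact Algebra.FiniteType.of_surjective (mkP p φ d) mkP_surjective

include hφ

theorem exists_genericIdeal_eq {y : PrimeSpectrum (PRing p φ d)}
    (hy : y ∈ genericPoints (PrimeSpectrum (PRing p φ d))) : ∃ π, genericIdeal hφ π = y.asIdeal :=
  (range_genericIdeal hφ).symm.subset ((mem_genericPoints_primeSpectrum_iff y).1 hy)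

theorem roots_nodup_phiPowZero {y : PrimeSpectrum (PRing p φ d)}
    (hy : y ∈ genericPoints (PrimeSpectrum (PRing p φ d)))
    (σ : K₀ →ₐ[ℚ_[p]] GeomField p φ d y) : (phiPowZero p φ d y σ).charpoly.roots.Nodup := by
  obtain ⟨π, hπ⟩ := exists_genericIdeal_eq hφ hy
  rw [phiPowZero_eq]
  exact roots_nodup_of_ker_eq hφ _ σ ((ker_toAlgHom_geomField y).trans hπ.symm)

/-- The bijection between the partitions of `d` and the generic points of `P_{K₀,d}`. -/
def partitionEquiv :
    d.Partition ≃ genericPoints (PrimeSpectrum (PRing p φ d)) :=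
  Equiv.ofBijective (fun π => ⟨⟨genericIdeal hφ π, isPrime_genericIdeal hφ π⟩,
    (mem_genericPoints_primeSpectrum_iff _).2 ((range_genericIdeal hφ).subset ⟨π, rfl⟩)⟩)
    ⟨fun π μ h => genericIdeal_injective hφ (congrArg (fun y => PrimeSpectrum.asIdeal y.1) h), fun y => by
      obtain ⟨π, hπ⟩ := exists_genericIdeal_eq hφ y.2
      exact ⟨π, Subtype.ext (PrimeSpectrum.ext hπ)⟩⟩

theorem hasEigenvalueChains_and_hasNilpotentJordanType_iff {y : PrimeSpectrum (PRing p φ d)}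
    (σ : K₀ →ₐ[ℚ_[p]] GeomField p φ d y) {μ : d.Partition} (hy : genericIdeal hφ μ = y.asIdeal)
    (π : d.Partition) :
    (HasEigenvalueChains (p ^ Module.finrank ℚ_[p] K₀) (phiPowZero p φ d y σ) π ↔ π = μ) ∧
    (HasNilpotentJordanType (monodromyZero p φ d y σ) π ↔ π = μ) := by
  let g := IsScalarTower.toAlgHom ℚ_[p] (PRing p φ d) (GeomField p φ d y)
  have hg : RingHom.ker g = genericIdeal hφ μ := (ker_toAlgHom_geomField _).trans hy.symm
  have : CharZero (GeomField p φ d y) := charZero_of_injective_algebraMap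
    (algebraMap ℚ_[p] (GeomField p φ d y)).injective
  have h1 : 1 < p ^ Module.finrank ℚ_[p] K₀ :=
    Nat.one_lt_pow Module.finrank_pos.ne' (Fact.out : p.Prime).one_lt
  have hq0 : ((p ^ Module.finrank ℚ_[p] K₀ : ℕ) : GeomField p φ d y) ≠ 0 :=
    Nat.cast_ne_zero.2 (by omega)
  obtain ⟨ν, hν⟩ := exists_partition_forall_iff hq0 (natCast_pow_injective h1) (isUnit_compA φ g σ)
    (roots_nodup_of_ker_eq hφ g σ hg) (compN_mul_compA g σ hφ)
    (le_rank_add_rank_of_ker_eq hφ g σ hg)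
  -- The partition supplied by linear algebra is identified with that of the stratum through the
  -- Jordan type at the generic point.
  obtain rfl : μ = ν := (hν μ).2.1 (hasNilpotentJordanType_of_ker_eq hφ g σ hg)
  rw [phiPowZero_eq, monodromyZero_eq]
  exact hν π

theorem partitionEquiv_eq_iff (y : genericPoints (PrimeSpectrum (PRing p φ d)))
    (σ : K₀ →ₐ[ℚ_[p]] GeomField p φ d y.1) (π : d.Partition) :
    (partitionEquiv hφ π = y ↔ HasEigenvalueChains (p ^ Module.finrank ℚ_[p] K₀)
      (phiPowZero p φ d y.1 σ) π) ∧
    (partitionEquiv hφ π = y ↔ HasNilpotentJordanType (monodromyZero p φ d y.1 σ) π) := by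
  obtain ⟨μ, hμ⟩ := (partitionEquiv hφ).surjective y
  have h := hasEigenvalueChains_and_hasNilpotentJordanType_iff hφ (y := y.1) σ (μ := μ)
    (by rw [← hμ]; rfl) π
  rw [h.1, h.2, ← hμ, (partitionEquiv hφ).injective.eq_iff]
  exact ⟨Iff.rfl, Iff.rfl⟩

end PhiNModule

end

theorem mainTheorem3 (p : ℕ) [Fact p.Prime] (K₀ : Type*) [Field K₀] [Algebra ℚ_[p] K₀]
    [FiniteDimensional ℚ_[p] K₀] [Algebra ℤ_[p] K₀] [IsScalarTower ℤ_[p] ℚ_[p] K₀]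
    (hK₀ : PhiNModule.IsUnramified p K₀)
    (φ : K₀ ≃ₐ[ℚ_[p]] K₀) (hφ : PhiNModule.IsFrobenius p K₀ φ) (d : ℕ) :
    (IsReduced (PhiNModule.P p φ d) ∧
      IsCohenMacaulayScheme (PhiNModule.P p φ d) ∧
      IsGenericallySmooth (PhiNModule.PStruct p φ d) ∧
      IsEquidimensionalOfDim (PhiNModule.P p φ d) (Module.finrank ℚ_[p] K₀ * d ^ 2) ∧
      ∀ y ∈ genericPoints (PhiNModule.P p φ d), ∀ σ : K₀ →ₐ[ℚ_[p]] PhiNModule.GeomField p φ d y,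
        (PhiNModule.phiPowZero p φ d y σ).charpoly.roots.Nodup) ∧
    ∃ e : d.Partition ≃ genericPoints (PhiNModule.P p φ d),
      ∀ (y : genericPoints (PhiNModule.P p φ d))
        (σ : K₀ →ₐ[ℚ_[p]] PhiNModule.GeomField p φ d y.1) (π : d.Partition),
        (e π = y ↔ PhiNModule.HasEigenvalueChains (p ^ Module.finrank ℚ_[p] K₀)
          (PhiNModule.phiPowZero p φ d y.1 σ) π) ∧
        (e π = y ↔ PhiNModule.HasNilpotentJordanType (PhiNModule.monodromyZero p φ d y.1 σ) π) := by
  -- The arithmetic hypotheses on `K₀` and `φ` enter only through this equality.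
  have hord : orderOf φ = Module.finrank ℚ_[p] K₀ := PhiNModule.orderOf_frobenius hK₀ hφ
  have hnoeth : IsNoetherianRing (CommRingCat.of (PhiNModule.PRing p φ d)) :=
    PhiNModule.isNoetherianRing_pRing
  have hred : _root_.IsReduced (CommRingCat.of (PhiNModule.PRing p φ d)) :=
    PhiNModule.isReduced_pRing hord
  have hfp : LocallyOfFinitePresentation (PhiNModule.PStruct p φ d) :=
    PhiNModule.locallyOfFinitePresentation_pStruct
  refine ⟨⟨inferInstance, isCohenMacaulayScheme_spec fun 𝔭 _ =>
    PhiNModule.isCohenMacaulayLocalRing_pRing hord 𝔭,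
    isGenericallySmooth_of_perfectField _, isEquidimensionalOfDim_spec fun 𝔭 h𝔭 =>
      PhiNModule.ringKrullDim_pRing_quotient hord 𝔭 h𝔭,
    fun y hy σ => PhiNModule.roots_nodup_phiPowZero hord hy σ⟩,
    PhiNModule.partitionEquiv hord, PhiNModule.partitionEquiv_eq_iff hord⟩
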